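/- Let $X$ be a metric space with its Borel $\sigma$-algebra and let $\sigma$ be a nonzero, finite, diffuse (i.e. non-atomic) Borel measure on $X$. Let $\Omega$ be the space of configurations, i.e. of countable subsets $\omega\subset X$ having finitely many points in each compact set, identified with the measures $\omega=\sum_{x\in\omega}\delta_x$, with the $\sigma$-algebra generated by the maps $\omega\mapsto\omega(B)$, $B$ Borel. Let $\pi$ be the Poisson measure on $\Omega$ with intensity $\sigma$, i.e. $\pi(\omega(A_1)=k_1,\dots,\omega(A_n)=k_n)=\prod_{i=1}^n e^{-\sigma(A_i)}\sigma(A_i)^{k_i}/k_i!$ for disjoint Borel sets $A_i$ and $k_i\in\mathbb N$. Expectation $E$ and variance are taken under $\pi$. For measurable $F:\Omega\to\mathbb R$ let $D_xF(\omega)=F(\omega)-F(\omega+\delta_x)$ if $x\notin\omega$ and $D_xF(\omega)=F(\omega)-F(\omega-\delta_x)$ if $x\in\omega$; let $D^+_xF=\max(0,D_xF)$ and $D^-_xF=-\min(0,D_xF)$. Write $|\cdot|_p$ for the norm of $L^p(X,\frac{\sigma+\omega}{2})$, a function of $\omega$. For $T\in\{D,D^+,D^-\}$ and $p\in[1,\infty]$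 put $$h_p(T)=\inf_{0<\pi(A)<1/2}\frac{E[|T1_A|_p]}{\pi(A)},\qquad \lambda_p(T)=\inf_{F}\frac{E[|TF|_p^2]}{\operatorname{Var}(F)},$$ the first infimum being over measurable $A\subset\Omega$ and the second over the $F\in L^2(\pi)$ that are not a.s. constant. Write $h_p=h_p(D)$, $h_p^\pm=h_p(D^\pm)$, $\lambda_p=\lambda_p(D)$, $\lambda_p^\pm=\lambda_p(D^\pm)$. Let $k_\infty^+=\inf E[|D^+F|_\infty]/E[(F-m)^+]$ over all integrable $F$ that are not a.s. constant and all medians $m$ of $F$. Then: 1. $\lambda_2=2\lambda_2^+=2\lambda_2^-=1$. 2. $\lambda_\infty=\dfrac1{\sigma(X)}$. 3. $\dfrac1{\sqrt{2\pi}}\le h_2$ (here and in 4. under the root, $\pi$ is the number). 4. $\max\left(\dfrac1{\sqrt{\pi\sigma(X)}},\dfrac1{2\sigma(X)}\right)\le h_\infty\le\dfrac4{\sigma(X)}+\dfrac4{\sqrt{\sigma(X)}}$. 5. $\dfrac12\le h_1=2h_1^+=2h_1^-\le4+4\sqrt{\sigma(X)}$. 6. $(h_2^+)^2\le h_1^+$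 and $h_2^+\le\sqrt{1+\sqrt{\sigma(X)}}$. 7. $\lambda_\infty^+\le2h_\infty^+$, and $\dfrac{h_\infty^+}2=\dfrac{k_\infty^+}2\le\sqrt{\lambda_\infty}=\dfrac1{\sqrt{\sigma(X)}}$. 8. $\lambda_\infty^-\le2h_\infty^-$, and $\dfrac{h_\infty^-}2\le\dfrac1{\sigma(X)}+\sqrt{\dfrac2{\sigma(X)}}$. -/

import Mathlib

open MeasureTheory ProbabilityTheory
open scoped ENNReal

/-- A finite measure is diffuse (non-atomic) if every measurable set of positive measure contains a
measurable subset of strictly smaller positive measure. In particular singletons are null; on a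
separable metric space with its Borel sets this is equivalent to singletons being null. -/
def IsDiffuse {X : Type*} [MeasurableSpace X] (σ : Measure X) : Prop :=
  ∀ B : Set X, MeasurableSet B → 0 < σ B → ∃ C ⊆ B, MeasurableSet C ∧ 0 < σ C ∧ σ C < σ B

/-- A configuration of points of `X`: a countable subset which has finitely many points in every
compact set. It is identified with the Radon measure `∑ δ_x`, see `Configuration.toMeasure`. -/
@[ext]
structure Configuration (X : Type*) [TopologicalSpace X] where
  carrier : Set X
  countable_carrier : carrier.Countable
  finite_inter_compact : ∀ K : Set X, IsCompact K → (carrier ∩ K).Finite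

namespace Configuration

variable {X : Type*} [TopologicalSpace X]

/-- The measure `ω = ∑_{x ∈ ω} δ_x`. -/
noncomputable def toMeasure [MeasurableSpace X] (ω : Configuration X) : Measure X :=
  Measure.sum fun x : ω.carrier => Measure.dirac (x : X)

/-- The σ-algebra generated by the maps `ω ↦ ω(B)` with `B` measurable, i.e. the one induced by
the usual σ-algebra on the space of measures on `X`. -/
noncomputable instance [MeasurableSpace X] : MeasurableSpace (Configuration X) :=
  MeasurableSpace.comap Configuration.toMeasure inferInstance

/-- The configuration `ω ∪ {x}`; it is `ω + δ_x` if `x ∉ ω`. -/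
def add (ω : Configuration X) (x : X) : Configuration X where
  carrier := insert x ω.carrier
  countable_carrier := ω.countable_carrier.insert x
  finite_inter_compact K hK := by
    refine ((ω.finite_inter_compact K hK).insert x).subset ?_
    rintro y ⟨rfl | hy, hyK⟩
    · exact Set.mem_insert _ _
    · exact Set.mem_insert_of_mem _ ⟨hy, hyK⟩

/-- The configuration `ω \ {x}`; it is `ω - δ_x` if `x ∈ ω`. -/
def remove (ω : Configuration X) (x : X) : Configuration X where
  carrier := ω.carrier \ {x}
  countable_carrier := ω.countable_carrier.mono Set.sdiff_subset
  finite_inter_compact K hK :=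
    (ω.finite_inter_compact K hK).subset (Set.inter_subset_inter_left K Set.sdiff_subset)

end Configuration

section Poisson

variable {X : Type*} [TopologicalSpace X] [MeasurableSpace X]

/-- `P` is the Poisson measure with (finite) intensity `σ` on the configuration space: for disjoint
measurable sets `A₁, …, Aₙ`, the numbers of points in the `Aᵢ` are independent Poisson variables
with parameters `σ(Aᵢ)`. -/
def IsPoissonMeasure (σ : Measure X) (P : Measure (Configuration X)) : Prop :=
  ∀ (n : ℕ) (A : Fin n → Set X), (∀ i, MeasurableSet (A i)) →
    (∀ i j, i ≠ j → Disjoint (A i) (A j)) → ∀ k : Fin n → ℕ,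
      P {ω | ∀ i, ω.toMeasure (A i) = (k i : ℝ≥0∞)} =
        ∏ i, ENNReal.ofReal
          (σ.real (A i) ^ k i / (Nat.factorial (k i) : ℝ) * Real.exp (-σ.real (A i)))

open Classical in
/-- The finite difference gradient: `D_x F(ω) = F(ω) - F(ω + δ_x)` if `x ∉ ω` and
`D_x F(ω) = F(ω) - F(ω - δ_x)` if `x ∈ ω`. -/
noncomputable def diffOp (F : Configuration X → ℝ) (ω : Configuration X) (x : X) : ℝ :=
  if x ∈ ω.carrier then F ω - F (ω.remove x) else F ω - F (ω.add x)

/-- `D⁺_x F = max (0, D_x F)`. -/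
noncomputable def diffPlus (F : Configuration X → ℝ) (ω : Configuration X) (x : X) : ℝ :=
  max 0 (diffOp F ω x)

/-- `D⁻_x F = - min (0, D_x F)`. -/
noncomputable def diffMinus (F : Configuration X → ℝ) (ω : Configuration X) (x : X) : ℝ :=
  -min 0 (diffOp F ω x)

/-- The norm of `x ↦ u(ω, x)` in `L^p((σ + ω)/2)`, `p ∈ [1, ∞]`. -/
noncomputable def fieldNorm (σ : Measure X) (p : ℝ≥0∞) (u : Configuration X → X → ℝ)
    (ω : Configuration X) : ℝ≥0∞ :=
  eLpNorm (u ω) p ((2 : ℝ≥0∞)⁻¹ • (σ + ω.toMeasure))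

/-- `F` is (almost surely) equal to a constant. -/
def IsAEConst (P : Measure (Configuration X)) (F : Configuration X → ℝ) : Prop :=
  ∃ c : ℝ, F =ᵐ[P] fun _ => c

/-- `m` is a median of the random variable `F`. -/
def IsMedian (P : Measure (Configuration X)) (F : Configuration X → ℝ) (m : ℝ) : Prop :=
  2⁻¹ ≤ P {ω | F ω ≤ m} ∧ 2⁻¹ ≤ P {ω | m ≤ F ω}

/-- The isoperimetric constant
`inf { E[|T 1_A|_{L^p((σ+ω)/2)}] / P(A) : 0 < P(A) < 1/2 }`,
where `T` is one of the gradients `D`, `D⁺`, `D⁻`. These are `h_p`, `h_p⁺`, `h_p⁻`. -/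
noncomputable def isoperimetricConst (σ : Measure X) (P : Measure (Configuration X)) (p : ℝ≥0∞)
    (T : (Configuration X → ℝ) → Configuration X → X → ℝ) : ℝ≥0∞ :=
  ⨅ (A : Set (Configuration X)) (_ : MeasurableSet A) (_ : 0 < P A) (_ : P A < 2⁻¹),
    (∫⁻ ω, fieldNorm σ p (T (A.indicator fun _ => (1 : ℝ))) ω ∂P) / P A

/-- The Poincaré constant
`inf { E[|T F|²_{L^p((σ+ω)/2)}] / Var(F) : F ∈ L²(P) not a.s. constant }`,
where `T` is one of the gradients `D`, `D⁺`, `D⁻`. These are `λ_p`, `λ_p⁺`, `λ_p⁻`. -/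
noncomputable def poincareConst (σ : Measure X) (P : Measure (Configuration X)) (p : ℝ≥0∞)
    (T : (Configuration X → ℝ) → Configuration X → X → ℝ) : ℝ≥0∞ :=
  ⨅ (F : Configuration X → ℝ) (_ : Measurable F) (_ : MemLp F 2 P) (_ : ¬ IsAEConst P F),
    (∫⁻ ω, fieldNorm σ p (T F) ω ^ 2 ∂P) / evariance F P

/-- The constant `k_p⁺`, namely
`inf { E[|D⁺ F|_{L^p((σ+ω)/2)}] / E[(F - m)⁺] }` over all integrable `F` that are not a.s.
constant and all medians `m` of `F`. -/
noncomputable def medianConstPlus (σ : Measure X) (P : Measure (Configuration X)) (p : ℝ≥0∞) :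
    ℝ≥0∞ :=
  ⨅ (F : Configuration X → ℝ) (_ : Measurable F) (_ : Integrable F P) (_ : ¬ IsAEConst P F)
    (m : ℝ) (_ : IsMedian P F m),
    (∫⁻ ω, fieldNorm σ p (diffPlus F) ω ∂P) / ∫⁻ ω, ENNReal.ofReal (F ω - m) ∂P

end Poisson

/-!
A measurable function of the configuration factors through the counting measure
`Configuration.toMeasure`, so everything is written for functions `F` of a measure `μ`, and adding a
point `x` means passing from `μ` to `μ + δ_x`. The Mecke formula
`IsPoissonMeasure.lintegral_tsum_remove` exchanges the points of the configuration with an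
independent point distributed according to `σ`. It gives
`E ∫ ψ(D_x F) d(σ + ω)/2 = 1/2 E ∫ (ψ(F(ω) - F(ω + δ_x)) + ψ(F(ω + δ_x) - F(ω))) σ(dx)`,
which is `IsPoissonMeasure.lintegral_lintegral_diffOp`. The right side does not change when `ψ` is
composed with a change of sign, so `D⁺` and `D⁻` each carry half of the energy for `p = 1` and
`p = 2`; this explains the factors `2` between the constants and their one-sided variants.

The lower bounds come from the functional isoperimetric inequality
`J(E F) ≤ E √(J(F)² + κ ∫ (F(ω + δ_x) - F(ω))² σ(dx))` for `0 ≤ F ≤ 1`, `J(x) = x (1 - x)` and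
`κ > 1/2`, in `IsPoissonMeasure.bernoulliVar_integral_le`. If `σ` has small mass `s`, at most one
point matters and the inequality holds up to an error of order `s²`. It tensorizes by
Minkowski's inequality (`sqrt_integral_sq_add_le`), and the restrictions of a Poisson configuration
to two complementary sets are independent Poisson configurations. Since `σ` is diffuse, `X` can be
cut repeatedly into two parts of comparable mass; the sum of the squared masses decreases
geometrically, and the error vanishes in the limit. Linearization around a constant gives the
Poincaré inequality `IsPoissonMeasure.evariance_le_lintegral`. On indicator functions `J` vanishes,
and `κ = 3/4` gives the Cheeger type inequality `IsPoissonMeasure.bernoulliVar_le_integral_sqrt`,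
whose constants `1/√6` and `1/√(3 σ(X))` are better than `1/√(2π)` and `1/√(π σ(X))` because
`π > 3`.

The upper bounds are attained or tested at the number `N` of points, which has mean and variance
`σ(X)`. It gives equality in the Poincaré inequalities. For the isoperimetric constants, the
inequalities for the tails `{N ≥ k + 1}` and `{N ≤ k}` on the two sides of a median are summed with
the odd numbers as weights, so that the left sides add up to a second moment; this bounds the
constant in terms of the variance (`le_of_isoperimetric_tails`).

The isoperimetric constants only test sets of probability less than `1/2`, while level sets above a
median can have probability exactly `1/2`. An isoperimetric inequality extends to such a set by
forbidding two points in a set of small measure, unless the set has almost no configuration with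
several points (`mul_measure_le_of_perturbation`); the remaining case for `D⁺` and
`p = ∞` is `mul_measure_le_lintegral_fieldNorm_top_diffPlus`. Integration over the
levels above a median (`mul_lintegral_sub_le_lintegral_fieldNorm_top`) then
identifies the constant for medians with `h_∞⁺`. A quotient `0/0` cannot occur there, because a
function with vanishing one-sided gradient is constant
(`isAEConst_of_lintegral_fieldNorm_top_diffPlus_eq_zero`).
-/

/-! ### Diffuse measures -/

namespace IsDiffuse

variable {X : Type*} [MeasurableSpace X] {σ : Measure X}

theorem restrict (hσ : IsDiffuse σ) {B : Set X} (hB : MeasurableSet B) :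
    IsDiffuse (σ.restrict B) := by
  intro D hD hpos
  rw [Measure.restrict_apply hD] at hpos
  obtain ⟨C, hC, hCm, h0, hlt⟩ := hσ (D ∩ B) (hD.inter hB) hpos
  have e : σ.restrict B C = σ C := by
    rw [Measure.restrict_apply hCm, Set.inter_eq_left.2 (hC.trans Set.inter_subset_right)]
  refine ⟨C, hC.trans Set.inter_subset_left, hCm, by rwa [e], ?_⟩
  rwa [e, Measure.restrict_apply hD]

theorem measure_singleton [MeasurableSingletonClass X] (hσ : IsDiffuse σ) (x : X) :
    σ {x} = 0 := by
  by_contra h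
  obtain ⟨C, hC, -, h0, hlt⟩ := hσ {x} (measurableSet_singleton x) (pos_iff_ne_zero.2 h)
  rcases Set.subset_singleton_iff_eq.1 hC with rfl | rfl
  · simp at h0
  · exact lt_irrefl _ hlt

/-- A set of positive diffuse measure has subsets of arbitrarily small positive measure, by repeated
halving. -/
theorem exists_subset_measure_le [IsFiniteMeasure σ] (hσ : IsDiffuse σ) {B : Set X}
    (hB : MeasurableSet B) (hpos : 0 < σ B) {ε : ℝ≥0∞} (hε : 0 < ε) :
    ∃ C ⊆ B, MeasurableSet C ∧ 0 < σ C ∧ σ C ≤ ε := by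
  have key : ∀ n : ℕ, ∃ C ⊆ B, MeasurableSet C ∧ 0 < σ C ∧ 2 ^ n * σ C ≤ σ B := by
    intro n
    induction n with
    | zero => exact ⟨B, subset_rfl, hB, hpos, by simp⟩
    | succ n ih =>
      obtain ⟨C, hCB, hC, h0, hle⟩ := ih
      obtain ⟨D, hDC, hD, hD0, hlt⟩ := hσ C hC h0
      have hsum : σ D + σ (C \ D) = σ C := by
        rw [measure_sdiff hDC hD.nullMeasurableSet (measure_ne_top _ _)]
        exact add_tsub_cancel_of_le hlt.le
      rcases le_total (σ D) (σ (C \ D)) with h | h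
      · refine ⟨D, hDC.trans hCB, hD, hD0, le_trans ?_ hle⟩
        rw [pow_succ, mul_assoc, two_mul]
        gcongr
        rw [← hsum]
        gcongr
      · refine ⟨C \ D, Set.sdiff_subset.trans hCB, hC.diff hD, ?_, le_trans ?_ hle⟩
        · rw [pos_iff_ne_zero]
          intro h'
          rw [h', add_zero] at hsum
          exact hlt.ne hsum
        · rw [pow_succ, mul_assoc, two_mul]
          gcongr
          rw [← hsum]
          gcongr
  obtain ⟨n, hn⟩ : ∃ n : ℕ, σ B < n * ε :=
    ENNReal.exists_nat_mul_gt hε.ne' (measure_ne_top _ _)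
  obtain ⟨C, hCB, hC, h0, hle⟩ := key n
  refine ⟨C, hCB, hC, h0, ?_⟩
  by_contra! h
  have h2 : (n : ℝ≥0∞) ≤ 2 ^ n := by exact_mod_cast (Nat.lt_two_pow_self (n := n)).le
  have : (n : ℝ≥0∞) * ε ≤ 2 ^ n * σ C := mul_le_mul' h2 h.le
  exact absurd (hn.trans_le (this.trans hle)) (lt_irrefl _)

/-- Exhaustion by a maximal disjoint family: a diffuse measure can be cut into countably many
pieces of measure at most `δ`. -/
theorem exists_countable_partition [IsFiniteMeasure σ] (hσ : IsDiffuse σ) {B : Set X}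
    (hB : MeasurableSet B) {δ : ℝ≥0∞} (hδ : 0 < δ) :
    ∃ 𝒟 : Set (Set X), 𝒟.Countable ∧ 𝒟.PairwiseDisjoint id ∧
      (∀ D ∈ 𝒟, MeasurableSet D ∧ D ⊆ B ∧ σ D ≤ δ) ∧ σ (B \ ⋃₀ 𝒟) = 0 := by
  let 𝒮 : Set (Set (Set X)) := {𝒟 | 𝒟.PairwiseDisjoint id ∧
    ∀ D ∈ 𝒟, MeasurableSet D ∧ D ⊆ B ∧ 0 < σ D ∧ σ D ≤ δ}
  obtain ⟨𝒟, hmax⟩ : ∃ 𝒟, Maximal (· ∈ 𝒮) 𝒟 := by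
    refine zorn_subset 𝒮 fun c hc hchain => ⟨⋃₀ c, ⟨?_, ?_⟩, fun s hs => Set.subset_sUnion_of_mem hs⟩
    · exact (Set.pairwiseDisjoint_sUnion hchain.directedOn).2 fun s hs => (hc hs).1
    · rintro D ⟨s, hs, hD⟩
      exact (hc hs).2 D hD
  obtain ⟨hdisj, hall⟩ := hmax.prop
  have hcount : 𝒟.Countable := by
    have h := Measure.countable_meas_pos_of_disjoint_iUnion (μ := σ) (As := fun D : 𝒟 => (D : Set X))
      (fun D => (hall D D.2).1) (fun D E hDE => hdisj D.2 E.2 (Subtype.coe_ne_coe.2 hDE))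
    have h2 : {D : 𝒟 | 0 < σ (D : Set X)} = Set.univ :=
      Set.eq_univ_of_forall fun D => (hall D D.2).2.2.1
    rw [h2] at h
    exact Set.countable_coe_iff.1 (Set.countable_univ_iff.1 h)
  refine ⟨𝒟, hcount, hdisj, fun D hD => ⟨(hall D hD).1, (hall D hD).2.1, (hall D hD).2.2.2⟩, ?_⟩
  by_contra hne
  have hm : MeasurableSet (B \ ⋃₀ 𝒟) :=
    hB.diff (MeasurableSet.sUnion hcount fun D hD => (hall D hD).1)
  obtain ⟨C, hC, hCm, h0, hle⟩ := hσ.exists_subset_measure_le hm (pos_iff_ne_zero.2 hne) hδ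
  have hCd : ∀ D ∈ 𝒟, Disjoint C D := fun D hD =>
    Set.disjoint_of_subset hC (Set.subset_sUnion_of_mem hD) Set.disjoint_sdiff_left
  have hins : insert C 𝒟 ∈ 𝒮 := by
    refine ⟨hdisj.insert fun D hD _ => hCd D hD, ?_⟩
    rintro D (rfl | hD)
    · exact ⟨hCm, hC.trans Set.sdiff_subset, h0, hle⟩
    · exact hall D hD
  have hCin : C ∈ 𝒟 := hmax.le_of_ge hins (Set.subset_insert _ _) (Set.mem_insert _ _)
  have := hCd C hCin
  rw [disjoint_self] at this
  rw [this] at h0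
  simp at h0

/-- Finitely many disjoint small pieces of `B` exhaust its measure up to an arbitrarily small
part. -/
theorem exists_finset_lt_sum [IsFiniteMeasure σ] (hσ : IsDiffuse σ) {B : Set X}
    (hB : MeasurableSet B) {δ : ℝ≥0∞} (hδ : 0 < δ) {r : ℝ≥0∞} (hr : r < σ B) :
    ∃ t : Finset (Set X), (t : Set (Set X)).PairwiseDisjoint id ∧
      (∀ D ∈ t, MeasurableSet D ∧ D ⊆ B ∧ σ D ≤ δ) ∧ r < ∑ D ∈ t, σ D := by
  obtain ⟨𝒟, hc, hd, hall, h0⟩ := hσ.exists_countable_partition hB hδ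
  have hsum : σ B ≤ ∑' D : 𝒟, σ (D : Set X) := by
    rw [← measure_sUnion hc (fun D hD E hE h => hd hD hE h) (fun D hD => (hall D hD).1)]
    calc σ B ≤ σ (⋃₀ 𝒟 ∪ B \ ⋃₀ 𝒟) := measure_mono (by simp)
      _ ≤ _ := measure_union_le _ _
      _ = _ := by rw [h0, add_zero]
  rw [ENNReal.tsum_eq_iSup_sum] at hsum
  obtain ⟨s, hs⟩ := lt_iSup_iff.1 (hr.trans_le hsum)
  refine ⟨s.map (Function.Embedding.subtype _), ?_, ?_, ?_⟩
  · exact hd.subset (by intro D hD; simp at hD; exact hD.1)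
  · intro D hD
    simp at hD
    exact hall D hD.1
  · rwa [Finset.sum_map]

/-- A diffuse measure splits into two parts, each with at least a third of the mass: add up small
pieces until a third is reached. -/
theorem exists_subset_third [IsFiniteMeasure σ] (hσ : IsDiffuse σ) :
    ∃ C : Set X, MeasurableSet C ∧ σ.real Set.univ / 3 ≤ σ.real C ∧
      σ.real Set.univ / 3 ≤ σ.real Cᶜ := by
  rcases (measureReal_nonneg (μ := σ) (s := Set.univ)).eq_or_lt with h | h
  · refine ⟨∅, MeasurableSet.empty, ?_, ?_⟩ <;> simp [← h]
  have hpos : 0 < σ Set.univ := by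
    rw [pos_iff_ne_zero]; intro h'; simp [Measure.real, h'] at h
  set δ := ENNReal.ofReal (σ.real Set.univ / 3) with hδ
  have hδ0 : 0 < δ := ENNReal.ofReal_pos.2 (by linarith)
  have hlt : δ < σ Set.univ := by
    rw [hδ, ENNReal.ofReal_lt_iff_lt_toReal (by linarith) (measure_ne_top _ _)]
    change _ < σ.real Set.univ
    linarith
  -- a finite family of small pieces of total measure at least one third, of least cardinality
  have hex : ∃ n : ℕ, ∃ t : Finset (Set X), t.card = n ∧ (t : Set (Set X)).PairwiseDisjoint id ∧
      (∀ D ∈ t, MeasurableSet D ∧ σ D ≤ δ) ∧ δ ≤ ∑ D ∈ t, σ D := by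
    obtain ⟨t, h1, h2, h3⟩ := hσ.exists_finset_lt_sum MeasurableSet.univ hδ0 hlt
    exact ⟨_, t, rfl, h1, fun D hD => ⟨(h2 D hD).1, (h2 D hD).2.2⟩, h3.le⟩
  classical
  obtain ⟨t, htc, hd, hall, hge⟩ := Nat.find_spec hex
  have hU : σ (⋃ D ∈ t, D) = ∑ D ∈ t, σ D :=
    measure_biUnion_finset hd fun D hD => (hall D hD).1
  have hm : MeasurableSet (⋃ D ∈ t, D) := Finset.measurableSet_biUnion t fun D hD => (hall D hD).1
  have hle : ∑ D ∈ t, σ D ≤ δ + δ := by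
    obtain ⟨D, hD⟩ : t.Nonempty := by
      rw [Finset.nonempty_iff_ne_empty]
      rintro rfl
      simp at hge
      exact hδ0.ne' hge
    have hlt' : ∑ E ∈ t.erase D, σ E < δ := by
      by_contra! hcon
      refine Nat.find_min hex (m := (t.erase D).card) ?_ ⟨t.erase D, rfl, ?_, ?_, hcon⟩
      · rw [← htc]
        exact Finset.card_erase_lt_of_mem hD
      · exact hd.subset (Finset.coe_subset.2 (Finset.erase_subset _ _))
      · exact fun E hE => hall E (Finset.mem_of_mem_erase hE)
    rw [← Finset.add_sum_erase t _ hD]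
    exact add_le_add (hall D hD).2 hlt'.le
  have hδr : δ.toReal = σ.real Set.univ / 3 := ENNReal.toReal_ofReal (by linarith)
  refine ⟨⋃ D ∈ t, D, hm, ?_, ?_⟩
  · rw [← hδr, Measure.real, hU]
    exact ENNReal.toReal_mono (by rw [← hU]; exact measure_ne_top _ _) hge
  · have h1 : σ.real (⋃ D ∈ t, D) ≤ 2 * (σ.real Set.univ / 3) := by
      rw [← hδr, Measure.real, hU, two_mul,
        ← ENNReal.toReal_add ENNReal.ofReal_ne_top ENNReal.ofReal_ne_top]
      exact ENNReal.toReal_mono (by simp) hle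
    rw [measureReal_compl hm]
    linarith

theorem exists_finite_cover [IsFiniteMeasure σ] (hσ : IsDiffuse σ) {δ : ℝ≥0∞} (hδ : 0 < δ) :
    ∃ t : Finset (Set X), (∀ D ∈ t, MeasurableSet D ∧ σ D ≤ δ) ∧ ∀ x, ∃ D ∈ t, x ∈ D := by
  classical
  rcases eq_or_ne (σ Set.univ) 0 with h0 | h0
  · exact ⟨{Set.univ}, by simp [h0], by simp⟩
  obtain ⟨t, hd, hall, hlt⟩ := hσ.exists_finset_lt_sum MeasurableSet.univ hδ
    (ENNReal.sub_lt_self (measure_ne_top σ Set.univ) h0 hδ.ne')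
  have hU : σ (⋃ D ∈ t, D) = ∑ D ∈ t, σ D :=
    measure_biUnion_finset hd fun D hD => (hall D hD).1
  have hm : MeasurableSet (⋃ D ∈ t, D) := Finset.measurableSet_biUnion t fun D hD => (hall D hD).1
  refine ⟨insert (⋃ D ∈ t, D)ᶜ t, ?_, ?_⟩
  · intro D hD
    rcases Finset.mem_insert.1 hD with rfl | hD
    · refine ⟨hm.compl, ?_⟩
      rw [measure_compl hm (measure_ne_top _ _), hU]
      exact tsub_le_iff_tsub_le.1 hlt.le
    · exact ⟨(hall D hD).1, (hall D hD).2.2⟩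
  · intro x
    by_cases hx : x ∈ ⋃ D ∈ t, D
    · obtain ⟨D, hD, hx⟩ := Set.mem_iUnion₂.1 hx
      exact ⟨D, Finset.mem_insert_of_mem hD, hx⟩
    · exact ⟨_, Finset.mem_insert_self _ _, hx⟩

end IsDiffuse

/-! ### Counting functionals determine measures -/

section CountAtoms

variable {X : Type*} [MeasurableSpace X]

/-- The pairs `(μ, x)` for which `x` lies in the `j`-th piece of the partition of `X` into the fibres
of `f` and `μ` has mass exactly `k i` on the `i`-th piece. -/
def countAtom {ι : Type} (f : X → ι) (j : ι) (k : ι → ℕ) : Set (Measure X × X) :=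
  {q | f q.2 = j ∧ ∀ i, q.1 (f ⁻¹' {i}) = k i}

/-- The sets of pairs `(μ, x)` which are determined by the piece of a finite measurable partition
that contains `x` and the masses that `μ` gives to the pieces. -/
def partitionSets (X : Type*) [MeasurableSpace X] : Set (Set (Measure X × X)) :=
  {S | ∃ (ι : Type) (_ : Fintype ι) (f : X → ι) (T : ι → Set (ι → ℝ≥0∞)),
    (∀ i, MeasurableSet (f ⁻¹' {i})) ∧ (∀ i, MeasurableSet (T i)) ∧
      S = {q | (fun i => q.1 (f ⁻¹' {i})) ∈ T (f q.2)}}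

theorem measurableSet_countAtom {ι : Type} [Fintype ι] {f : X → ι}
    (hf : ∀ i, MeasurableSet (f ⁻¹' {i})) (j : ι) (k : ι → ℕ) :
    MeasurableSet (countAtom f j k) := by
  have e : countAtom f j k = Prod.snd ⁻¹' (f ⁻¹' {j}) ∩
      ⋂ i, Prod.fst ⁻¹' {μ : Measure X | μ (f ⁻¹' {i}) = k i} := by
    ext q; simp [countAtom]
  rw [e]
  refine (measurable_snd (hf j)).inter (MeasurableSet.iInter fun i => measurable_fst ?_)
  exact Measure.measurable_coe (hf i) (measurableSet_singleton _)

theorem isPiSystem_partitionSets : IsPiSystem (partitionSets X) := by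
  rintro _ ⟨ι, _, f, T, hf, hT, rfl⟩ _ ⟨ι', _, f', T', hf', hT', rfl⟩ -
  have hpre : ∀ p : ι × ι', (fun x => (f x, f' x)) ⁻¹' {p} = f ⁻¹' {p.1} ∩ f' ⁻¹' {p.2} := by
    intro p; ext x; simp [Prod.ext_iff]
  have hmeas : ∀ p : ι × ι', MeasurableSet ((fun x => (f x, f' x)) ⁻¹' {p}) := by
    intro p; rw [hpre]; exact (hf _).inter (hf' _)
  refine ⟨ι × ι', inferInstance, fun x => (f x, f' x),
    fun p => {k | (fun i => ∑ i', k (i, i')) ∈ T p.1 ∧ (fun i' => ∑ i, k (i, i')) ∈ T' p.2},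
    hmeas, ?_, ?_⟩
  · intro p
    refine MeasurableSet.inter ?_ ?_
    · have h : Measurable fun (k : ι × ι' → ℝ≥0∞) (i : ι) => ∑ i', k (i, i') := by fun_prop
      exact h (hT p.1)
    · have h : Measurable fun (k : ι × ι' → ℝ≥0∞) (i' : ι') => ∑ i, k (i, i') := by fun_prop
      exact h (hT' p.2)
  · have h1 : ∀ (μ : Measure X) i, μ (f ⁻¹' {i}) =
        ∑ i', μ ((fun x => (f x, f' x)) ⁻¹' {(i, i')}) := by
      intro μ i
      rw [← measure_biUnion_finset (fun a _ b _ hab => ?_) (fun i' _ => hmeas (i, i'))]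
      · congr 1; ext x; simp
      · refine Set.disjoint_left.2 fun x hx hx' => hab ?_
        simp at hx hx'
        rw [← hx.2, hx'.2]
    have h2 : ∀ (μ : Measure X) i', μ (f' ⁻¹' {i'}) =
        ∑ i, μ ((fun x => (f x, f' x)) ⁻¹' {(i, i')}) := by
      intro μ i'
      rw [← measure_biUnion_finset (fun a _ b _ hab => ?_) (fun i _ => hmeas (i, i'))]
      · congr 1; ext x; simp
      · refine Set.disjoint_left.2 fun x hx hx' => hab ?_
        simp at hx hx'
        rw [← hx.1, hx'.1]
    ext q
    simp only [Set.mem_inter_iff, Set.mem_ofPred_eq, h1, h2]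

theorem generateFrom_partitionSets :
    (inferInstance : MeasurableSpace (Measure X × X)) =
      MeasurableSpace.generateFrom (partitionSets X) := by
  classical
  apply le_antisymm
  · refine sup_le ?_ ?_
    · rw [← measurable_iff_comap_le]
      refine @Measure.measurable_of_measurable_coe _ _ _
        (MeasurableSpace.generateFrom (partitionSets X)) _ fun B hB => ?_
      intro U hU
      refine MeasurableSpace.measurableSet_generateFrom
        ⟨Bool, inferInstance, fun x => decide (x ∈ B), fun _ => {k | k true ∈ U}, ?_, ?_, ?_⟩
      · rintro (_ | _)
        · convert hB.compl using 1; ext x; simp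
        · convert hB using 1; ext x; simp
      · exact fun i => measurable_pi_apply _ hU
      · ext q
        have : (fun x => decide (x ∈ B)) ⁻¹' {true} = B := by ext x; simp
        simp [this]
    · rw [← measurable_iff_comap_le]
      intro B hB
      refine MeasurableSpace.measurableSet_generateFrom
        ⟨Bool, inferInstance, fun x => decide (x ∈ B),
          fun b => if b then Set.univ else ∅, ?_, ?_, ?_⟩
      · rintro (_ | _)
        · convert hB.compl using 1; ext x; simp
        · convert hB using 1; ext x; simp
      · rintro (_ | _) <;> simp
      · ext q
        by_cases h : q.2 ∈ B <;> simp [h]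
  · refine MeasurableSpace.generateFrom_le ?_
    rintro _ ⟨ι, _, f, T, hf, hT, rfl⟩
    have e : {q : Measure X × X | (fun i => q.1 (f ⁻¹' {i})) ∈ T (f q.2)} =
        ⋃ j, Prod.snd ⁻¹' (f ⁻¹' {j}) ∩ Prod.fst ⁻¹' {μ : Measure X | (fun i => μ (f ⁻¹' {i})) ∈ T j} := by
      ext q; simp
    rw [e]
    refine MeasurableSet.iUnion fun j => (measurable_snd (hf j)).inter (measurable_fst ?_)
    exact (measurable_pi_lambda _ fun i => Measure.measurable_coe (hf i)) (hT j)

theorem measurableSet_natMass {B : Set X} (hB : MeasurableSet B) :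
    MeasurableSet {q : Measure X × X | ∃ n : ℕ, q.1 B = (n : ℝ≥0∞)} := by
  have : {q : Measure X × X | ∃ n : ℕ, q.1 B = (n : ℝ≥0∞)} =
      ⋃ n : ℕ, (fun q : Measure X × X => q.1 B) ⁻¹' {(n : ℝ≥0∞)} := by ext; simp
  rw [this]
  exact MeasurableSet.iUnion fun n =>
    ((Measure.measurable_coe hB).comp measurable_fst) (measurableSet_singleton _)

/-- If masses are almost surely integers, a set of `partitionSets` splits into countably many
atoms. -/
theorem measure_partitionSet_eq_tsum {M : Measure (Measure X × X)}
    (hM : ∀ B, MeasurableSet B → ∀ᵐ q ∂M, ∃ n : ℕ, q.1 B = (n : ℝ≥0∞))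
    {ι : Type} [Fintype ι] {f : X → ι} (hf : ∀ i, MeasurableSet (f ⁻¹' {i}))
    (T : ι → Set (ι → ℝ≥0∞)) [∀ p : ι × (ι → ℕ), Decidable ((fun i => (p.2 i : ℝ≥0∞)) ∈ T p.1)] :
    M {q | (fun i => q.1 (f ⁻¹' {i})) ∈ T (f q.2)} =
      ∑' p : ι × (ι → ℕ), if (fun i => (p.2 i : ℝ≥0∞)) ∈ T p.1 then M (countAtom f p.1 p.2)
        else 0 := by
  let A : ι × (ι → ℕ) → Set (Measure X × X) := fun p =>
    if (fun i => (p.2 i : ℝ≥0∞)) ∈ T p.1 then countAtom f p.1 p.2 else ∅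
  have hae : {q : Measure X × X | (fun i => q.1 (f ⁻¹' {i})) ∈ T (f q.2)} =ᵐ[M] ⋃ p, A p := by
    have h := ae_all_iff.2 fun i => hM _ (hf i)
    filter_upwards [h] with q hq
    choose k hk using hq
    refine propext ⟨fun h => ?_, fun h => ?_⟩
    · refine Set.mem_iUnion.2 ⟨(f q.2, k), ?_⟩
      have h' : (fun i => q.1 (f ⁻¹' {i})) ∈ T (f q.2) := h
      simp only [hk] at h'
      simp only [A, h', if_true]
      exact ⟨rfl, hk⟩
    · obtain ⟨p, hp⟩ := Set.mem_iUnion.1 h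
      by_cases hT : (fun i => (p.2 i : ℝ≥0∞)) ∈ T p.1
      · simp only [A, hT, if_true] at hp
        change (fun i => q.1 (f ⁻¹' {i})) ∈ T (f q.2)
        rw [hp.1]
        simpa only [hp.2] using hT
      · simp [A, hT] at hp
  rw [measure_congr hae, measure_iUnion]
  · refine tsum_congr fun p => ?_
    by_cases hT : (fun i => (p.2 i : ℝ≥0∞)) ∈ T p.1 <;> simp [A, hT]
  · intro p p' hpp
    refine Set.disjoint_left.2 fun q hq hq' => hpp ?_
    have hsub : ∀ p, A p ⊆ countAtom f p.1 p.2 := by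
      intro p; by_cases hT : (fun i => (p.2 i : ℝ≥0∞)) ∈ T p.1 <;> simp [A, hT]
    have h1 := hsub _ hq
    have h2 := hsub _ hq'
    refine Prod.ext (h1.1.symm.trans h2.1) (funext fun i => ?_)
    exact_mod_cast (h1.2 i).symm.trans (h2.2 i)
  · intro p
    by_cases hT : (fun i => (p.2 i : ℝ≥0∞)) ∈ T p.1
    · simpa [A, hT] using measurableSet_countAtom hf p.1 p.2
    · simp [A, hT]

theorem measure_univ_eq_tsum_countAtom {M : Measure (Measure X × X)}
    (hM : ∀ B, MeasurableSet B → ∀ᵐ q ∂M, ∃ n : ℕ, q.1 B = (n : ℝ≥0∞)) :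
    M Set.univ = ∑' p : Unit × (Unit → ℕ), M (countAtom (fun _ : X => ()) p.1 p.2) := by
  classical
  have h := measure_partitionSet_eq_tsum hM (f := fun _ : X => ()) (fun i => by simp)
    (fun _ => Set.univ)
  simpa using h

/-- A measure on pairs `(μ, x)` with integer masses is determined by its values on atoms. -/
theorem ext_of_countAtom {M₁ M₂ : Measure (Measure X × X)} [IsFiniteMeasure M₁]
    (h₁ : ∀ B, MeasurableSet B → ∀ᵐ q ∂M₁, ∃ n : ℕ, q.1 B = (n : ℝ≥0∞))
    (h₂ : ∀ B, MeasurableSet B → ∀ᵐ q ∂M₂, ∃ n : ℕ, q.1 B = (n : ℝ≥0∞))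
    (h : ∀ (ι : Type) [Fintype ι] (f : X → ι), (∀ i, MeasurableSet (f ⁻¹' {i})) →
      ∀ j k, M₁ (countAtom f j k) = M₂ (countAtom f j k)) : M₁ = M₂ := by
  classical
  refine ext_of_generate_finite _ generateFrom_partitionSets isPiSystem_partitionSets ?_ ?_
  · rintro _ ⟨ι, _, f, T, hf, hT, rfl⟩
    rw [measure_partitionSet_eq_tsum h₁ hf T, measure_partitionSet_eq_tsum h₂ hf T]
    exact tsum_congr fun p => by rw [h ι f hf]
  · rw [measure_univ_eq_tsum_countAtom h₁, measure_univ_eq_tsum_countAtom h₂]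
    exact tsum_congr fun p => h Unit _ (fun i => by simp) _ _

/-- A family of finite measures on pairs `(μ, x)` with integer masses is measurable as soon as the
values on atoms are. -/
theorem measurable_of_countAtom {Ω : Type*} [MeasurableSpace Ω] {κ : Ω → Measure (Measure X × X)}
    [∀ ω, IsFiniteMeasure (κ ω)]
    (h₁ : ∀ ω B, MeasurableSet B → ∀ᵐ q ∂κ ω, ∃ n : ℕ, q.1 B = (n : ℝ≥0∞))
    (h : ∀ (ι : Type) [Fintype ι] (f : X → ι), (∀ i, MeasurableSet (f ⁻¹' {i})) →
      ∀ j k, Measurable fun ω => κ ω (countAtom f j k)) : Measurable κ := by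
  classical
  refine Measurable.measure_of_isPiSystem generateFrom_partitionSets isPiSystem_partitionSets ?_ ?_
  · rintro _ ⟨ι, _, f, T, hf, hT, rfl⟩
    simp_rw [fun ω => measure_partitionSet_eq_tsum (h₁ ω) hf T]
    refine Measurable.tsum fun p => ?_
    split_ifs
    · exact h ι f hf _ _
    · exact measurable_const
  · simp_rw [fun ω => measure_univ_eq_tsum_countAtom (h₁ ω)]
    exact Measurable.tsum fun p => h Unit _ (fun i => by simp) _ _

end CountAtoms

/-! ### Configurations and their counting measures -/

namespace Configuration

variable {X : Type*} [TopologicalSpace X]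

/-- The configuration `ω ∩ B`. -/
def restrict (ω : Configuration X) (B : Set X) : Configuration X where
  carrier := ω.carrier ∩ B
  countable_carrier := ω.countable_carrier.mono Set.inter_subset_left
  finite_inter_compact K hK :=
    (ω.finite_inter_compact K hK).subset (Set.inter_subset_inter_left K Set.inter_subset_left)

theorem remove_add {ω : Configuration X} {x : X} (hx : x ∈ ω.carrier) :
    (ω.remove x).add x = ω := by
  ext y
  by_cases h : y = x
  · subst h; simp [add, hx]
  · simp [add, remove, h]

variable [MeasurableSpace X]

theorem measurable_toMeasure : Measurable (toMeasure : Configuration X → Measure X) :=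
  comap_measurable _

@[fun_prop]
theorem measurable_apply {B : Set X} (hB : MeasurableSet B) :
    Measurable fun ω : Configuration X => ω.toMeasure B :=
  (Measure.measurable_coe hB).comp measurable_toMeasure

theorem toMeasure_apply (ω : Configuration X) {B : Set X} (hB : MeasurableSet B) :
    ω.toMeasure B = ∑' x : ω.carrier, B.indicator 1 (x : X) := by
  simp only [toMeasure, Measure.sum_apply _ hB, Measure.dirac_apply' _ hB]

theorem toMeasure_restrict (ω : Configuration X) {B : Set X} (hB : MeasurableSet B) :
    (ω.restrict B).toMeasure = ω.toMeasure.restrict B := by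
  ext C hC
  rw [Measure.restrict_apply hC, toMeasure_apply _ hC, toMeasure_apply _ (hC.inter hB),
    tsum_subtype (ω.restrict B).carrier (C.indicator (1 : X → ℝ≥0∞)),
    tsum_subtype ω.carrier ((C ∩ B).indicator (1 : X → ℝ≥0∞))]
  refine tsum_congr fun x => ?_
  by_cases h1 : x ∈ ω.carrier <;> by_cases h2 : x ∈ B <;> by_cases h3 : x ∈ C <;>
    simp [restrict, Set.indicator, h1, h2, h3]

theorem measurable_restrict {B : Set X} (hB : MeasurableSet B) :
    Measurable fun ω : Configuration X => ω.restrict B := by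
  rw [measurable_comap_iff]
  refine Measure.measurable_of_measurable_coe _ fun C hC => ?_
  simp only [Function.comp_apply, toMeasure_restrict _ hB, Measure.restrict_apply hC]
  exact measurable_apply (hC.inter hB)

theorem toMeasure_add {ω : Configuration X} {x : X} (hx : x ∉ ω.carrier) :
    (ω.add x).toMeasure = ω.toMeasure + Measure.dirac x := by
  ext C hC
  rw [Measure.add_apply, toMeasure_apply _ hC, toMeasure_apply _ hC, Measure.dirac_apply' _ hC,
    tsum_subtype (ω.add x).carrier (C.indicator (1 : X → ℝ≥0∞)),
    tsum_subtype ω.carrier (C.indicator (1 : X → ℝ≥0∞))]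
  have h : C.indicator (1 : X → ℝ≥0∞) x =
      ∑' y, ({x} : Set X).indicator (C.indicator (1 : X → ℝ≥0∞)) y := by
    rw [← tsum_subtype, tsum_singleton]
  rw [h, ← ENNReal.tsum_add]
  refine tsum_congr fun y => ?_
  by_cases hy : y = x
  · subst hy; simp [add, hx]
  · by_cases h1 : y ∈ ω.carrier <;> simp [add, Set.indicator, hy, h1]

theorem toMeasure_remove {ω : Configuration X} {x : X} (hx : x ∈ ω.carrier) :
    (ω.remove x).toMeasure + Measure.dirac x = ω.toMeasure := by
  rw [← toMeasure_add (by simp [remove]), remove_add hx]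

theorem toMeasure_univ_lt_top_iff {ω : Configuration X} :
    ω.toMeasure Set.univ < ∞ ↔ ω.carrier.Finite := by
  rw [toMeasure_apply _ MeasurableSet.univ]
  simp only [Set.indicator_univ, Pi.one_apply]
  constructor
  · intro h
    by_contra hinf
    have : Infinite ω.carrier := Set.infinite_coe_iff.2 hinf
    rw [ENNReal.tsum_const_eq_top_of_ne_zero one_ne_zero] at h
    exact lt_irrefl _ h
  · intro h
    have := h.fintype
    simp

theorem exists_nat_toMeasure_eq {ω : Configuration X} (hω : ω.carrier.Finite) {B : Set X}
    (hB : MeasurableSet B) : ∃ n : ℕ, ω.toMeasure B = (n : ℝ≥0∞) := by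
  classical
  have := hω.fintype
  refine ⟨∑ x : ω.carrier, if (x : X) ∈ B then 1 else 0, ?_⟩
  rw [toMeasure_apply _ hB, tsum_fintype]
  push_cast
  refine Finset.sum_congr rfl fun x _ => ?_
  by_cases h : (x : X) ∈ B <;> simp [h]

theorem lintegral_toMeasure [MeasurableSingletonClass X] (ω : Configuration X) (f : X → ℝ≥0∞) :
    ∫⁻ x, f x ∂ω.toMeasure = ∑' x : ω.carrier, f x := by
  simp [toMeasure, lintegral_sum_measure]

/-- The law of a point `x` of a finite configuration `ω` together with the configuration that is
left when `x` is taken away, each point counted with weight one. -/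
noncomputable def removals (ω : Configuration X) : Measure (Measure X × X) := by
  classical
  exact if ω.toMeasure Set.univ < ∞ then
    Measure.sum fun x : ω.carrier => Measure.dirac ((ω.remove x).toMeasure, (x : X)) else 0

theorem lintegral_removals {ω : Configuration X} (hω : ω.toMeasure Set.univ < ∞)
    {v : Measure X × X → ℝ≥0∞} (hv : Measurable v) :
    ∫⁻ q, v q ∂ω.removals = ∑' x : ω.carrier, v ((ω.remove x).toMeasure, (x : X)) := by
  simp [removals, hω, lintegral_sum_measure, lintegral_dirac' _ hv]

theorem ae_removals {ω : Configuration X} {B : Set X} (hB : MeasurableSet B) :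
    ∀ᵐ q ∂ω.removals, ∃ n : ℕ, q.1 B = (n : ℝ≥0∞) := by
  by_cases hω : ω.toMeasure Set.univ < ∞
  · have hm := measurableSet_natMass hB
    simp only [removals, hω, if_true]
    rw [Measure.ae_sum_iff' hm]
    intro x
    rw [ae_dirac_iff hm]
    exact exists_nat_toMeasure_eq ((toMeasure_univ_lt_top_iff.1 hω).subset Set.sdiff_subset) hB
  · simp [removals, hω]

instance (ω : Configuration X) : IsFiniteMeasure ω.removals := by
  by_cases hω : ω.toMeasure Set.univ < ∞
  · have := (toMeasure_univ_lt_top_iff.1 hω).fintype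
    refine ⟨?_⟩
    simp [removals, hω]
  · simp only [removals, hω, if_false]
    infer_instance

open Classical in
/-- Removing a point in turn from `ω` and testing the counts `k` for what remains selects the
configurations with one more point in the `j`-th cell, each of them as often as it has points
there. -/
theorem removals_countAtom (ω : Configuration X) {ι : Type} [Fintype ι] {f : X → ι}
    (hf : ∀ i, MeasurableSet (f ⁻¹' {i})) (j : ι) (k : ι → ℕ) :
    ω.removals (countAtom f j k) =
      {ω : Configuration X | ω.toMeasure Set.univ < ∞ ∧
        ∀ i, ω.toMeasure (f ⁻¹' {i}) = ((k i + if i = j then 1 else 0 : ℕ) : ℝ≥0∞)}.indicator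
        (fun _ => ((k j + 1 : ℕ) : ℝ≥0∞)) ω := by
  by_cases hω : ω.toMeasure Set.univ < ∞
  swap
  · simp [removals, hω]
  have hfin : ∀ B, ω.toMeasure B ≠ ∞ := fun B =>
    ((measure_mono (Set.subset_univ _)).trans_lt hω).ne
  have hatom := measurableSet_countAtom hf j k
  have key : ∀ x : ω.carrier, ((ω.remove x).toMeasure, (x : X)) ∈ countAtom f j k ↔
      f x = j ∧ ∀ i, ω.toMeasure (f ⁻¹' {i}) = ((k i + if i = j then 1 else 0 : ℕ) : ℝ≥0∞) := by
    rintro ⟨x, hx⟩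
    refine and_congr_right fun hj => forall_congr' fun i => ?_
    change (ω.remove x).toMeasure _ = _ ↔ _
    rw [← toMeasure_remove hx, Measure.add_apply, Measure.dirac_apply' _ (hf i)]
    have e : (f ⁻¹' {i}).indicator (1 : X → ℝ≥0∞) x = ((if i = j then 1 else 0 : ℕ) : ℝ≥0∞) := by
      by_cases h : i = j
      · simp [h, hj]
      · have : f x ≠ i := fun h' => h (h'.symm.trans hj)
        simp [h, this]
    rw [e, Nat.cast_add]
    exact (ENNReal.add_left_inj (ENNReal.natCast_ne_top _)).symm
  have hsum : ω.removals (countAtom f j k) = ∑' x : ω.carrier,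
      (countAtom f j k).indicator 1 ((ω.remove x).toMeasure, (x : X)) := by
    simp [removals, hω, Measure.sum_apply _ hatom, Measure.dirac_apply' _ hatom]
  rw [hsum]
  by_cases hC : ∀ i, ω.toMeasure (f ⁻¹' {i}) = ((k i + if i = j then 1 else 0 : ℕ) : ℝ≥0∞)
  · have h2 := hC j
    rw [toMeasure_apply _ (hf j)] at h2
    simp only [if_true] at h2
    rw [Set.indicator_of_mem (Set.mem_ofPred_eq ▸ ⟨hω, hC⟩), ← h2]
    refine tsum_congr fun x => ?_
    have hx := key x
    by_cases h : f x = j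
    · have : (x : X) ∈ f ⁻¹' {j} := h
      rw [Set.indicator_of_mem (hx.2 ⟨h, hC⟩), Set.indicator_of_mem this]; rfl
    · have : (x : X) ∉ f ⁻¹' {j} := h
      rw [Set.indicator_of_notMem (fun h' => h (hx.1 h').1), Set.indicator_of_notMem this]
  · rw [Set.indicator_of_notMem (fun h => hC h.2), ENNReal.tsum_eq_zero]
    intro x
    exact Set.indicator_of_notMem (fun h' => hC ((key x).1 h').2) _

theorem measurable_removals : Measurable (removals : Configuration X → Measure (Measure X × X)) := by
  classical
  refine measurable_of_countAtom (fun ω B hB => ae_removals hB) fun ι _ f hf j k => ?_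
  simp_rw [fun ω : Configuration X => removals_countAtom ω hf j k]
  refine measurable_const.indicator ?_
  refine MeasurableSet.inter (measurable_apply MeasurableSet.univ measurableSet_Iio) ?_
  change MeasurableSet {ω : Configuration X | ∀ i, _}
  rw [Set.ofPred_forall]
  exact MeasurableSet.iInter fun i => measurable_apply (hf i) (measurableSet_singleton _)

end Configuration

/-! ### The Poisson measure: Mecke formula and uniqueness -/

/-- The weight `e^{-r} r^k / k!` of the Poisson distribution with parameter `r`. -/
noncomputable def poissonWeight (r : ℝ) (k : ℕ) : ℝ :=
  r ^ k / (Nat.factorial k : ℝ) * Real.exp (-r)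

theorem poissonWeight_nonneg {r : ℝ} (hr : 0 ≤ r) (k : ℕ) : 0 ≤ poissonWeight r k := by
  unfold poissonWeight; positivity

theorem succ_mul_poissonWeight (r : ℝ) (k : ℕ) :
    (k + 1) * poissonWeight r (k + 1) = r * poissonWeight r k := by
  unfold poissonWeight
  rw [Nat.factorial_succ]
  push_cast
  have : (k : ℝ) + 1 ≠ 0 := by positivity
  have h2 : (Nat.factorial k : ℝ) ≠ 0 := by positivity
  field_simp
  ring

theorem hasSum_poissonWeight (r : ℝ) : HasSum (poissonWeight r) 1 := by
  have h := (NormedSpace.expSeries_div_hasSum_exp r).mul_right (Real.exp (-r))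
  rwa [← Real.exp_eq_exp_ℝ, ← Real.exp_add, add_neg_cancel, Real.exp_zero] at h

namespace IsPoissonMeasure

section

variable {X : Type*} [TopologicalSpace X] [MeasurableSpace X]
  {σ : Measure X} {P : Measure (Configuration X)}

theorem measure_eq_prod (hP : IsPoissonMeasure σ P) {ι : Type} [Fintype ι] {A : ι → Set X}
    (hA : ∀ i, MeasurableSet (A i)) (hd : ∀ i j, i ≠ j → Disjoint (A i) (A j)) (k : ι → ℕ) :
    P {ω | ∀ i, ω.toMeasure (A i) = (k i : ℝ≥0∞)} =
      ∏ i, ENNReal.ofReal (poissonWeight (σ.real (A i)) (k i)) := by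
  let e := Fintype.equivFin ι
  have h := hP (Fintype.card ι) (fun i => A (e.symm i)) (fun i => hA _)
    (fun i j hij => hd _ _ fun h => hij (e.symm.injective h)) (fun i => k (e.symm i))
  rw [← Equiv.prod_comp e.symm]
  refine Eq.trans ?_ h
  congr 1
  ext ω
  exact e.symm.forall_congr_right.symm

theorem measure_apply_eq (hP : IsPoissonMeasure σ P) {B : Set X} (hB : MeasurableSet B) (k : ℕ) :
    P {ω | ω.toMeasure B = (k : ℝ≥0∞)} = ENNReal.ofReal (poissonWeight (σ.real B) k) := by
  have h := hP.measure_eq_prod (ι := Unit) (A := fun _ => B) (fun _ => hB)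
    (fun i j hij => absurd (Subsingleton.elim i j) hij) (fun _ => k)
  simpa using h

theorem isProbabilityMeasure (hP : IsPoissonMeasure σ P) : IsProbabilityMeasure P := by
  have h := hP 0 (fun _ => ∅) (by simp) (by simp) (fun _ => 0)
  refine ⟨?_⟩
  simpa using h

theorem ae_finite (hP : IsPoissonMeasure σ P) : ∀ᵐ ω ∂P, ω.toMeasure Set.univ < ∞ := by
  have := hP.isProbabilityMeasure
  have hm : ∀ k : ℕ, MeasurableSet {ω : Configuration X | ω.toMeasure Set.univ = (k : ℝ≥0∞)} :=
    fun k => Configuration.measurable_apply MeasurableSet.univ (measurableSet_singleton _)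
  have hu : P (⋃ k : ℕ, {ω | ω.toMeasure Set.univ = (k : ℝ≥0∞)}) = 1 := by
    rw [measure_iUnion _ hm]
    · simp_rw [hP.measure_apply_eq MeasurableSet.univ]
      rw [← ENNReal.ofReal_tsum_of_nonneg (fun k => poissonWeight_nonneg measureReal_nonneg k)
        (hasSum_poissonWeight _).summable, (hasSum_poissonWeight _).tsum_eq, ENNReal.ofReal_one]
    · intro i j hij
      refine Set.disjoint_left.2 fun ω h1 h2 => hij ?_
      exact_mod_cast (show ω.toMeasure Set.univ = _ from h1).symm.trans h2
  have hae := (prob_compl_eq_zero_iff (MeasurableSet.iUnion hm)).2 hu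
  filter_upwards [measure_eq_zero_iff_ae_notMem.1 hae] with ω hω
  obtain ⟨k, hk⟩ := Set.mem_iUnion.1 (not_not.1 hω)
  rw [show ω.toMeasure Set.univ = (k : ℝ≥0∞) from hk]
  exact ENNReal.natCast_lt_top k

theorem ae_carrier_finite (hP : IsPoissonMeasure σ P) : ∀ᵐ ω ∂P, ω.carrier.Finite := by
  filter_upwards [hP.ae_finite] with ω hω
  exact Configuration.toMeasure_univ_lt_top_iff.1 hω

theorem measure_countAtom (hP : IsPoissonMeasure σ P) {ι : Type} [Fintype ι] {f : X → ι}
    (hf : ∀ i, MeasurableSet (f ⁻¹' {i})) (k : ι → ℕ) :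
    P {ω | ∀ i, ω.toMeasure (f ⁻¹' {i}) = (k i : ℝ≥0∞)} =
      ∏ i, ENNReal.ofReal (poissonWeight (σ.real (f ⁻¹' {i})) (k i)) :=
  hP.measure_eq_prod hf (fun i j hij => Disjoint.preimage f (by simpa using hij)) k

/-- **Mecke formula** as an equality of measures. -/
theorem bind_removals [IsFiniteMeasure σ] (hP : IsPoissonMeasure σ P) :
    P.bind Configuration.removals = (P.map Configuration.toMeasure).prod σ := by
  classical
  have := hP.isProbabilityMeasure
  have hmr := Configuration.measurable_removals (X := X)
  have := Measure.isProbabilityMeasure_map (μ := P)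
    (Configuration.measurable_toMeasure (X := X)).aemeasurable
  symm
  refine ext_of_countAtom ?_ ?_ ?_
  · intro B hB
    have h : ∀ᵐ μ ∂P.map Configuration.toMeasure, ∃ n : ℕ, μ B = (n : ℝ≥0∞) := by
      have hm : MeasurableSet {μ : Measure X | ∃ n : ℕ, μ B = (n : ℝ≥0∞)} := by
        have : {μ : Measure X | ∃ n : ℕ, μ B = (n : ℝ≥0∞)} =
            ⋃ n : ℕ, (fun μ : Measure X => μ B) ⁻¹' {(n : ℝ≥0∞)} := by ext; simp
        rw [this]
        exact MeasurableSet.iUnion fun n => Measure.measurable_coe hB (measurableSet_singleton _)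
      rw [ae_map_iff Configuration.measurable_toMeasure.aemeasurable hm]
      filter_upwards [hP.ae_carrier_finite] with ω hω
      exact Configuration.exists_nat_toMeasure_eq hω hB
    exact Measure.quasiMeasurePreserving_fst.ae h
  · intro B hB
    rw [ae_iff, ← Set.compl_ofPred, Measure.bind_apply (measurableSet_natMass hB).compl hmr.aemeasurable,
      lintegral_eq_zero_iff']
    · exact Filter.Eventually.of_forall fun ω => ae_iff.1 (Configuration.ae_removals hB)
    · exact ((Measure.measurable_coe (measurableSet_natMass hB).compl).comp hmr).aemeasurable
  · intro ι _ f hf j k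
    rw [Measure.bind_apply (measurableSet_countAtom hf j k) hmr.aemeasurable]
    simp_rw [Configuration.removals_countAtom _ hf j k]
    have hm : MeasurableSet {ω : Configuration X | ∀ i, ω.toMeasure (f ⁻¹' {i}) =
        ((k i + if i = j then 1 else 0 : ℕ) : ℝ≥0∞)} := by
      rw [Set.ofPred_forall]
      exact MeasurableSet.iInter fun i => Configuration.measurable_apply (hf i)
        (measurableSet_singleton _)
    have hm' : MeasurableSet {ω : Configuration X | ω.toMeasure Set.univ < ∞ ∧
        ∀ i, ω.toMeasure (f ⁻¹' {i}) = ((k i + if i = j then 1 else 0 : ℕ) : ℝ≥0∞)} :=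
      MeasurableSet.inter (Configuration.measurable_apply MeasurableSet.univ measurableSet_Iio) hm
    rw [lintegral_indicator_const hm']
    have h2 : P {ω : Configuration X | ω.toMeasure Set.univ < ∞ ∧
        ∀ i, ω.toMeasure (f ⁻¹' {i}) = ((k i + if i = j then 1 else 0 : ℕ) : ℝ≥0∞)} =
        P {ω : Configuration X | ∀ i, ω.toMeasure (f ⁻¹' {i}) =
          ((k i + if i = j then 1 else 0 : ℕ) : ℝ≥0∞)} := by
      refine measure_congr ?_
      filter_upwards [hP.ae_finite] with ω hω
      exact propext ⟨fun h => h.2, fun h => ⟨hω, h⟩⟩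
    have hatom : countAtom f j k =
        {μ : Measure X | ∀ i, μ (f ⁻¹' {i}) = (k i : ℝ≥0∞)} ×ˢ (f ⁻¹' {j}) := by
      ext q
      simp [countAtom, and_comm]
    have hmk : MeasurableSet {μ : Measure X | ∀ i, μ (f ⁻¹' {i}) = (k i : ℝ≥0∞)} := by
      rw [Set.ofPred_forall]
      exact MeasurableSet.iInter fun i => Measure.measurable_coe (hf i) (measurableSet_singleton _)
    rw [h2, hP.measure_countAtom hf, hatom, Measure.prod_prod,
      Measure.map_apply Configuration.measurable_toMeasure hmk, Set.preimage_ofPred_eq,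
      hP.measure_countAtom hf, ← Finset.mul_prod_erase _ _ (Finset.mem_univ j),
      ← Finset.mul_prod_erase _ _ (Finset.mem_univ j)]
    have hrest : ∏ i ∈ Finset.univ.erase j, ENNReal.ofReal (poissonWeight (σ.real (f ⁻¹' {i}))
        (k i + if i = j then 1 else 0)) =
        ∏ i ∈ Finset.univ.erase j, ENNReal.ofReal (poissonWeight (σ.real (f ⁻¹' {i})) (k i)) :=
      Finset.prod_congr rfl fun i hi => by simp [Finset.ne_of_mem_erase hi]
    rw [hrest, if_pos rfl, ← mul_assoc, mul_right_comm]
    congr 1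
    have hw := succ_mul_poissonWeight (σ.real (f ⁻¹' {j})) (k j)
    rw [← ofReal_measureReal (μ := σ) (s := f ⁻¹' {j}), mul_comm,
      ← ENNReal.ofReal_mul measureReal_nonneg, ← hw, ENNReal.ofReal_mul (by positivity)]
    rw [← Nat.cast_succ, ENNReal.ofReal_natCast]

/-- **Mecke formula.** -/
theorem lintegral_tsum_remove [IsFiniteMeasure σ] (hP : IsPoissonMeasure σ P)
    {v : Measure X × X → ℝ≥0∞} (hv : Measurable v) :
    ∫⁻ ω, ∑' x : ω.carrier, v ((ω.remove x).toMeasure, (x : X)) ∂P =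
      ∫⁻ ω, ∫⁻ x, v (ω.toMeasure, x) ∂σ ∂P := by
  have h1 : ∫⁻ ω, ∑' x : ω.carrier, v ((ω.remove x).toMeasure, (x : X)) ∂P =
      ∫⁻ ω, ∫⁻ q, v q ∂ω.removals ∂P := by
    refine lintegral_congr_ae ?_
    filter_upwards [hP.ae_finite] with ω hω
    exact (Configuration.lintegral_removals hω hv).symm
  rw [h1, ← Measure.lintegral_bind Configuration.measurable_removals.aemeasurable hv.aemeasurable,
    hP.bind_removals, lintegral_prod _ hv.aemeasurable, lintegral_map (hv.lintegral_prod_right')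
    Configuration.measurable_toMeasure]

theorem aemeasurable_tsum_remove (hP : IsPoissonMeasure σ P)
    {v : Measure X × X → ℝ≥0∞} (hv : Measurable v) :
    AEMeasurable (fun ω => ∑' x : ω.carrier, v ((ω.remove x).toMeasure, (x : X))) P := by
  refine ⟨fun ω => ∫⁻ q, v q ∂ω.removals,
    (Measure.measurable_lintegral hv).comp Configuration.measurable_removals, ?_⟩
  filter_upwards [hP.ae_finite] with ω hω
  exact (Configuration.lintegral_removals hω hv).symm

/-- The Poisson measure is determined by its intensity. -/
theorem unique [Nonempty X] {P' : Measure (Configuration X)} (hP : IsPoissonMeasure σ P)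
    (hP' : IsPoissonMeasure σ P') : P = P' := by
  obtain ⟨x₀⟩ := ‹Nonempty X›
  have hmeas : Measurable fun ω : Configuration X => (ω.toMeasure, x₀) :=
    Configuration.measurable_toMeasure.prodMk measurable_const
  have := hP.isProbabilityMeasure
  have hnat : ∀ {Q : Measure (Configuration X)}, IsPoissonMeasure σ Q → ∀ B, MeasurableSet B →
      ∀ᵐ q : Measure X × X ∂(Q.map fun ω => (ω.toMeasure, x₀)), ∃ n : ℕ, q.1 B = (n : ℝ≥0∞) := by
    intro Q hQ B hB
    rw [ae_map_iff hmeas.aemeasurable (measurableSet_natMass hB)]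
    filter_upwards [hQ.ae_carrier_finite] with ω hω
    exact Configuration.exists_nat_toMeasure_eq hω hB
  have hfin : IsFiniteMeasure (P.map fun ω => (ω.toMeasure, x₀)) := inferInstance
  have key : P.map (fun ω => (ω.toMeasure, x₀)) = P'.map fun ω => (ω.toMeasure, x₀) := by
    refine ext_of_countAtom (hnat hP) (hnat hP') fun ι _ f hf j k => ?_
    rw [Measure.map_apply hmeas (measurableSet_countAtom hf j k),
      Measure.map_apply hmeas (measurableSet_countAtom hf j k)]
    by_cases hj : f x₀ = j
    · have e : (fun ω : Configuration X => (ω.toMeasure, x₀)) ⁻¹' countAtom f j k =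
          {ω | ∀ i, ω.toMeasure (f ⁻¹' {i}) = (k i : ℝ≥0∞)} := by
        ext ω; simp [countAtom, hj]
      rw [e, hP.measure_countAtom hf, hP'.measure_countAtom hf]
    · have e : (fun ω : Configuration X => (ω.toMeasure, x₀)) ⁻¹' countAtom f j k = ∅ := by
        ext ω; simp [countAtom, hj]
      rw [e, measure_empty, measure_empty]
  ext A hA
  obtain ⟨A', hA', rfl⟩ := hA
  have h := congrArg (fun M => M (Prod.fst ⁻¹' A')) key
  simp only [Measure.map_apply hmeas (measurable_fst hA')] at h
  exact h

end

end IsPoissonMeasure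

/-! ### Independence of the restrictions to disjoint sets -/

namespace IsPoissonMeasure

variable {X : Type*} [TopologicalSpace X] [MeasurableSpace X]
  {σ : Measure X} {P : Measure (Configuration X)}

/-- The finite dimensional distributions determine a measure also when they are known only up to a
constant factor. -/
theorem eq_smul_of_cylinders [Nonempty X] (hP : IsPoissonMeasure σ P)
    {Q : Measure (Configuration X)} {c : ℝ≥0∞} (hc : c ≠ ∞)
    (h : ∀ (n : ℕ) (A : Fin n → Set X), (∀ i, MeasurableSet (A i)) →
      (∀ i j, i ≠ j → Disjoint (A i) (A j)) → ∀ k : Fin n → ℕ,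
        Q {ω | ∀ i, ω.toMeasure (A i) = (k i : ℝ≥0∞)} =
          c * ∏ i, ENNReal.ofReal (poissonWeight (σ.real (A i)) (k i))) : Q = c • P := by
  rcases eq_or_ne c 0 with rfl | hc0
  · have h0 := h 0 (fun _ => ∅) (by simp) (by simp) (fun _ => 0)
    rw [zero_smul, ← Measure.measure_univ_eq_zero]
    simpa using h0
  · have hQ : IsPoissonMeasure σ (c⁻¹ • Q) := by
      intro n A hA hd k
      rw [Measure.smul_apply, h n A hA hd k, smul_eq_mul, ← mul_assoc,
        ENNReal.inv_mul_cancel hc0 hc, one_mul]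
      rfl
    rw [hP.unique hQ, smul_smul, ENNReal.mul_inv_cancel hc0 hc, one_smul]

theorem restrict (hP : IsPoissonMeasure σ P) {B : Set X} (hB : MeasurableSet B) :
    IsPoissonMeasure (σ.restrict B) (P.map fun ω => ω.restrict B) := by
  intro n A hA hd k
  have hm : MeasurableSet {ω : Configuration X | ∀ i, ω.toMeasure (A i) = (k i : ℝ≥0∞)} := by
    rw [Set.ofPred_forall]
    exact MeasurableSet.iInter fun i => Configuration.measurable_apply (hA i)
      (measurableSet_singleton _)
  rw [Measure.map_apply (Configuration.measurable_restrict hB) hm]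
  have h := hP n (fun i => A i ∩ B) (fun i => (hA i).inter hB)
    (fun i j hij => (hd i j hij).mono Set.inter_subset_left Set.inter_subset_left) k
  simp only [Set.preimage_ofPred_eq, Configuration.toMeasure_restrict _ hB,
    Measure.restrict_apply (hA _), measureReal_restrict_apply (hA _)]
  exact h

/-- The restrictions of a Poisson configuration to a set and to its complement are independent.
Conditioned on an event of the one, the other is still Poisson, hence has the same law. -/
theorem map_restrict_restrict_compl [Nonempty X] (hP : IsPoissonMeasure σ P) {B : Set X}
    (hB : MeasurableSet B) :
    P.map (fun ω => (ω.restrict B, ω.restrict Bᶜ)) =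
      (P.map fun ω => ω.restrict B).prod (P.map fun ω => ω.restrict Bᶜ) := by
  have hP1 := hP.restrict hB
  have hP2 := hP.restrict hB.compl
  have := hP.isProbabilityMeasure
  have := hP1.isProbabilityMeasure
  have := hP2.isProbabilityMeasure
  have hr1 := Configuration.measurable_restrict hB
  have hr2 := Configuration.measurable_restrict hB.compl
  have hcyl : ∀ (n : ℕ) (A : Fin n → Set X), (∀ i, MeasurableSet (A i)) → ∀ k : Fin n → ℕ,
      MeasurableSet {ω : Configuration X | ∀ i, ω.toMeasure (A i) = (k i : ℝ≥0∞)} := by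
    intro n A hA k
    rw [Set.ofPred_forall]
    exact MeasurableSet.iInter fun i => Configuration.measurable_apply (hA i)
      (measurableSet_singleton _)
  have step1 : ∀ (n : ℕ) (A : Fin n → Set X), (∀ i, MeasurableSet (A i)) →
      (∀ i j, i ≠ j → Disjoint (A i) (A j)) → ∀ k : Fin n → ℕ,
      (P.restrict ((fun ω => ω.restrict Bᶜ) ⁻¹'
          {ω | ∀ i, ω.toMeasure (A i) = (k i : ℝ≥0∞)})).map (fun ω => ω.restrict B) =
        (∏ i, ENNReal.ofReal (poissonWeight ((σ.restrict Bᶜ).real (A i)) (k i))) •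
          P.map (fun ω => ω.restrict B) := by
    intro n A hA hd k
    refine hP1.eq_smul_of_cylinders (ENNReal.prod_ne_top fun i _ => ENNReal.ofReal_ne_top) ?_
    intro n' A' hA' hd' k'
    rw [Measure.map_apply hr1 (hcyl n' A' hA' k'), Measure.restrict_apply (hr1 (hcyl n' A' hA' k'))]
    have h := hP.measure_eq_prod (ι := Fin n ⊕ Fin n')
      (A := Sum.elim (fun i => A i ∩ Bᶜ) (fun i => A' i ∩ B)) ?_ ?_ (Sum.elim k k')
    · rw [Fintype.prod_sum_type] at h
      simp only [Sum.elim_inl, Sum.elim_inr] at h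
      simp only [measureReal_restrict_apply (hA _), measureReal_restrict_apply (hA' _)]
      rw [← h]
      congr 1
      ext ω
      simp [Configuration.toMeasure_restrict _ hB, Configuration.toMeasure_restrict _ hB.compl,
        Measure.restrict_apply (hA _), Measure.restrict_apply (hA' _), and_comm]
    · rintro (i | i)
      · exact (hA i).inter hB.compl
      · exact (hA' i).inter hB
    · have hBB : ∀ i i', Disjoint (A i ∩ Bᶜ) (A' i' ∩ B) := fun i i' =>
        (disjoint_compl_left (a := B)).mono Set.inter_subset_right Set.inter_subset_right
      rintro (i | i) (j | j) hij
      · exact (hd i j fun h => hij (h ▸ rfl)).mono Set.inter_subset_left Set.inter_subset_left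
      · exact hBB i j
      · exact (hBB j i).symm
      · exact (hd' i j fun h => hij (h ▸ rfl)).mono Set.inter_subset_left Set.inter_subset_left
  symm
  refine Measure.prod_eq fun S T hS hT => ?_
  rw [Measure.map_apply (hr1.prodMk hr2) (hS.prod hT)]
  have key : (P.restrict ((fun ω => ω.restrict B) ⁻¹' S)).map (fun ω => ω.restrict Bᶜ) =
      (P.map (fun ω => ω.restrict B) S) • P.map (fun ω => ω.restrict Bᶜ) := by
    refine hP2.eq_smul_of_cylinders (measure_ne_top _ _) ?_
    intro n A hA hd k
    have h := congrArg (fun M => M S) (step1 n A hA hd k)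
    simp only [Measure.map_apply hr1 hS, Measure.restrict_apply (hr1 hS), Measure.smul_apply,
      smul_eq_mul] at h
    rw [Measure.map_apply hr2 (hcyl n A hA k), Measure.restrict_apply (hr2 (hcyl n A hA k)),
      Set.inter_comm, h, Measure.map_apply hr1 hS, mul_comm]
  have h := congrArg (fun M => M T) key
  simp only [Measure.map_apply hr2 hT, Measure.restrict_apply (hr2 hT), Measure.smul_apply,
    smul_eq_mul] at h
  rw [Measure.map_apply hr2 hT, ← h, Set.inter_comm]
  rfl

/-- A Poisson configuration is the superposition of its independent restrictions. -/
theorem map_toMeasure_eq_map_prod [Nonempty X] (hP : IsPoissonMeasure σ P) {B : Set X}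
    (hB : MeasurableSet B) :
    P.map Configuration.toMeasure =
      ((P.map fun ω => ω.restrict B).prod (P.map fun ω => ω.restrict Bᶜ)).map
        fun q => q.1.toMeasure + q.2.toMeasure := by
  have hm : Measurable fun q : Configuration X × Configuration X =>
      q.1.toMeasure + q.2.toMeasure :=
    (Configuration.measurable_toMeasure.comp measurable_fst).add
      (Configuration.measurable_toMeasure.comp measurable_snd)
  rw [← hP.map_restrict_restrict_compl hB, Measure.map_map hm
    ((Configuration.measurable_restrict hB).prodMk (Configuration.measurable_restrict hB.compl))]
  congr 1
  ext1 ω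
  simp only [Function.comp_apply, Configuration.toMeasure_restrict _ hB,
    Configuration.toMeasure_restrict _ hB.compl, Measure.restrict_add_restrict_compl hB]

end IsPoissonMeasure

/-! ### A functional isoperimetric inequality -/

section Auxiliary

theorem integrable_of_bounded {Ω : Type*} [MeasurableSpace Ω] {μ : Measure Ω} [IsFiniteMeasure μ]
    {f : Ω → ℝ} (hf : Measurable f) {C : ℝ} (hC : ∀ ω, |f ω| ≤ C) : Integrable f μ :=
  Integrable.of_bound hf.aestronglyMeasurable C (Filter.Eventually.of_forall hC)

/-- The Cauchy–Schwarz inequality as positivity of a quadratic form in `t` and `r`. -/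
theorem integral_mul_sq_le {Y : Type*} [MeasurableSpace Y] {μ : Measure Y} {f g : Y → ℝ}
    (hf : Integrable (fun y => f y ^ 2) μ) (hg : Integrable (fun y => g y ^ 2) μ)
    (hfg : Integrable (fun y => f y * g y) μ) (t r : ℝ) :
    0 ≤ t ^ 2 * ∫ y, f y ^ 2 ∂μ - 2 * t * r * ∫ y, f y * g y ∂μ + r ^ 2 * ∫ y, g y ^ 2 ∂μ := by
  have h : 0 ≤ ∫ y, (t * f y - r * g y) ^ 2 ∂μ := integral_nonneg fun y => sq_nonneg _
  have e : (fun y => (t * f y - r * g y) ^ 2) =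
      fun y => t ^ 2 * f y ^ 2 - 2 * t * r * (f y * g y) + r ^ 2 * g y ^ 2 := by
    ext y; ring
  have i1 : Integrable (fun y => t ^ 2 * f y ^ 2 - 2 * t * r * (f y * g y)) μ :=
    (hf.const_mul _).sub (hfg.const_mul _)
  rw [e, integral_add i1 (hg.const_mul _), integral_sub (hf.const_mul _) (hfg.const_mul _), integral_const_mul, integral_const_mul,
    integral_const_mul] at h
  exact h

/-- The Cauchy–Schwarz inequality in `ℝ × L²`, with the inner product in `L²` scaled by `κ`; the one
in `L²` is given in the form of `integral_mul_sq_le`. -/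
theorem mul_add_mul_sq_le {H M D : ℝ} (hH : 0 ≤ H) (hD : 0 ≤ D) {κ : ℝ} (hκ : 0 ≤ κ)
    (h : ∀ t r : ℝ, 0 ≤ t ^ 2 * H - 2 * t * r * M + r ^ 2 * D) (u U : ℝ) :
    (u * U + κ * M) ^ 2 ≤ (u ^ 2 + κ * D) * (U ^ 2 + κ * H) := by
  have hM : M ^ 2 ≤ H * D := by
    rcases hH.eq_or_lt with h0 | h0
    · have hM0 : M = 0 := by
        by_contra hne
        have h2 := h ((D + 1) / M) 1
        have h3 : (D + 1) / M * M = D + 1 := div_mul_cancel₀ _ hne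
        rw [← h0] at h2
        linarith
      simp [hM0, ← h0]
    · have h1 := h M H
      have h2 : 0 ≤ H * (H * D - M ^ 2) := by nlinarith
      have := nonneg_of_mul_nonneg_right h2 h0
      linarith
  have h1 := h u U
  nlinarith [mul_nonneg hκ h1, mul_nonneg (mul_nonneg hκ hκ) (sub_nonneg.2 hM)]

/-- Minkowski's inequality for the norm `(u, d) ↦ √(u² + κ ‖d‖²)` of `ℝ × L²(ν)`: the norm of an
average is at most the average of the norms. -/
theorem sqrt_integral_sq_add_le {Ω Y : Type*} [MeasurableSpace Ω] [MeasurableSpace Y]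
    {P : Measure Ω} [IsProbabilityMeasure P] {ν : Measure Y} [IsFiniteMeasure ν]
    {u : Ω → ℝ} (hu : Measurable u) {C : ℝ} (hC : ∀ ω, |u ω| ≤ C)
    {d : Ω × Y → ℝ} (hd : Measurable d) {K : ℝ} (hK : ∀ q, |d q| ≤ K) {κ : ℝ} (hκ : 0 ≤ κ) :
    √((∫ ω, u ω ∂P) ^ 2 + κ * ∫ y, (∫ ω, d (ω, y) ∂P) ^ 2 ∂ν) ≤
      ∫ ω, √(u ω ^ 2 + κ * ∫ y, d (ω, y) ^ 2 ∂ν) ∂P := by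
  set h : Y → ℝ := fun y => ∫ ω, d (ω, y) ∂P with hh
  have hhm : Measurable h :=
    (hd.stronglyMeasurable.integral_prod_left').measurable
  have hhK : ∀ y, |h y| ≤ K := by
    intro y
    have := norm_integral_le_of_norm_le_const (μ := P) (f := fun ω => d (ω, y))
      (Filter.Eventually.of_forall fun ω => hK (ω, y))
    simpa using this
  have hsq : ∀ a b c d : ℝ, |a| ≤ c → |b| ≤ d → |a * b| ≤ c * d := fun a b c d h1 h2 => by
    rw [abs_mul]; exact mul_le_mul h1 h2 (abs_nonneg _) ((abs_nonneg _).trans h1)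
  have hsq2 : ∀ a c : ℝ, |a| ≤ c → |a ^ 2| ≤ c ^ 2 := fun a c h1 => by
    rw [abs_pow]; exact pow_le_pow_left₀ (abs_nonneg _) h1 2
  have ih2 : Integrable (fun y => h y ^ 2) ν :=
    integrable_of_bounded (hhm.pow_const 2) fun y => hsq2 _ _ (hhK y)
  have id2 : ∀ ω, Integrable (fun y => d (ω, y) ^ 2) ν := fun ω =>
    integrable_of_bounded ((hd.comp measurable_prodMk_left).pow_const 2) fun y => hsq2 _ _ (hK _)
  have ihd : ∀ ω, Integrable (fun y => h y * d (ω, y)) ν := fun ω =>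
    integrable_of_bounded (hhm.mul (hd.comp measurable_prodMk_left))
      fun y => hsq _ _ _ _ (hhK y) (hK _)
  set U := ∫ ω, u ω ∂P with hU
  set H := ∫ y, h y ^ 2 ∂ν with hH
  have hH0 : 0 ≤ H := integral_nonneg fun y => sq_nonneg _
  have hD0 : ∀ ω, 0 ≤ ∫ y, d (ω, y) ^ 2 ∂ν := fun ω => integral_nonneg fun y => sq_nonneg _
  set R := √(U ^ 2 + κ * H) with hR
  have hR2 : R ^ 2 = U ^ 2 + κ * H := Real.sq_sqrt (by positivity)
  have hDm : Measurable fun ω => ∫ y, d (ω, y) ^ 2 ∂ν :=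
    ((hd.pow_const 2).stronglyMeasurable.integral_prod_right').measurable
  have hMm : Measurable fun ω => ∫ y, h y * d (ω, y) ∂ν := by
    have : Measurable fun q : Ω × Y => h q.2 * d q := (hhm.comp measurable_snd).mul hd
    exact (this.stronglyMeasurable.integral_prod_right').measurable
  have hDK : ∀ ω, ∫ y, d (ω, y) ^ 2 ∂ν ≤ K ^ 2 * ν.real Set.univ := by
    intro ω
    have := norm_integral_le_of_norm_le_const (μ := ν) (f := fun y => d (ω, y) ^ 2)
      (Filter.Eventually.of_forall fun y => hsq2 _ _ (hK (ω, y)))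
    exact (le_abs_self _).trans this
  have hMK : ∀ ω, |∫ y, h y * d (ω, y) ∂ν| ≤ K * K * ν.real Set.univ := fun ω =>
    norm_integral_le_of_norm_le_const (μ := ν) (f := fun y => h y * d (ω, y))
      (Filter.Eventually.of_forall fun y => hsq _ _ _ _ (hhK y) (hK (ω, y)))
  have hpt : ∀ ω, u ω * U + κ * ∫ y, h y * d (ω, y) ∂ν ≤
      √(u ω ^ 2 + κ * ∫ y, d (ω, y) ^ 2 ∂ν) * R := by
    intro ω
    rw [hR, ← Real.sqrt_mul (by have := hD0 ω; positivity)]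
    exact Real.le_sqrt_of_sq_le (mul_add_mul_sq_le hH0 (hD0 ω) hκ
      (integral_mul_sq_le ih2 (id2 ω) (ihd ω)) _ _)
  have hsm : Measurable fun ω => √(u ω ^ 2 + κ * ∫ y, d (ω, y) ^ 2 ∂ν) := by fun_prop
  have isq : Integrable (fun ω => √(u ω ^ 2 + κ * ∫ y, d (ω, y) ^ 2 ∂ν)) P := by
    refine integrable_of_bounded hsm (C := √(C ^ 2 + κ * (K ^ 2 * ν.real Set.univ))) fun ω => ?_
    rw [abs_of_nonneg (Real.sqrt_nonneg _)]
    refine Real.sqrt_le_sqrt (add_le_add ?_ (mul_le_mul_of_nonneg_left (hDK ω) hκ))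
    exact (le_abs_self _).trans (hsq2 _ _ (hC ω))
  have iu : Integrable u P := integrable_of_bounded hu hC
  have iM : Integrable (fun ω => ∫ y, h y * d (ω, y) ∂ν) P := integrable_of_bounded hMm hMK
  have hswap : ∫ ω, ∫ y, h y * d (ω, y) ∂ν ∂P = H := by
    rw [integral_integral_swap]
    · refine integral_congr_ae (Filter.Eventually.of_forall fun y => ?_)
      simp only [integral_const_mul]
      rw [sq]
    · exact integrable_of_bounded ((hhm.comp measurable_snd).mul hd)
        fun q => hsq _ _ _ _ (hhK q.2) (hK q)
  have hint : R * R ≤ (∫ ω, √(u ω ^ 2 + κ * ∫ y, d (ω, y) ^ 2 ∂ν) ∂P) * R := by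
    have := integral_mono ((iu.mul_const U).add (iM.const_mul κ)) (isq.mul_const R) hpt
    rw [integral_add' (iu.mul_const U) (iM.const_mul κ), integral_mul_const, integral_mul_const,
      integral_const_mul, hswap] at this
    rw [← sq, hR2, sq]
    exact this
  rcases (Real.sqrt_nonneg (U ^ 2 + κ * H)).eq_or_lt with h0 | h0
  · rw [hR, ← h0]
    exact integral_nonneg fun ω => Real.sqrt_nonneg _
  · exact le_of_mul_le_mul_right hint h0

end Auxiliary

/-- The carré du champ `∫ |F(μ + δ_x) - F(μ)|² σ(dx)` of a function of a counting measure. -/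
noncomputable def carreDuChamp {X : Type*} [MeasurableSpace X] (σ : Measure X) (F : Measure X → ℝ)
    (μ : Measure X) : ℝ :=
  ∫ x, (F (μ + Measure.dirac x) - F μ) ^ 2 ∂σ

section

variable {X : Type*} [MeasurableSpace X] {σ : Measure X} {F : Measure X → ℝ}

theorem Measurable.comp_add_dirac (hF : Measurable F) :
    Measurable fun q : Measure X × X => F (q.1 + Measure.dirac q.2) :=
  hF.comp (measurable_fst.add (Measure.measurable_dirac.comp measurable_snd))

theorem carreDuChamp_nonneg (μ : Measure X) : 0 ≤ carreDuChamp σ F μ :=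
  integral_nonneg fun _ => sq_nonneg _

theorem measurable_carreDuChamp [SFinite σ] (hF : Measurable F) :
    Measurable (carreDuChamp σ F) := by
  have : Measurable fun q : Measure X × X => (F (q.1 + Measure.dirac q.2) - F q.1) ^ 2 :=
    (hF.comp_add_dirac.sub (hF.comp measurable_fst)).pow_const 2
  exact this.stronglyMeasurable.integral_prod_right'.measurable

theorem carreDuChamp_le [IsFiniteMeasure σ] {K : ℝ} (hK : ∀ μ ν, |F μ - F ν| ≤ K)
    (μ : Measure X) : carreDuChamp σ F μ ≤ K ^ 2 * σ.real Set.univ := by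
  have := norm_integral_le_of_norm_le_const (μ := σ) (C := K ^ 2)
    (f := fun x => (F (μ + Measure.dirac x) - F μ) ^ 2)
    (Filter.Eventually.of_forall fun x => by
      rw [Real.norm_eq_abs, abs_pow]
      exact pow_le_pow_left₀ (abs_nonneg _) (hK _ _) 2)
  exact (le_abs_self _).trans this

theorem carreDuChamp_restrict_add [IsFiniteMeasure σ] (hF : Measurable F) {K : ℝ}
    (hK : ∀ μ ν, |F μ - F ν| ≤ K) {B : Set X} (hB : MeasurableSet B) (μ : Measure X) :
    carreDuChamp (σ.restrict B) F μ + carreDuChamp (σ.restrict Bᶜ) F μ = carreDuChamp σ F μ := by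
  refine integral_add_compl hB (integrable_of_bounded ?_ (C := K ^ 2) fun x => ?_)
  · exact ((hF.comp_add_dirac.comp measurable_prodMk_left).sub_const _).pow_const 2
  · rw [abs_pow]
    exact pow_le_pow_left₀ (abs_nonneg _) (hK _ _) 2

end

/-- The variance `x (1 - x)` of a Bernoulli variable with parameter `x`. -/
def bernoulliVar (x : ℝ) : ℝ := x * (1 - x)

theorem bernoulliVar_nonneg {x : ℝ} (h0 : 0 ≤ x) (h1 : x ≤ 1) : 0 ≤ bernoulliVar x :=
  mul_nonneg h0 (sub_nonneg.2 h1)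

theorem bernoulliVar_le (x : ℝ) : bernoulliVar x ≤ 1 / 4 := by
  unfold bernoulliVar; nlinarith [sq_nonneg (2 * x - 1)]

@[fun_prop]
theorem measurable_bernoulliVar : Measurable bernoulliVar := by
  unfold bernoulliVar; fun_prop

/-- The integrand of the functional isoperimetric inequality. -/
noncomputable def isoIntegrand {X : Type*} [MeasurableSpace X] (σ : Measure X) (κ : ℝ)
    (F : Measure X → ℝ) (μ : Measure X) : ℝ :=
  √(bernoulliVar (F μ) ^ 2 + κ * carreDuChamp σ F μ)

section

variable {X : Type*} [MeasurableSpace X] {σ : Measure X} {F : Measure X → ℝ} {κ : ℝ}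

theorem abs_sub_le_one (h0 : ∀ μ, 0 ≤ F μ) (h1 : ∀ μ, F μ ≤ 1) (μ ν : Measure X) :
    |F μ - F ν| ≤ 1 :=
  abs_le.2 ⟨by linarith [h0 μ, h1 ν], by linarith [h0 ν, h1 μ]⟩

theorem measurable_isoIntegrand [SFinite σ] (hF : Measurable F) :
    Measurable (isoIntegrand σ κ F) := by
  have := measurable_carreDuChamp (σ := σ) hF
  unfold isoIntegrand
  fun_prop

theorem isoIntegrand_nonneg (μ : Measure X) : 0 ≤ isoIntegrand σ κ F μ := Real.sqrt_nonneg _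

theorem abs_isoIntegrand_le [IsFiniteMeasure σ] (hκ : 0 ≤ κ) (h0 : ∀ μ, 0 ≤ F μ)
    (h1 : ∀ μ, F μ ≤ 1) (μ : Measure X) :
    |isoIntegrand σ κ F μ| ≤ √(1 + κ * σ.real Set.univ) := by
  rw [abs_of_nonneg (isoIntegrand_nonneg μ)]
  refine Real.sqrt_le_sqrt (add_le_add ?_ (mul_le_mul_of_nonneg_left ?_ hκ))
  · have := bernoulliVar_nonneg (h0 μ) (h1 μ)
    have := bernoulliVar_le (F μ)
    nlinarith
  · simpa using carreDuChamp_le (abs_sub_le_one h0 h1) μ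

end

namespace IsPoissonMeasure

section

variable {X : Type*} [TopologicalSpace X] [MeasurableSpace X]
  {σ : Measure X} {P : Measure (Configuration X)}

theorem lintegral_toMeasure_univ [IsFiniteMeasure σ] (hP : IsPoissonMeasure σ P) :
    ∫⁻ ω, ω.toMeasure Set.univ ∂P = σ Set.univ := by
  have := hP.isProbabilityMeasure
  have h := hP.lintegral_tsum_remove (v := fun _ => 1) measurable_const
  simp only [lintegral_const, measure_univ, mul_one, one_mul] at h
  rw [← h]
  refine lintegral_congr fun ω => ?_
  rw [Configuration.toMeasure_apply _ MeasurableSet.univ]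
  simp

/-- Up to an error of second order in the total mass, only configurations with a single point
contribute to the quadratic deviation of `F` from its value on the empty configuration. -/
theorem lintegral_sq_sub_le [IsFiniteMeasure σ] (hP : IsPoissonMeasure σ P) {F : Measure X → ℝ}
    (hF : Measurable F) (hF1 : ∀ μ ν, |F μ - F ν| ≤ 1) :
    ∫⁻ ω, ENNReal.ofReal ((F ω.toMeasure - F 0) ^ 2) ∂P ≤
      P {ω | ω.toMeasure Set.univ = 0} * ENNReal.ofReal (carreDuChamp σ F 0) +
        σ Set.univ * σ Set.univ := by
  classical
  have hle1 : ∀ μ ν, ENNReal.ofReal ((F μ - F ν) ^ 2) ≤ 1 := fun μ ν => by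
    rw [ENNReal.ofReal_le_one, sq_le_one_iff_abs_le_one]; exact hF1 μ ν
  let v : Measure X × X → ℝ≥0∞ := fun q =>
    if q.1 Set.univ = 0 then ENNReal.ofReal ((F (q.1 + Measure.dirac q.2) - F 0) ^ 2) else 1
  have hm0 : MeasurableSet {q : Measure X × X | q.1 Set.univ = 0} :=
    ((Measure.measurable_coe MeasurableSet.univ).comp measurable_fst) (measurableSet_singleton _)
  have hv : Measurable v := by
    refine Measurable.ite hm0 ?_ measurable_const
    exact ((hF.comp_add_dirac.sub_const _).pow_const 2).ennreal_ofReal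
  have hm : MeasurableSet {ω : Configuration X | ω.toMeasure Set.univ = 0} :=
    Configuration.measurable_apply MeasurableSet.univ (measurableSet_singleton _)
  calc ∫⁻ ω, ENNReal.ofReal ((F ω.toMeasure - F 0) ^ 2) ∂P
      ≤ ∫⁻ ω, ∑' x : ω.carrier, v ((ω.remove x).toMeasure, (x : X)) ∂P := by
        refine lintegral_mono fun ω => ?_
        rcases ω.carrier.eq_empty_or_nonempty with he | ⟨x, hx⟩
        · have : ω.toMeasure = 0 := by
            rw [← Measure.measure_univ_eq_zero,
              Configuration.toMeasure_apply _ MeasurableSet.univ, ENNReal.tsum_eq_zero]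
            rintro ⟨x, hx⟩
            simp [he] at hx
          simp [this]
        · refine le_trans ?_ (ENNReal.le_tsum ⟨x, hx⟩)
          simp only [v]
          split_ifs
          · rw [Configuration.toMeasure_remove hx]
          · exact hle1 _ _
    _ = ∫⁻ ω, ∫⁻ x, v (ω.toMeasure, x) ∂σ ∂P := hP.lintegral_tsum_remove hv
    _ ≤ ∫⁻ ω, ({ω : Configuration X | ω.toMeasure Set.univ = 0}.indicator
          (fun _ => ENNReal.ofReal (carreDuChamp σ F 0)) ω +
            σ Set.univ * ω.toMeasure Set.univ) ∂P := by
        refine lintegral_mono_ae ?_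
        filter_upwards [hP.ae_carrier_finite] with ω hω
        by_cases h0 : ω.toMeasure Set.univ = 0
        · rw [Set.indicator_of_mem (by exact h0), h0, mul_zero, add_zero]
          simp only [v, h0, if_true]
          rw [Measure.measure_univ_eq_zero.1 h0]
          refine (ofReal_integral_eq_lintegral_ofReal ?_
            (Filter.Eventually.of_forall fun x => sq_nonneg _)).ge
          refine integrable_of_bounded (C := 1)
            (((hF.comp_add_dirac.comp measurable_prodMk_left).sub_const _).pow_const 2) fun x => ?_
          rw [abs_pow]
          exact pow_le_one₀ (abs_nonneg _) (hF1 _ _)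
        · rw [Set.indicator_of_notMem (by exact h0), zero_add]
          simp only [v, h0, if_false, lintegral_const, one_mul]
          obtain ⟨n, hn⟩ := Configuration.exists_nat_toMeasure_eq hω MeasurableSet.univ
          refine le_mul_of_one_le_right' ?_
          rw [hn] at h0 ⊢
          exact_mod_cast Nat.one_le_iff_ne_zero.2 (by exact_mod_cast h0)
    _ = _ := by
        rw [lintegral_add_left (measurable_const.indicator hm), lintegral_indicator_const hm,
          lintegral_const_mul _ (Configuration.measurable_apply MeasurableSet.univ),
          hP.lintegral_toMeasure_univ, mul_comm (P _)]

theorem integral_sq_sub_le [IsFiniteMeasure σ] (hP : IsPoissonMeasure σ P) {F : Measure X → ℝ}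
    (hF : Measurable F) (hF1 : ∀ μ ν, |F μ - F ν| ≤ 1) :
    ∫ ω, (F ω.toMeasure - F 0) ^ 2 ∂P ≤
      P.real {ω | ω.toMeasure Set.univ = 0} * carreDuChamp σ F 0 + σ.real Set.univ ^ 2 := by
  have := hP.isProbabilityMeasure
  have hm : Measurable fun ω : Configuration X => (F ω.toMeasure - F 0) ^ 2 :=
    ((hF.comp Configuration.measurable_toMeasure).sub_const _).pow_const 2
  rw [integral_eq_lintegral_of_nonneg_ae (Filter.Eventually.of_forall fun ω => sq_nonneg _)
    hm.aestronglyMeasurable]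
  refine ENNReal.toReal_le_of_le_ofReal
    (add_nonneg (mul_nonneg measureReal_nonneg (carreDuChamp_nonneg _)) (sq_nonneg _)) ?_
  refine (hP.lintegral_sq_sub_le hF hF1).trans_eq ?_
  rw [ENNReal.ofReal_add (mul_nonneg measureReal_nonneg (carreDuChamp_nonneg _)) (sq_nonneg _),
    ENNReal.ofReal_mul measureReal_nonneg, ofReal_measureReal, sq,
    ENNReal.ofReal_mul measureReal_nonneg, ofReal_measureReal]

theorem integrable_comp_toMeasure (hP : IsPoissonMeasure σ P) {G : Measure X → ℝ}
    (hG : Measurable G) {C : ℝ} (hC : ∀ μ, |G μ| ≤ C) :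
    Integrable (fun ω : Configuration X => G ω.toMeasure) P := by
  have := hP.isProbabilityMeasure
  exact integrable_of_bounded (hG.comp Configuration.measurable_toMeasure) fun ω => hC _

/-- The functional isoperimetric inequality up to an error which is quadratic in the total mass. -/
theorem bernoulliVar_integral_le_add_sq [IsFiniteMeasure σ] (hP : IsPoissonMeasure σ P) {κ : ℝ}
    (hκ : 1 / 2 < κ) {F : Measure X → ℝ} (hF : Measurable F) (h0 : ∀ μ, 0 ≤ F μ)
    (h1 : ∀ μ, F μ ≤ 1) :
    bernoulliVar (∫ ω, F ω.toMeasure ∂P) ≤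
      ∫ ω, isoIntegrand σ κ F ω.toMeasure ∂P +
        (1 + 1 / (κ - 1 / 2) ^ 2) * σ.real Set.univ ^ 2 := by
  have := hP.isProbabilityMeasure
  have hκ0 : 0 ≤ κ := by linarith
  set s := σ.real Set.univ with hs
  have hs0 : 0 ≤ s := measureReal_nonneg
  have hκ1 : 0 < κ - 1 / 2 := by linarith
  rcases le_or_gt s (κ - 1 / 2) with hle | hgt
  swap
  · have hb := bernoulliVar_le (∫ ω, F ω.toMeasure ∂P)
    have hi : 0 ≤ ∫ ω, isoIntegrand σ κ F ω.toMeasure ∂P :=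
      integral_nonneg fun ω => isoIntegrand_nonneg _
    have h2 : 1 ≤ 1 / (κ - 1 / 2) ^ 2 * s ^ 2 := by
      rw [one_div, inv_mul_eq_div, one_le_div (by positivity)]
      exact pow_le_pow_left₀ hκ1.le hgt.le 2
    nlinarith [sq_nonneg s]
  set a := F 0 with ha
  set g := carreDuChamp σ F 0 with hg
  have hg0 : 0 ≤ g := carreDuChamp_nonneg _
  have hgs : g ≤ s := by simpa using carreDuChamp_le (abs_sub_le_one h0 h1) (0 : Measure X)
  set q := P.real {ω | ω.toMeasure Set.univ = 0} with hq
  have hm : MeasurableSet {ω : Configuration X | ω.toMeasure Set.univ = 0} :=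
    Configuration.measurable_apply MeasurableSet.univ (measurableSet_singleton _)
  have hdev := hP.integral_sq_sub_le hF (abs_sub_le_one h0 h1)
  have hpt : ∀ ω : Configuration X, bernoulliVar (F ω.toMeasure) +
      {ω : Configuration X | ω.toMeasure Set.univ = 0}.indicator (fun _ => g) ω ≤
        isoIntegrand σ κ F ω.toMeasure := by
    intro ω
    have hJ := bernoulliVar_nonneg (h0 ω.toMeasure) (h1 ω.toMeasure)
    have hJ4 := bernoulliVar_le (F ω.toMeasure)
    by_cases hω : ω.toMeasure Set.univ = 0
    · rw [Set.indicator_of_mem (by exact hω)]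
      have e := Measure.measure_univ_eq_zero.1 hω
      rw [e] at hJ hJ4 ⊢
      refine Real.le_sqrt_of_sq_le ?_
      rw [← hg]
      nlinarith [mul_nonneg hg0 hg0, mul_le_mul_of_nonneg_left hJ4 hg0,
        mul_le_mul_of_nonneg_left (hgs.trans hle) hg0]
    · rw [Set.indicator_of_notMem (by exact hω), add_zero]
      exact Real.le_sqrt_of_sq_le (le_add_of_nonneg_right
        (mul_nonneg hκ0 (carreDuChamp_nonneg _)))
  have iF : Integrable (fun ω : Configuration X => F ω.toMeasure) P :=
    hP.integrable_comp_toMeasure hF (C := 1) fun μ => by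
      rw [abs_of_nonneg (h0 μ)]; exact h1 μ
  have iF2 : Integrable (fun ω : Configuration X => F ω.toMeasure ^ 2) P :=
    hP.integrable_comp_toMeasure (hF.pow_const 2) (C := 1) fun μ => by
      rw [abs_of_nonneg (sq_nonneg _)]; exact pow_le_one₀ (h0 μ) (h1 μ)
  have eJ : (fun ω : Configuration X => bernoulliVar (F ω.toMeasure)) =
      fun ω => F ω.toMeasure - F ω.toMeasure ^ 2 := by
    ext ω; unfold bernoulliVar; ring
  have iJ : Integrable (fun ω : Configuration X => bernoulliVar (F ω.toMeasure)) P := by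
    rw [eJ]; exact iF.sub iF2
  have iI : Integrable (fun ω : Configuration X => isoIntegrand σ κ F ω.toMeasure) P :=
    hP.integrable_comp_toMeasure (measurable_isoIntegrand hF) (abs_isoIntegrand_le hκ0 h0 h1)
  have hint := integral_mono (iJ.add ((integrable_const g).indicator hm)) iI hpt
  rw [integral_add' iJ ((integrable_const g).indicator hm), integral_indicator_const _ hm,
    smul_eq_mul, ← hq] at hint
  have hJint : ∫ ω, bernoulliVar (F ω.toMeasure) ∂P =
      ∫ ω, F ω.toMeasure ∂P - ∫ ω, F ω.toMeasure ^ 2 ∂P := by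
    rw [eJ, integral_sub iF iF2]
  have edev : ∫ ω, (F ω.toMeasure - a) ^ 2 ∂P =
      ∫ ω, F ω.toMeasure ^ 2 ∂P - 2 * a * ∫ ω, F ω.toMeasure ∂P + a ^ 2 := by
    have e : (fun ω : Configuration X => (F ω.toMeasure - a) ^ 2) =
        fun ω => (F ω.toMeasure ^ 2 - 2 * a * F ω.toMeasure) + a ^ 2 := by
      ext ω; ring
    have i1 : Integrable (fun ω : Configuration X =>
        F ω.toMeasure ^ 2 - 2 * a * F ω.toMeasure) P := iF2.sub (iF.const_mul _)
    rw [e, integral_add i1 (integrable_const _), integral_sub iF2 (iF.const_mul _),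
      integral_const_mul]
    simp
  rw [← ha, ← hq, ← hs, edev] at hdev
  rw [hJint] at hint
  have hc : 0 ≤ 1 / (κ - 1 / 2) ^ 2 * s ^ 2 := by positivity
  unfold bernoulliVar
  nlinarith [sq_nonneg (∫ ω, F ω.toMeasure ∂P - a)]

end

end IsPoissonMeasure

namespace IsPoissonMeasure

section

variable {X : Type*} [TopologicalSpace X] [MeasurableSpace X]
  {σ : Measure X} {P : Measure (Configuration X)}

/-- Averaging over the independent restrictions of the configuration to `B` and its complement. -/
theorem integral_toMeasure_eq [Nonempty X] (hP : IsPoissonMeasure σ P) {B : Set X}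
    (hB : MeasurableSet B) {H : Measure X → ℝ} (hH : Measurable H) {C : ℝ}
    (hC : ∀ μ, |H μ| ≤ C) :
    ∫ ω, H ω.toMeasure ∂P =
      ∫ ω₁, ∫ ω₂, H (ω₁.toMeasure + ω₂.toMeasure) ∂P.map (fun ω => ω.restrict Bᶜ)
        ∂P.map (fun ω => ω.restrict B) := by
  have := (hP.restrict hB).isProbabilityMeasure
  have := (hP.restrict hB.compl).isProbabilityMeasure
  have hm : Measurable fun q : Configuration X × Configuration X =>
      q.1.toMeasure + q.2.toMeasure :=
    (Configuration.measurable_toMeasure.comp measurable_fst).add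
      (Configuration.measurable_toMeasure.comp measurable_snd)
  rw [← integral_map (μ := P) Configuration.measurable_toMeasure.aemeasurable
    hH.aestronglyMeasurable, hP.map_toMeasure_eq_map_prod hB,
    integral_map hm.aemeasurable hH.aestronglyMeasurable]
  exact integral_prod (fun q : Configuration X × Configuration X =>
    H (q.1.toMeasure + q.2.toMeasure)) (integrable_of_bounded (hH.comp hm) fun q => hC _)

/-- The functional isoperimetric inequality with an error that decays geometrically in the number of
bisections of the space. The induction step is the tensorization of the inequality. -/
theorem bernoulliVar_integral_le_add_pow [Nonempty X] {κ : ℝ} (hκ : 1 / 2 < κ) (n : ℕ) :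
    ∀ (σ : Measure X) [IsFiniteMeasure σ], IsDiffuse σ →
      ∀ P : Measure (Configuration X), IsPoissonMeasure σ P →
      ∀ F : Measure X → ℝ, Measurable F → (∀ μ, 0 ≤ F μ) → (∀ μ, F μ ≤ 1) →
        bernoulliVar (∫ ω, F ω.toMeasure ∂P) ≤ ∫ ω, isoIntegrand σ κ F ω.toMeasure ∂P +
          (1 + 1 / (κ - 1 / 2) ^ 2) * (5 / 9) ^ n * σ.real Set.univ ^ 2 := by
  have hκ0 : 0 ≤ κ := by linarith
  induction n with
  | zero =>
    intro σ _ hσ P hP F hF h0 h1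
    simpa using hP.bernoulliVar_integral_le_add_sq hκ hF h0 h1
  | succ n ih =>
    intro σ _ hσ P hP F hF h0 h1
    obtain ⟨B, hB, hB1, hB2⟩ := hσ.exists_subset_third
    have hP1 := hP.restrict hB
    have hP2 := hP.restrict hB.compl
    set P1 := P.map (fun ω => ω.restrict B) with hP1def
    set P2 := P.map (fun ω => ω.restrict Bᶜ) with hP2def
    have := hP1.isProbabilityMeasure
    have := hP2.isProbabilityMeasure
    have hs : σ.real B + σ.real Bᶜ = σ.real Set.univ := measureReal_add_measureReal_compl hB
    set c := (1 + 1 / (κ - 1 / 2) ^ 2) * (5 / 9) ^ n with hc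
    have hc0 : 0 ≤ c := by positivity
    have hmadd : Measurable fun q : Measure X × Configuration X => q.1 + q.2.toMeasure :=
      measurable_fst.add (Configuration.measurable_toMeasure.comp measurable_snd)
    -- the average of `F` over the second half of the configuration
    set G : Measure X → ℝ := fun μ => ∫ ω, F (μ + ω.toMeasure) ∂P2 with hG
    have hGm : Measurable G :=
      ((hF.comp hmadd).stronglyMeasurable.integral_prod_right' (ν := P2)).measurable
    have hFabs : ∀ μ, |F μ| ≤ 1 := fun μ => by rw [abs_of_nonneg (h0 μ)]; exact h1 μ
    have iF2 : ∀ μ : Measure X, Integrable (fun ω : Configuration X => F (μ + ω.toMeasure)) P2 :=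
      fun μ => integrable_of_bounded ((hF.comp hmadd).comp measurable_prodMk_left)
        fun ω => hFabs _
    have hG0 : ∀ μ, 0 ≤ G μ := fun μ => integral_nonneg fun ω => h0 _
    have hG1 : ∀ μ, G μ ≤ 1 := fun μ => by
      have := integral_mono (iF2 μ) (integrable_const (1 : ℝ)) fun ω => h1 _
      simpa using this
    have key : ∀ μ : Measure X, isoIntegrand (σ.restrict B) κ G μ ≤
        ∫ ω, isoIntegrand σ κ F (μ + ω.toMeasure) ∂P2 + c * σ.real Bᶜ ^ 2 := by
      intro μ
      have hFμ : Measurable fun ν => F (μ + ν) := hF.comp (measurable_const.add measurable_id)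
      have hJ := ih (σ.restrict Bᶜ) (hσ.restrict hB.compl) P2 hP2 (fun ν => F (μ + ν)) hFμ
        (fun ν => h0 _) (fun ν => h1 _)
      rw [measureReal_restrict_apply_univ] at hJ
      have hJ0 := bernoulliVar_nonneg (hG0 μ) (hG1 μ)
      set U := ∫ ω : Configuration X, isoIntegrand (σ.restrict Bᶜ) κ (fun ν => F (μ + ν))
        ω.toMeasure ∂P2 with hU
      set e := c * σ.real Bᶜ ^ 2 with he
      have he0 : 0 ≤ e := by positivity
      have hU0 : 0 ≤ U := integral_nonneg fun ω => isoIntegrand_nonneg _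
      set w := carreDuChamp (σ.restrict B) G μ with hw
      have hw0 : 0 ≤ w := carreDuChamp_nonneg _
      have hmink := sqrt_integral_sq_add_le (P := P2) (ν := σ.restrict B)
        (u := fun ω => isoIntegrand (σ.restrict Bᶜ) κ (fun ν => F (μ + ν)) ω.toMeasure)
        ((measurable_isoIntegrand hFμ).comp Configuration.measurable_toMeasure)
        (fun ω => abs_isoIntegrand_le hκ0 (fun ν => h0 _) (fun ν => h1 _) _)
        (d := fun q => F (μ + q.1.toMeasure + Measure.dirac q.2) - F (μ + q.1.toMeasure))
        (by
          refine (hF.comp ?_).sub (hF.comp ?_)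
          · exact (measurable_const.add (Configuration.measurable_toMeasure.comp
              measurable_fst)).add (Measure.measurable_dirac.comp measurable_snd)
          · exact measurable_const.add (Configuration.measurable_toMeasure.comp measurable_fst))
        (K := 1) (fun q => abs_sub_le_one h0 h1 _ _) hκ0
      have hR : ∀ ω : Configuration X,
          √(isoIntegrand (σ.restrict Bᶜ) κ (fun ν => F (μ + ν)) ω.toMeasure ^ 2 +
            κ * ∫ y, (F (μ + ω.toMeasure + Measure.dirac y) - F (μ + ω.toMeasure)) ^ 2
              ∂σ.restrict B) = isoIntegrand σ κ F (μ + ω.toMeasure) := by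
        intro ω
        unfold isoIntegrand
        congr 1
        rw [Real.sq_sqrt (add_nonneg (sq_nonneg _) (mul_nonneg hκ0 (carreDuChamp_nonneg _))),
          ← carreDuChamp_restrict_add hF (abs_sub_le_one h0 h1) hB]
        simp only [carreDuChamp, add_assoc]
        ring
      simp only [hR] at hmink
      have hL : ∫ y, (∫ ω : Configuration X, (F (μ + ω.toMeasure + Measure.dirac y) -
          F (μ + ω.toMeasure)) ∂P2) ^ 2 ∂σ.restrict B = w := by
        refine integral_congr_ae (Filter.Eventually.of_forall fun y => ?_)
        have : ∀ ω : Configuration X, μ + ω.toMeasure + Measure.dirac y =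
            μ + Measure.dirac y + ω.toMeasure := fun ω => add_right_comm _ _ _
        simp only [this]
        rw [integral_sub (iF2 _) (iF2 _)]
      rw [hL, ← hU] at hmink
      refine le_trans ?_ (add_le_add hmink le_rfl)
      -- `√((U + e)² + κ w) ≤ √(U² + κ w) + e`
      refine Real.sqrt_le_iff.2 ⟨by positivity, ?_⟩
      have hs1 : U ≤ √(U ^ 2 + κ * w) :=
        Real.le_sqrt_of_sq_le (le_add_of_nonneg_right (by positivity))
      have hs2 : √(U ^ 2 + κ * w) ^ 2 = U ^ 2 + κ * w := Real.sq_sqrt (by positivity)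
      have hJ' : bernoulliVar (G μ) ^ 2 ≤ (U + e) ^ 2 := pow_le_pow_left₀ hJ0 hJ 2
      nlinarith [mul_le_mul_of_nonneg_right hs1 he0]
    have hmain := ih (σ.restrict B) (hσ.restrict hB) P1 hP1 G hGm hG0 hG1
    rw [measureReal_restrict_apply_univ] at hmain
    have hFG : ∫ ω, F ω.toMeasure ∂P = ∫ ω, G ω.toMeasure ∂P1 :=
      hP.integral_toMeasure_eq hB hF hFabs
    have hIm := measurable_isoIntegrand (σ := σ) (κ := κ) hF
    have hIb := abs_isoIntegrand_le (σ := σ) hκ0 h0 h1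
    have hI := hP.integral_toMeasure_eq hB hIm hIb
    have iI : Integrable (fun ω₁ : Configuration X =>
        ∫ ω, isoIntegrand σ κ F (ω₁.toMeasure + ω.toMeasure) ∂P2) P1 := by
      refine integrable_of_bounded (C := √(1 + κ * σ.real Set.univ)) ?_ fun ω₁ => ?_
      · exact ((hIm.comp hmadd).stronglyMeasurable.integral_prod_right' (ν := P2)).measurable.comp
          Configuration.measurable_toMeasure
      · have := norm_integral_le_of_norm_le_const (μ := P2)
          (f := fun ω : Configuration X => isoIntegrand σ κ F (ω₁.toMeasure + ω.toMeasure))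
          (Filter.Eventually.of_forall fun ω => hIb _)
        simpa using this
    have hstep := integral_mono
      (hP1.integrable_comp_toMeasure (measurable_isoIntegrand (σ := σ.restrict B) (κ := κ) hGm)
        (abs_isoIntegrand_le hκ0 hG0 hG1))
      (iI.add (integrable_const (c * σ.real Bᶜ ^ 2))) fun ω => key ω.toMeasure
    rw [integral_add' iI (integrable_const _), integral_const, probReal_univ, one_smul] at hstep
    rw [hFG, hI, pow_succ]
    have hsq : σ.real B ^ 2 + σ.real Bᶜ ^ 2 ≤ 5 / 9 * σ.real Set.univ ^ 2 := by
      rw [← hs] at hB1 hB2 ⊢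
      nlinarith
    have := mul_le_mul_of_nonneg_left hsq hc0
    calc _ ≤ _ := hmain
      _ ≤ _ := add_le_add hstep le_rfl
      _ = ∫ ω₁, ∫ ω₂, isoIntegrand σ κ F (ω₁.toMeasure + ω₂.toMeasure) ∂P2 ∂P1 +
          c * (σ.real B ^ 2 + σ.real Bᶜ ^ 2) := by ring
      _ ≤ _ := by
        refine add_le_add le_rfl (this.trans_eq ?_)
        rw [hc]; ring

/-- A Bobkov type functional isoperimetric inequality on the Poisson space. -/
theorem bernoulliVar_integral_le [Nonempty X] [IsFiniteMeasure σ] (hP : IsPoissonMeasure σ P)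
    (hσ : IsDiffuse σ) {κ : ℝ} (hκ : 1 / 2 < κ) {F : Measure X → ℝ} (hF : Measurable F)
    (h0 : ∀ μ, 0 ≤ F μ) (h1 : ∀ μ, F μ ≤ 1) :
    bernoulliVar (∫ ω, F ω.toMeasure ∂P) ≤ ∫ ω, isoIntegrand σ κ F ω.toMeasure ∂P := by
  have hlim : Filter.Tendsto (fun n : ℕ => ∫ ω, isoIntegrand σ κ F ω.toMeasure ∂P +
      (1 + 1 / (κ - 1 / 2) ^ 2) * (5 / 9 : ℝ) ^ n * σ.real Set.univ ^ 2) Filter.atTop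
      (nhds (∫ ω, isoIntegrand σ κ F ω.toMeasure ∂P +
        (1 + 1 / (κ - 1 / 2) ^ 2) * 0 * σ.real Set.univ ^ 2)) :=
    (((tendsto_pow_atTop_nhds_zero_of_lt_one (by norm_num) (by norm_num)).const_mul _).mul_const
      _).const_add _
  rw [mul_zero, zero_mul, add_zero] at hlim
  exact ge_of_tendsto' hlim fun n =>
    bernoulliVar_integral_le_add_pow hκ n σ hσ P hP F hF h0 h1

end

end IsPoissonMeasure

/-! ### The Poincaré and Cheeger inequalities -/

section

variable {X : Type*} [MeasurableSpace X] {σ : Measure X}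

theorem carreDuChamp_const_add_mul (F : Measure X → ℝ) (a t : ℝ) (μ : Measure X) :
    carreDuChamp σ (fun μ => a + t * F μ) μ = t ^ 2 * carreDuChamp σ F μ := by
  unfold carreDuChamp
  rw [← integral_const_mul]
  refine integral_congr_ae (Filter.Eventually.of_forall fun x => ?_)
  ring

theorem sqrt_sq_add_le {J y : ℝ} (hJ : 0 < J) (hy : 0 ≤ y) : √(J ^ 2 + y) ≤ J + y / (2 * J) := by
  refine Real.sqrt_le_iff.2 ⟨by positivity, ?_⟩
  have : (J + y / (2 * J)) ^ 2 = J ^ 2 + y + (y / (2 * J)) ^ 2 := by field_simp; ring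
  rw [this]
  nlinarith [sq_nonneg (y / (2 * J))]

end

namespace IsPoissonMeasure

section

variable {X : Type*} [TopologicalSpace X] [MeasurableSpace X]
  {σ : Measure X} {P : Measure (Configuration X)}

/-- Cheeger type inequality: `bernoulliVar` vanishes on indicator functions. -/
theorem bernoulliVar_le_integral_sqrt [Nonempty X] [IsFiniteMeasure σ] (hP : IsPoissonMeasure σ P)
    (hσ : IsDiffuse σ) {A : Set (Measure X)} (hA : MeasurableSet A) :
    bernoulliVar (P.real (Configuration.toMeasure ⁻¹' A)) ≤
      √(3 / 4) * ∫ ω, √(carreDuChamp σ (A.indicator fun _ => 1) ω.toMeasure) ∂P := by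
  have h := hP.bernoulliVar_integral_le hσ (κ := 3 / 4) (by norm_num)
    (F := A.indicator fun _ => 1) (measurable_const.indicator hA)
    (fun μ => Set.indicator_nonneg (fun _ _ => zero_le_one) μ)
    (fun μ => Set.indicator_le_self' (fun _ _ => zero_le_one) μ)
  have e : (fun ω : Configuration X => A.indicator (fun _ => (1 : ℝ)) ω.toMeasure) =
      (Configuration.toMeasure ⁻¹' A).indicator fun _ => 1 := rfl
  rw [e, integral_indicator_const _ (Configuration.measurable_toMeasure hA), smul_eq_mul,
    mul_one] at h
  refine h.trans_eq ?_
  rw [← integral_const_mul]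
  refine integral_congr_ae (Filter.Eventually.of_forall fun ω => ?_)
  have h0 : bernoulliVar (A.indicator (fun _ => (1 : ℝ)) ω.toMeasure) = 0 := by
    by_cases hω : ω.toMeasure ∈ A <;> simp [hω, bernoulliVar]
  simp only [isoIntegrand, h0]
  rw [zero_pow two_ne_zero, zero_add, Real.sqrt_mul (by norm_num)]

/-- The Poincaré inequality for bounded functions, by linearization of the functional isoperimetric
inequality at the constant function `1 / 2`. -/
theorem integral_sq_sub_sq_integral_le [Nonempty X] [IsFiniteMeasure σ]
    (hP : IsPoissonMeasure σ P) (hσ : IsDiffuse σ) {F : Measure X → ℝ} (hF : Measurable F) {M : ℝ}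
    (hM : ∀ μ, |F μ| ≤ M) :
    ∫ ω, F ω.toMeasure ^ 2 ∂P - (∫ ω, F ω.toMeasure ∂P) ^ 2 ≤
      ∫ ω, carreDuChamp σ F ω.toMeasure ∂P := by
  have := hP.isProbabilityMeasure
  have hM0 : 0 ≤ M := (abs_nonneg _).trans (hM 0)
  set m := ∫ ω, F ω.toMeasure ∂P with hm
  set S := ∫ ω, F ω.toMeasure ^ 2 ∂P with hS
  set G := ∫ ω, carreDuChamp σ F ω.toMeasure ∂P with hG
  have iF : Integrable (fun ω : Configuration X => F ω.toMeasure) P :=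
    hP.integrable_comp_toMeasure hF hM
  have hF2 : ∀ μ, F μ ^ 2 ≤ M ^ 2 := fun μ => sq_le_sq' (abs_le.1 (hM μ)).1 (abs_le.1 (hM μ)).2
  have iF2 : Integrable (fun ω : Configuration X => F ω.toMeasure ^ 2) P :=
    hP.integrable_comp_toMeasure (hF.pow_const 2) (C := M ^ 2) fun μ => by
      rw [abs_of_nonneg (sq_nonneg _)]; exact hF2 μ
  have iG : Integrable (fun ω : Configuration X => carreDuChamp σ F ω.toMeasure) P :=
    hP.integrable_comp_toMeasure (measurable_carreDuChamp hF)
      (C := (2 * M) ^ 2 * σ.real Set.univ) fun μ => by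
        rw [abs_of_nonneg (carreDuChamp_nonneg _)]
        refine carreDuChamp_le (fun μ ν => ?_) μ
        have h1 := abs_le.1 (hM μ)
        have h2 := abs_le.1 (hM ν)
        exact abs_le.2 ⟨by linarith, by linarith⟩
  have key : ∀ t : ℝ, 0 < t → t < 1 / (4 * (M + 1)) →
      (S - m ^ 2) * (1 / 2 - 2 * t ^ 2 * M ^ 2) ≤ (1 / 2 + t) * G := by
    intro t ht0 ht1
    have htM : t * (M + 1) < 1 / 4 := by
      rw [lt_div_iff₀ (by positivity)] at ht1
      linarith
    have htM' : t * M ≤ 1 / 4 := by nlinarith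
    have htF : ∀ μ, |t * F μ| ≤ 1 / 4 := fun μ => by
      rw [abs_mul, abs_of_pos ht0]
      exact (mul_le_mul_of_nonneg_left (hM μ) ht0.le).trans htM'
    have hb := hP.bernoulliVar_integral_le hσ (κ := 1 / 2 + t) (by linarith)
      (F := fun μ => 1 / 2 + t * F μ) (by fun_prop)
      (fun μ => by have := abs_le.1 (htF μ); linarith)
      (fun μ => by have := abs_le.1 (htF μ); linarith)
    set j := 1 / 4 - t ^ 2 * M ^ 2 with hj
    have hj0 : 0 < j := by
      have : t ^ 2 * M ^ 2 ≤ (1 / 4) ^ 2 := by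
        rw [← mul_pow]; exact pow_le_pow_left₀ (by positivity) htM' 2
      rw [hj]; linarith
    have hpt : ∀ ω : Configuration X,
        isoIntegrand σ (1 / 2 + t) (fun μ => 1 / 2 + t * F μ) ω.toMeasure ≤
          1 / 4 - t ^ 2 * F ω.toMeasure ^ 2 +
            (1 / 2 + t) * t ^ 2 / (2 * j) * carreDuChamp σ F ω.toMeasure := by
      intro ω
      have hJ : bernoulliVar (1 / 2 + t * F ω.toMeasure) = 1 / 4 - t ^ 2 * F ω.toMeasure ^ 2 := by
        unfold bernoulliVar; ring
      have hjJ : j ≤ 1 / 4 - t ^ 2 * F ω.toMeasure ^ 2 := by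
        have := mul_le_mul_of_nonneg_left (hF2 ω.toMeasure) (sq_nonneg t)
        rw [hj]; linarith
      have hg := carreDuChamp_nonneg (σ := σ) (F := F) ω.toMeasure
      unfold isoIntegrand
      rw [hJ, carreDuChamp_const_add_mul]
      refine (sqrt_sq_add_le (hj0.trans_le hjJ) (by positivity)).trans ?_
      refine add_le_add le_rfl ?_
      rw [div_mul_eq_mul_div]
      refine div_le_div₀ (by positivity) (by rw [mul_assoc]) (by positivity) (by linarith)
    have iI : Integrable (fun ω : Configuration X =>
        isoIntegrand σ (1 / 2 + t) (fun μ => 1 / 2 + t * F μ) ω.toMeasure) P :=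
      hP.integrable_comp_toMeasure (measurable_isoIntegrand (by fun_prop))
        (abs_isoIntegrand_le (by positivity)
          (fun μ => by have := abs_le.1 (htF μ); linarith)
          (fun μ => by have := abs_le.1 (htF μ); linarith))
    have i1 : Integrable (fun ω : Configuration X => 1 / 4 - t ^ 2 * F ω.toMeasure ^ 2) P :=
      (integrable_const _).sub (iF2.const_mul _)
    have hint := integral_mono iI (i1.add (iG.const_mul ((1 / 2 + t) * t ^ 2 / (2 * j)))) hpt
    rw [integral_add' i1 (iG.const_mul _), integral_sub (integrable_const _) (iF2.const_mul _),
      integral_const_mul, integral_const_mul, integral_const, probReal_univ, one_smul, ← hG,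
      ← hS] at hint
    rw [integral_add (integrable_const _) (iF.const_mul _), integral_const_mul, integral_const,
      probReal_univ, one_smul, ← hm] at hb
    have hJm : bernoulliVar (1 / 2 + t * m) = 1 / 4 - t ^ 2 * m ^ 2 := by
      unfold bernoulliVar; ring
    rw [hJm] at hb
    have h3 : t ^ 2 * (S - m ^ 2) ≤ t ^ 2 * ((1 / 2 + t) * G / (2 * j)) := by
      have e : (1 / 2 + t) * t ^ 2 / (2 * j) * G = t ^ 2 * ((1 / 2 + t) * G / (2 * j)) := by ring
      rw [e] at hint
      linarith
    have h4 := le_of_mul_le_mul_left h3 (by positivity)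
    rw [le_div_iff₀ (by positivity)] at h4
    refine le_trans (le_of_eq ?_) h4
    rw [hj]; ring
  have hl : Filter.Tendsto (fun t : ℝ => (S - m ^ 2) * (1 / 2 - 2 * t ^ 2 * M ^ 2))
      (nhdsWithin 0 (Set.Ioi 0)) (nhds ((S - m ^ 2) * (1 / 2 - 2 * 0 ^ 2 * M ^ 2))) := by
    refine Filter.Tendsto.mono_left ?_ nhdsWithin_le_nhds
    exact Continuous.tendsto (by fun_prop) 0
  have hr : Filter.Tendsto (fun t : ℝ => (1 / 2 + t) * G)
      (nhdsWithin 0 (Set.Ioi 0)) (nhds ((1 / 2 + 0) * G)) := by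
    refine Filter.Tendsto.mono_left ?_ nhdsWithin_le_nhds
    exact Continuous.tendsto (f := fun t : ℝ => (1 / 2 + t) * G) (by fun_prop) 0
  have := le_of_tendsto_of_tendsto hl hr (by
    filter_upwards [Ioo_mem_nhdsGT (show (0 : ℝ) < 1 / (4 * (M + 1)) by positivity)] with t ht
    exact key t ht.1 ht.2)
  linarith

end

end IsPoissonMeasure

namespace IsPoissonMeasure

section

variable {X : Type*} [TopologicalSpace X] [MeasurableSpace X]
  {σ : Measure X} {P : Measure (Configuration X)}

/-- The **Poincaré inequality** on the Poisson space. -/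
theorem evariance_le_lintegral [Nonempty X] [IsFiniteMeasure σ]
    (hP : IsPoissonMeasure σ P) (hσ : IsDiffuse σ) {F : Measure X → ℝ} (hF : Measurable F)
    (hL : MemLp (fun ω : Configuration X => F ω.toMeasure) 2 P) :
    evariance (fun ω : Configuration X => F ω.toMeasure) P ≤
      ∫⁻ ω, ∫⁻ x, ‖F (ω.toMeasure + Measure.dirac x) - F ω.toMeasure‖ₑ ^ 2 ∂σ ∂P := by
  have := hP.isProbabilityMeasure
  -- truncation at level `n` is a contraction
  let f : ℕ → Measure X → ℝ := fun n μ => max (-(n : ℝ)) (min n (F μ))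
  have hfm : ∀ n, Measurable (f n) := fun n => by fun_prop
  have hfn : ∀ n μ, |f n μ| ≤ n := fun n μ =>
    abs_le.2 ⟨le_max_left _ _, max_le (by have : (0 : ℝ) ≤ n := Nat.cast_nonneg n; linarith)
      (min_le_left _ _)⟩
  have hfF : ∀ n μ, |f n μ| ≤ |F μ| := fun n μ => by
    have : (0 : ℝ) ≤ n := Nat.cast_nonneg n
    refine abs_le.2 ⟨?_, ?_⟩
    · refine le_max_of_le_right (le_min ?_ (neg_abs_le _))
      have := abs_nonneg (F μ)
      linarith
    · refine max_le ?_ ((min_le_right _ _).trans (le_abs_self _))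
      have := abs_nonneg (F μ)
      linarith
  have hcontr : ∀ n μ ν, |f n μ - f n ν| ≤ |F μ - F ν| := fun n μ ν =>
    (abs_max_sub_max_le_max _ _ _ _).trans (max_le (by simp)
      ((abs_min_sub_min_le_max _ _ _ _).trans (max_le (by simp) le_rfl)))
  have hlim : ∀ μ, Filter.Tendsto (fun n => f n μ) Filter.atTop (nhds (F μ)) := fun μ => by
    refine tendsto_const_nhds.congr' ?_
    obtain ⟨N, hN⟩ := exists_nat_ge |F μ|
    filter_upwards [Filter.eventually_ge_atTop N] with n hn
    have h1 : |F μ| ≤ n := hN.trans (by exact_mod_cast hn)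
    have h2 := abs_le.1 h1
    simp only [f]
    rw [min_eq_right h2.2, max_eq_right h2.1]
  set R := ∫⁻ ω, ∫⁻ x, ‖F (ω.toMeasure + Measure.dirac x) - F ω.toMeasure‖ₑ ^ 2 ∂σ ∂P with hR
  have hbound : ∀ n, ENNReal.ofReal (∫ ω, f n ω.toMeasure ^ 2 ∂P -
      (∫ ω, f n ω.toMeasure ∂P) ^ 2) ≤ R := by
    intro n
    refine (ENNReal.ofReal_le_ofReal
      (hP.integral_sq_sub_sq_integral_le hσ (hfm n) (hfn n))).trans ?_
    rw [ofReal_integral_eq_lintegral_ofReal]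
    · refine lintegral_mono fun ω => ?_
      unfold carreDuChamp
      rw [ofReal_integral_eq_lintegral_ofReal]
      · refine lintegral_mono fun x => ?_
        rw [Real.enorm_eq_ofReal_abs, ← ENNReal.ofReal_pow (abs_nonneg _), ← sq_abs]
        exact ENNReal.ofReal_le_ofReal (pow_le_pow_left₀ (abs_nonneg _) (hcontr n _ _) 2)
      · refine integrable_of_bounded (C := (2 * n) ^ 2)
          ((((hfm n).comp_add_dirac.comp measurable_prodMk_left).sub_const _).pow_const 2)
          fun x => ?_
        rw [abs_pow]
        refine pow_le_pow_left₀ (abs_nonneg _) ((abs_sub _ _).trans ?_) 2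
        rw [two_mul]
        exact add_le_add (hfn n _) (hfn n _)
      · exact Filter.Eventually.of_forall fun x => sq_nonneg _
    · refine hP.integrable_comp_toMeasure (measurable_carreDuChamp (hfm n))
        (C := (2 * n) ^ 2 * σ.real Set.univ) fun μ => ?_
      rw [abs_of_nonneg (carreDuChamp_nonneg _)]
      refine carreDuChamp_le (fun μ ν => (abs_sub _ _).trans ?_) μ
      rw [two_mul]
      exact add_le_add (hfn n _) (hfn n _)
    · exact Filter.Eventually.of_forall fun ω => carreDuChamp_nonneg _
  have hF2 : Integrable (fun ω : Configuration X => F ω.toMeasure ^ 2) P := hL.integrable_sq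
  have hF1 : Integrable (fun ω : Configuration X => F ω.toMeasure) P :=
    hL.integrable one_le_two
  have hl1 : Filter.Tendsto (fun n => ∫ ω, f n ω.toMeasure ∂P) Filter.atTop
      (nhds (∫ ω, F ω.toMeasure ∂P)) :=
    tendsto_integral_of_dominated_convergence (fun ω : Configuration X => |F ω.toMeasure|)
      (fun n => ((hfm n).comp Configuration.measurable_toMeasure).aestronglyMeasurable)
      hF1.abs (fun n => Filter.Eventually.of_forall fun ω => hfF n _)
      (Filter.Eventually.of_forall fun ω => hlim _)
  have hl2 : Filter.Tendsto (fun n => ∫ ω, f n ω.toMeasure ^ 2 ∂P) Filter.atTop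
      (nhds (∫ ω, F ω.toMeasure ^ 2 ∂P)) := by
    refine tendsto_integral_of_dominated_convergence (fun ω : Configuration X => F ω.toMeasure ^ 2)
      (fun n =>
        (((hfm n).comp Configuration.measurable_toMeasure).pow_const 2).aestronglyMeasurable)
      hF2 (fun n => Filter.Eventually.of_forall fun ω => ?_)
      (Filter.Eventually.of_forall fun ω => (hlim _).pow 2)
    rw [Real.norm_eq_abs, abs_pow, ← sq_abs (F _)]
    exact pow_le_pow_left₀ (abs_nonneg _) (hfF n _) 2
  rw [← hL.ofReal_variance_eq, variance_eq_sub hL]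
  exact le_of_tendsto' (ENNReal.tendsto_ofReal (hl2.sub (hl1.pow 2))) hbound

end

end IsPoissonMeasure

/-! ### The gradient and its norms -/

section Gradient

variable {X : Type*} [TopologicalSpace X] [MeasurableSpace X] [MeasurableSingletonClass X]
  {σ : Measure X} {P : Measure (Configuration X)} {F : Measure X → ℝ}

theorem IsDiffuse.ae_notMem_carrier (hσ : IsDiffuse σ) (ω : Configuration X) :
    ∀ᵐ x ∂σ, x ∉ ω.carrier := by
  have : NullSingletonClass σ := ⟨hσ.measure_singleton⟩
  exact measure_eq_zero_iff_ae_notMem.1 (ω.countable_carrier.measure_zero σ)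

omit [MeasurableSingletonClass X] in
theorem diffOp_of_notMem {ω : Configuration X} {x : X} (hx : x ∉ ω.carrier) :
    diffOp (fun ω => F ω.toMeasure) ω x =
      F ω.toMeasure - F (ω.toMeasure + Measure.dirac x) := by
  simp [diffOp, hx, Configuration.toMeasure_add hx]

omit [MeasurableSingletonClass X] in
theorem diffOp_of_mem {ω : Configuration X} {x : X} (hx : x ∈ ω.carrier) :
    diffOp (fun ω => F ω.toMeasure) ω x =
      F ((ω.remove x).toMeasure + Measure.dirac x) - F (ω.remove x).toMeasure := by
  simp [diffOp, hx, Configuration.toMeasure_remove hx]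

theorem lintegral_diffOp (hσ : IsDiffuse σ) (ψ : ℝ → ℝ≥0∞) (ω : Configuration X) :
    ∫⁻ x, ψ (diffOp (fun ω => F ω.toMeasure) ω x) ∂((2 : ℝ≥0∞)⁻¹ • (σ + ω.toMeasure)) =
      2⁻¹ * (∫⁻ x, ψ (F ω.toMeasure - F (ω.toMeasure + Measure.dirac x)) ∂σ +
        ∑' x : ω.carrier, ψ (F ((ω.remove x).toMeasure + Measure.dirac (x : X)) -
          F (ω.remove x).toMeasure)) := by
  rw [lintegral_smul_measure, lintegral_add_measure, Configuration.lintegral_toMeasure, smul_eq_mul]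
  congr 2
  · refine lintegral_congr_ae ?_
    filter_upwards [hσ.ae_notMem_carrier ω] with x hx
    rw [diffOp_of_notMem hx]
  · exact tsum_congr fun x => by rw [diffOp_of_mem x.2]

theorem IsPoissonMeasure.aemeasurable_lintegral_diffOp [IsFiniteMeasure σ]
    (hP : IsPoissonMeasure σ P) (hσ : IsDiffuse σ) (hF : Measurable F) {ψ : ℝ → ℝ≥0∞}
    (hψ : Measurable ψ) :
    AEMeasurable (fun ω => ∫⁻ x, ψ (diffOp (fun ω => F ω.toMeasure) ω x)
      ∂((2 : ℝ≥0∞)⁻¹ • (σ + ω.toMeasure))) P := by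
  simp_rw [lintegral_diffOp hσ ψ]
  refine AEMeasurable.const_mul (AEMeasurable.add ?_ ?_) _
  · have h : Measurable fun q : Measure X × X => ψ (F q.1 - F (q.1 + Measure.dirac q.2)) :=
      hψ.comp ((hF.comp measurable_fst).sub hF.comp_add_dirac)
    exact (h.lintegral_prod_right'.comp Configuration.measurable_toMeasure).aemeasurable
  · exact hP.aemeasurable_tsum_remove (v := fun q => ψ (F (q.1 + Measure.dirac q.2) - F q.1))
      (hψ.comp (hF.comp_add_dirac.sub (hF.comp measurable_fst)))

/-- By the Mecke formula, the points of `ω` and the points of `σ` contribute symmetrically to the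
mean of a functional of the gradient. -/
theorem IsPoissonMeasure.lintegral_lintegral_diffOp [IsFiniteMeasure σ]
    (hP : IsPoissonMeasure σ P) (hσ : IsDiffuse σ) (hF : Measurable F) {ψ : ℝ → ℝ≥0∞}
    (hψ : Measurable ψ) :
    ∫⁻ ω, ∫⁻ x, ψ (diffOp (fun ω => F ω.toMeasure) ω x)
        ∂((2 : ℝ≥0∞)⁻¹ • (σ + ω.toMeasure)) ∂P =
      2⁻¹ * ∫⁻ ω, ∫⁻ x, (ψ (F ω.toMeasure - F (ω.toMeasure + Measure.dirac x)) +
        ψ (F (ω.toMeasure + Measure.dirac x) - F ω.toMeasure)) ∂σ ∂P := by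
  have h1 : Measurable fun q : Measure X × X => ψ (F q.1 - F (q.1 + Measure.dirac q.2)) :=
    hψ.comp ((hF.comp measurable_fst).sub hF.comp_add_dirac)
  have h2 : Measurable fun q : Measure X × X => ψ (F (q.1 + Measure.dirac q.2) - F q.1) :=
    hψ.comp (hF.comp_add_dirac.sub (hF.comp measurable_fst))
  have h1' : Measurable fun ω : Configuration X =>
      ∫⁻ x, ψ (F ω.toMeasure - F (ω.toMeasure + Measure.dirac x)) ∂σ :=
    h1.lintegral_prod_right'.comp Configuration.measurable_toMeasure
  simp_rw [lintegral_diffOp hσ ψ]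
  rw [lintegral_const_mul' _ _ (by simp), lintegral_add_left h1', hP.lintegral_tsum_remove h2,
    ← lintegral_add_left h1']
  congr 1
  refine lintegral_congr fun ω => ?_
  exact (lintegral_add_left (h1.comp measurable_prodMk_left) _).symm

omit [MeasurableSingletonClass X] in
theorem fieldNorm_one (u : Configuration X → X → ℝ) (ω : Configuration X) :
    fieldNorm σ 1 u ω = ∫⁻ x, ‖u ω x‖ₑ ∂((2 : ℝ≥0∞)⁻¹ • (σ + ω.toMeasure)) :=
  eLpNorm_one_eq_lintegral_enorm

omit [MeasurableSingletonClass X] in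
theorem fieldNorm_two (u : Configuration X → X → ℝ) (ω : Configuration X) :
    fieldNorm σ 2 u ω =
      (∫⁻ x, ‖u ω x‖ₑ ^ 2 ∂((2 : ℝ≥0∞)⁻¹ • (σ + ω.toMeasure))) ^ (1 / 2 : ℝ) := by
  rw [fieldNorm, eLpNorm_eq_lintegral_rpow_enorm_toReal two_ne_zero ENNReal.ofNat_ne_top]
  simp

omit [MeasurableSingletonClass X] in
theorem fieldNorm_two_sq (u : Configuration X → X → ℝ) (ω : Configuration X) :
    fieldNorm σ 2 u ω ^ 2 = ∫⁻ x, ‖u ω x‖ₑ ^ 2 ∂((2 : ℝ≥0∞)⁻¹ • (σ + ω.toMeasure)) := by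
  rw [fieldNorm_two, ← ENNReal.rpow_natCast, ← ENNReal.rpow_mul]
  norm_num

theorem enorm_max_zero_add (r : ℝ) : ‖max 0 r‖ₑ + ‖max 0 (-r)‖ₑ = ‖r‖ₑ := by
  rcases le_total 0 r with h | h
  · rw [max_eq_right h, max_eq_left (by linarith)]; simp
  · rw [max_eq_left h, max_eq_right (by linarith)]; simp

theorem enorm_sq_max_zero_add (r : ℝ) : ‖max 0 r‖ₑ ^ 2 + ‖max 0 (-r)‖ₑ ^ 2 = ‖r‖ₑ ^ 2 := by
  rcases le_total 0 r with h | h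
  · rw [max_eq_right h, max_eq_left (by linarith)]; simp
  · rw [max_eq_left h, max_eq_right (by linarith)]; simp

theorem neg_min_zero_eq (r : ℝ) : -min 0 r = max 0 (-r) := by
  rw [← max_neg_neg, neg_zero]

omit [MeasurableSpace X] [MeasurableSingletonClass X] in
theorem diffMinus_eq (G : Configuration X → ℝ) (ω : Configuration X) (x : X) :
    diffMinus G ω x = max 0 (-diffOp G ω x) := neg_min_zero_eq _

section Mean

variable [IsFiniteMeasure σ] (hP : IsPoissonMeasure σ P) (hσ : IsDiffuse σ) (hF : Measurable F)
include hP hσ hF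

theorem lintegral_fieldNorm_two_diffOp :
    ∫⁻ ω, fieldNorm σ 2 (diffOp fun ω => F ω.toMeasure) ω ^ 2 ∂P =
      ∫⁻ ω, ∫⁻ x, ‖F (ω.toMeasure + Measure.dirac x) - F ω.toMeasure‖ₑ ^ 2 ∂σ ∂P := by
  simp_rw [fieldNorm_two_sq]
  rw [hP.lintegral_lintegral_diffOp hσ hF (ψ := fun r => ‖r‖ₑ ^ 2) (by fun_prop),
    ← lintegral_const_mul' _ _ (by simp)]
  refine lintegral_congr fun ω => ?_
  rw [← lintegral_const_mul' _ _ (by simp)]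
  refine lintegral_congr fun x => ?_
  rw [← enorm_neg (F ω.toMeasure - _), neg_sub, ← two_mul, ← mul_assoc,
    ENNReal.inv_mul_cancel two_ne_zero ENNReal.ofNat_ne_top, one_mul]

theorem lintegral_fieldNorm_two_diffPlus :
    ∫⁻ ω, fieldNorm σ 2 (diffPlus fun ω => F ω.toMeasure) ω ^ 2 ∂P =
      2⁻¹ * ∫⁻ ω, ∫⁻ x, ‖F (ω.toMeasure + Measure.dirac x) - F ω.toMeasure‖ₑ ^ 2 ∂σ ∂P := by
  simp_rw [fieldNorm_two_sq, diffPlus]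
  rw [hP.lintegral_lintegral_diffOp hσ hF (ψ := fun r => ‖max 0 r‖ₑ ^ 2) (by fun_prop)]
  congr 1
  refine lintegral_congr fun ω => lintegral_congr fun x => ?_
  rw [add_comm, ← neg_sub _ (F ω.toMeasure), enorm_sq_max_zero_add]

theorem lintegral_fieldNorm_two_diffMinus :
    ∫⁻ ω, fieldNorm σ 2 (diffMinus fun ω => F ω.toMeasure) ω ^ 2 ∂P =
      2⁻¹ * ∫⁻ ω, ∫⁻ x, ‖F (ω.toMeasure + Measure.dirac x) - F ω.toMeasure‖ₑ ^ 2 ∂σ ∂P := by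
  simp_rw [fieldNorm_two_sq, diffMinus_eq]
  rw [hP.lintegral_lintegral_diffOp hσ hF (ψ := fun r => ‖max 0 (-r)‖ₑ ^ 2) (by fun_prop)]
  congr 1
  refine lintegral_congr fun ω => lintegral_congr fun x => ?_
  rw [neg_sub, enorm_sq_max_zero_add]

theorem lintegral_fieldNorm_one_diffOp :
    ∫⁻ ω, fieldNorm σ 1 (diffOp fun ω => F ω.toMeasure) ω ∂P =
      ∫⁻ ω, ∫⁻ x, ‖F (ω.toMeasure + Measure.dirac x) - F ω.toMeasure‖ₑ ∂σ ∂P := by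
  simp_rw [fieldNorm_one]
  rw [hP.lintegral_lintegral_diffOp hσ hF (ψ := fun r => ‖r‖ₑ) (by fun_prop),
    ← lintegral_const_mul' _ _ (by simp)]
  refine lintegral_congr fun ω => ?_
  rw [← lintegral_const_mul' _ _ (by simp)]
  refine lintegral_congr fun x => ?_
  rw [← enorm_neg (F ω.toMeasure - _), neg_sub, ← two_mul, ← mul_assoc,
    ENNReal.inv_mul_cancel two_ne_zero ENNReal.ofNat_ne_top, one_mul]

theorem lintegral_fieldNorm_one_diffPlus :
    ∫⁻ ω, fieldNorm σ 1 (diffPlus fun ω => F ω.toMeasure) ω ∂P =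
      2⁻¹ * ∫⁻ ω, ∫⁻ x, ‖F (ω.toMeasure + Measure.dirac x) - F ω.toMeasure‖ₑ ∂σ ∂P := by
  simp_rw [fieldNorm_one, diffPlus]
  rw [hP.lintegral_lintegral_diffOp hσ hF (ψ := fun r => ‖max 0 r‖ₑ) (by fun_prop)]
  congr 1
  refine lintegral_congr fun ω => lintegral_congr fun x => ?_
  rw [add_comm, ← neg_sub _ (F ω.toMeasure), enorm_max_zero_add]

theorem lintegral_fieldNorm_one_diffMinus :
    ∫⁻ ω, fieldNorm σ 1 (diffMinus fun ω => F ω.toMeasure) ω ∂P =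
      2⁻¹ * ∫⁻ ω, ∫⁻ x, ‖F (ω.toMeasure + Measure.dirac x) - F ω.toMeasure‖ₑ ∂σ ∂P := by
  simp_rw [fieldNorm_one, diffMinus_eq]
  rw [hP.lintegral_lintegral_diffOp hσ hF (ψ := fun r => ‖max 0 (-r)‖ₑ) (by fun_prop)]
  congr 1
  refine lintegral_congr fun ω => lintegral_congr fun x => ?_
  rw [neg_sub, enorm_max_zero_add]

end Mean

end Gradient

/-! ### The number of points -/

namespace Configuration

variable {X : Type*} [TopologicalSpace X] [MeasurableSpace X]

/-- The number of points of a configuration, as a real number (zero if there are infinitely many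
points). -/
noncomputable def count (ω : Configuration X) : ℝ := (ω.toMeasure Set.univ).toReal

theorem measurable_count : Measurable (count : Configuration X → ℝ) :=
  (measurable_apply MeasurableSet.univ).ennreal_toReal

end Configuration

namespace IsPoissonMeasure

section

variable {X : Type*} [TopologicalSpace X] [MeasurableSpace X]
  {σ : Measure X} {P : Measure (Configuration X)} [IsFiniteMeasure σ]

theorem lintegral_toMeasure_univ_sq (hP : IsPoissonMeasure σ P) :
    ∫⁻ ω, ω.toMeasure Set.univ ^ 2 ∂P = σ Set.univ ^ 2 + σ Set.univ := by
  have := hP.isProbabilityMeasure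
  have hm : Measurable fun μ : Measure X => μ Set.univ := Measure.measurable_coe MeasurableSet.univ
  have hm' := Configuration.measurable_apply (X := X) MeasurableSet.univ
  have h := hP.lintegral_tsum_remove (v := fun q => q.1 Set.univ + 1)
    ((hm.comp measurable_fst).add_const _)
  have e : ∀ ω : Configuration X, ∑' x : ω.carrier, ((ω.remove x).toMeasure Set.univ + 1) =
      ω.toMeasure Set.univ ^ 2 := by
    intro ω
    have : ∀ x : ω.carrier, (ω.remove x).toMeasure Set.univ + 1 = ω.toMeasure Set.univ := by
      rintro ⟨x, hx⟩
      rw [← Configuration.toMeasure_remove hx]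
      simp
    simp_rw [this, ENNReal.tsum_const, sq]
    congr 1
    rw [Configuration.toMeasure_apply _ MeasurableSet.univ]
    simp
  simp_rw [e, lintegral_const] at h
  rw [h, lintegral_mul_const _ (hm'.add_const _), lintegral_add_left hm',
    hP.lintegral_toMeasure_univ]
  simp
  ring

theorem memLp_count (hP : IsPoissonMeasure σ P) : MemLp Configuration.count 2 P := by
  have hm := (Configuration.measurable_count (X := X)).aestronglyMeasurable (μ := P)
  refine ⟨hm, ?_⟩
  rw [eLpNorm_lt_top_iff_lintegral_rpow_enorm_lt_top two_ne_zero ENNReal.ofNat_ne_top]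
  refine lt_of_le_of_lt (lintegral_mono (g := fun ω => ω.toMeasure Set.univ ^ 2) fun ω => ?_) ?_
  · simp only [ENNReal.toReal_ofNat, ENNReal.rpow_ofNat]
    gcongr
    rw [Configuration.count, Real.enorm_eq_ofReal ENNReal.toReal_nonneg]
    exact ENNReal.ofReal_toReal_le
  · rw [hP.lintegral_toMeasure_univ_sq]
    exact ENNReal.add_lt_top.2 ⟨ENNReal.pow_lt_top (measure_lt_top _ _), measure_lt_top _ _⟩

theorem integral_count (hP : IsPoissonMeasure σ P) :
    ∫ ω, ω.count ∂P = σ.real Set.univ := by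
  unfold Configuration.count
  rw [integral_toReal (Configuration.measurable_apply MeasurableSet.univ).aemeasurable hP.ae_finite,
    hP.lintegral_toMeasure_univ]
  rfl

theorem integral_count_sq (hP : IsPoissonMeasure σ P) :
    ∫ ω, ω.count ^ 2 ∂P = σ.real Set.univ ^ 2 + σ.real Set.univ := by
  unfold Configuration.count
  simp_rw [← ENNReal.toReal_pow]
  rw [integral_toReal
    ((Configuration.measurable_apply MeasurableSet.univ).pow_const 2).aemeasurable,
    hP.lintegral_toMeasure_univ_sq, ENNReal.toReal_add (by finiteness) (by finiteness),
    ENNReal.toReal_pow]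
  · rfl
  · filter_upwards [hP.ae_finite] with ω hω
    exact ENNReal.pow_lt_top hω

theorem evariance_count (hP : IsPoissonMeasure σ P) :
    evariance Configuration.count P = σ Set.univ := by
  have := hP.isProbabilityMeasure
  rw [← hP.memLp_count.ofReal_variance_eq, variance_eq_sub hP.memLp_count]
  simp only [Pi.pow_apply]
  rw [hP.integral_count, hP.integral_count_sq, add_sub_cancel_left, ofReal_measureReal]

end

end IsPoissonMeasure

/-! ### Gradients of functions of the configuration -/

/-- The operators obtained by applying a fixed function, of at most linear growth, to the finite
difference gradient. The gradients `D`, `D⁺` and `D⁻` are of this form. -/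
def IsGradient {X : Type*} [TopologicalSpace X]
    (T : (Configuration X → ℝ) → Configuration X → X → ℝ) : Prop :=
  ∃ φ : ℝ → ℝ, (∀ r, |φ r| ≤ |r|) ∧ ∀ G ω x, T G ω x = φ (diffOp G ω x)

section IsGradient

variable {X : Type*} [TopologicalSpace X]
  {T : (Configuration X → ℝ) → Configuration X → X → ℝ}

theorem isGradient_diffOp : IsGradient (diffOp (X := X)) :=
  ⟨id, fun _ => le_rfl, fun _ _ _ => rfl⟩

theorem isGradient_diffPlus : IsGradient (diffPlus (X := X)) :=
  ⟨fun r => max 0 r, fun r => by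
    rw [abs_of_nonneg (le_max_left _ _)]; exact max_le (abs_nonneg _) (le_abs_self _),
    fun _ _ _ => rfl⟩

theorem isGradient_diffMinus : IsGradient (diffMinus (X := X)) :=
  ⟨fun r => max 0 (-r), fun r => by
    rw [abs_of_nonneg (le_max_left _ _)]; exact max_le (abs_nonneg _) (neg_le_abs _),
    fun _ _ _ => neg_min_zero_eq _⟩

theorem IsGradient.abs_le (hT : IsGradient T) (G : Configuration X → ℝ) (ω : Configuration X)
    (x : X) : |T G ω x| ≤ |diffOp G ω x| := by
  obtain ⟨φ, h1, h2⟩ := hT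
  rw [h2]
  exact h1 _

theorem abs_diffOp_indicator_le (A : Set (Configuration X)) (ω : Configuration X) (x : X) :
    |diffOp (A.indicator fun _ => (1 : ℝ)) ω x| ≤ 1 := by
  classical
  have h : ∀ ω', |A.indicator (fun _ => (1 : ℝ)) ω - A.indicator (fun _ => (1 : ℝ)) ω'| ≤ 1 := by
    intro ω'
    by_cases h1 : ω ∈ A <;> by_cases h2 : ω' ∈ A <;> simp [h1, h2]
  unfold diffOp
  split_ifs
  · exact h _
  · exact h _

theorem IsGradient.enorm_indicator_le_one (hT : IsGradient T) (A : Set (Configuration X))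
    (ω : Configuration X) (x : X) : ‖T (A.indicator fun _ => (1 : ℝ)) ω x‖ₑ ≤ 1 := by
  rw [Real.enorm_eq_ofReal_abs, ENNReal.ofReal_le_one]
  exact (hT.abs_le _ _ _).trans (abs_diffOp_indicator_le A ω x)

variable [MeasurableSpace X] {σ : Measure X}

theorem fieldNorm_top_le {u : Configuration X → X → ℝ} {ω : Configuration X} {C : ℝ≥0∞}
    (h : ∀ x, ‖u ω x‖ₑ ≤ C) : fieldNorm σ ∞ u ω ≤ C := by
  rw [fieldNorm, eLpNorm_exponent_top]
  exact eLpNormEssSup_le_of_ae_enorm_bound (Filter.Eventually.of_forall h)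

theorem ae_le_fieldNorm_top (u : Configuration X → X → ℝ) (ω : Configuration X) :
    ∀ᵐ x ∂σ, ‖u ω x‖ₑ ≤ fieldNorm σ ∞ u ω := by
  have h : ∀ᵐ x ∂((2 : ℝ≥0∞)⁻¹ • (σ + ω.toMeasure)), ‖u ω x‖ₑ ≤ fieldNorm σ ∞ u ω := by
    rw [fieldNorm, eLpNorm_exponent_top]
    exact ae_le_eLpNormEssSup
  rw [ae_iff, Measure.smul_apply, smul_eq_mul, mul_eq_zero, Measure.add_apply, add_eq_zero] at h
  exact (h.resolve_left (by simp)).1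

theorem lintegral_enorm_pow_le_fieldNorm_top (u : Configuration X → X → ℝ) (ω : Configuration X)
    (n : ℕ) : ∫⁻ x, ‖u ω x‖ₑ ^ n ∂σ ≤ σ Set.univ * fieldNorm σ ∞ u ω ^ n := by
  calc ∫⁻ x, ‖u ω x‖ₑ ^ n ∂σ ≤ ∫⁻ _, fieldNorm σ ∞ u ω ^ n ∂σ := by
        refine lintegral_mono_ae ?_
        filter_upwards [ae_le_fieldNorm_top u ω] with x hx
        gcongr
    _ = _ := by rw [lintegral_const, mul_comm]

theorem IsGradient.fieldNorm_top_indicator_le_one (hT : IsGradient T) (A : Set (Configuration X))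
    (ω : Configuration X) : fieldNorm σ ∞ (T (A.indicator fun _ => (1 : ℝ))) ω ≤ 1 :=
  fieldNorm_top_le (hT.enorm_indicator_le_one A ω)

end IsGradient

section

variable {X : Type*} [TopologicalSpace X] [MeasurableSpace X] [MeasurableSingletonClass X]
  {σ : Measure X} {P : Measure (Configuration X)}

theorem lintegral_enorm_sub_pow_le (hσ : IsDiffuse σ) (F : Measure X → ℝ) (ω : Configuration X)
    (n : ℕ) : ∫⁻ x, ‖F (ω.toMeasure + Measure.dirac x) - F ω.toMeasure‖ₑ ^ n ∂σ ≤
      σ Set.univ * fieldNorm σ ∞ (diffOp fun ω => F ω.toMeasure) ω ^ n := by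
  refine le_trans (le_of_eq ?_) (lintegral_enorm_pow_le_fieldNorm_top _ ω n)
  refine lintegral_congr_ae ?_
  filter_upwards [hσ.ae_notMem_carrier ω] with x hx
  rw [diffOp_of_notMem hx, ← enorm_neg, neg_sub]

omit [MeasurableSingletonClass X] in
theorem exists_measurable_comp_toMeasure {G : Configuration X → ℝ} (hG : Measurable G) :
    ∃ F : Measure X → ℝ, Measurable F ∧ G = fun ω => F ω.toMeasure :=
  hG.exists_eq_measurable_comp

omit [MeasurableSingletonClass X] in
theorem evariance_indicator [IsProbabilityMeasure P] {A : Set (Configuration X)}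
    (hA : MeasurableSet A) :
    evariance (A.indicator fun _ => (1 : ℝ)) P = ENNReal.ofReal (bernoulliVar (P.real A)) := by
  have hL : MemLp (A.indicator fun _ => (1 : ℝ)) 2 P := memLp_indicator_const 2 hA 1 (by simp)
  rw [← hL.ofReal_variance_eq, variance_eq_sub hL]
  have e : (A.indicator fun _ => (1 : ℝ)) ^ 2 = A.indicator fun _ => 1 := by
    ext ω
    by_cases h : ω ∈ A <;> simp [h]
  rw [e, integral_indicator_const _ hA, smul_eq_mul, mul_one, bernoulliVar]
  congr 1
  ring

omit [MeasurableSingletonClass X] in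
theorem half_measure_le_ofReal_bernoulliVar [IsProbabilityMeasure P] {A : Set (Configuration X)}
    (hA : P A ≤ 2⁻¹) : 2⁻¹ * P A ≤ ENNReal.ofReal (bernoulliVar (P.real A)) := by
  have h : P.real A ≤ 1 / 2 := by
    have := ENNReal.toReal_mono (by simp) hA
    simpa [Measure.real] using this
  rw [← ofReal_measureReal (μ := P) (s := A), show (2 : ℝ≥0∞)⁻¹ = ENNReal.ofReal (1 / 2) by
    rw [one_div, ENNReal.ofReal_inv_of_pos two_pos]; simp, ← ENNReal.ofReal_mul (by norm_num)]
  refine ENNReal.ofReal_le_ofReal ?_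
  unfold bernoulliVar
  have : 0 ≤ P.real A := measureReal_nonneg
  nlinarith

omit [MeasurableSingletonClass X] in
theorem not_isAEConst_indicator [IsProbabilityMeasure P] {A : Set (Configuration X)}
    (hA : MeasurableSet A) (h0 : 0 < P A) (h1 : P A ≤ 2⁻¹) :
    ¬ IsAEConst P (A.indicator fun _ => (1 : ℝ)) := by
  rintro ⟨c, hc⟩
  have h := half_measure_le_ofReal_bernoulliVar h1
  rw [← evariance_indicator hA, evariance_congr hc] at h
  have : evariance (fun _ : Configuration X => c) P = 0 := by simp [evariance]
  rw [this] at h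
  simp at h
  exact h0.ne' h

end

/-! ### The Poincaré constants -/

section

variable {X : Type*} [TopologicalSpace X] [MeasurableSpace X] [MeasurableSingletonClass X]
  {σ : Measure X} [IsFiniteMeasure σ] {P : Measure (Configuration X)}

omit [TopologicalSpace X] [MeasurableSingletonClass X] [IsFiniteMeasure σ] in
theorem toReal_add_dirac_sub {μ : Measure X} (hμ : μ Set.univ < ∞) (x : X) :
    ((μ + Measure.dirac x) Set.univ).toReal - (μ Set.univ).toReal = 1 := by
  have h : Measure.dirac x Set.univ = 1 := measure_univ
  rw [Measure.add_apply, h, ENNReal.toReal_add hμ.ne ENNReal.one_ne_top]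
  simp

omit [MeasurableSingletonClass X] in
theorem abs_diffOp_count {ω : Configuration X} (hω : ω.toMeasure Set.univ < ∞) (x : X) :
    |diffOp Configuration.count ω x| = 1 := by
  have e : (Configuration.count : Configuration X → ℝ) =
      fun ω => (fun μ : Measure X => (μ Set.univ).toReal) ω.toMeasure := rfl
  rw [e]
  by_cases hx : x ∈ ω.carrier
  · rw [diffOp_of_mem (F := fun μ : Measure X => (μ Set.univ).toReal) hx, toReal_add_dirac_sub,
      abs_one]
    refine lt_of_le_of_lt ?_ hω
    rw [← Configuration.toMeasure_remove hx, Measure.add_apply]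
    exact le_self_add
  · rw [diffOp_of_notMem (F := fun μ : Measure X => (μ Set.univ).toReal) hx, ← neg_sub,
      toReal_add_dirac_sub hω, abs_neg, abs_one]

omit [MeasurableSingletonClass X] [IsFiniteMeasure σ] in
theorem evariance_ne_zero {G : Configuration X → ℝ} (hG : Measurable G) (h : ¬ IsAEConst P G) :
    evariance G P ≠ 0 := by
  rw [Ne, evariance_eq_zero_iff hG.aemeasurable]
  exact fun h' => h ⟨_, h'⟩

omit [MeasurableSingletonClass X] in
theorem not_isAEConst_count (hP : IsPoissonMeasure σ P) (hσ0 : σ Set.univ ≠ 0) :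
    ¬ IsAEConst P Configuration.count := by
  have := hP.isProbabilityMeasure
  rintro ⟨c, hc⟩
  have h := hP.evariance_count
  rw [evariance_congr hc] at h
  have : evariance (fun _ : Configuration X => c) P = 0 := by simp [evariance]
  exact hσ0 (h.symm.trans this)

omit [MeasurableSingletonClass X] in
/-- The Poincaré inequality is sharp, with equality for the number of points. -/
theorem poincareConst_two_eq [Nonempty X] (hP : IsPoissonMeasure σ P) (hσ : IsDiffuse σ)
    (hσ0 : σ Set.univ ≠ 0) {T : (Configuration X → ℝ) → Configuration X → X → ℝ} {c : ℝ≥0∞}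
    (hT : ∀ F : Measure X → ℝ, Measurable F →
      ∫⁻ ω, fieldNorm σ 2 (T fun ω => F ω.toMeasure) ω ^ 2 ∂P =
        c * ∫⁻ ω, ∫⁻ x, ‖F (ω.toMeasure + Measure.dirac x) - F ω.toMeasure‖ₑ ^ 2 ∂σ ∂P) :
    poincareConst σ P 2 T = c := by
  have := hP.isProbabilityMeasure
  refine le_antisymm ?_ ?_
  · refine (iInf₂_le Configuration.count Configuration.measurable_count).trans
      ((iInf₂_le hP.memLp_count (not_isAEConst_count hP hσ0)).trans ?_)
    have hm : Measurable fun μ : Measure X => (μ Set.univ).toReal :=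
      (Measure.measurable_coe MeasurableSet.univ).ennreal_toReal
    have e : (Configuration.count : Configuration X → ℝ) =
      fun ω => (fun μ : Measure X => (μ Set.univ).toReal) ω.toMeasure := rfl
    have h1 : ∫⁻ ω : Configuration X, ∫⁻ x, ‖((ω.toMeasure + Measure.dirac x) Set.univ).toReal -
        (ω.toMeasure Set.univ).toReal‖ₑ ^ 2 ∂σ ∂P = σ Set.univ := by
      have : ∀ᵐ ω : Configuration X ∂P, ∫⁻ x, ‖((ω.toMeasure + Measure.dirac x) Set.univ).toReal -
          (ω.toMeasure Set.univ).toReal‖ₑ ^ 2 ∂σ = σ Set.univ := by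
        filter_upwards [hP.ae_finite] with ω hω
        simp_rw [toReal_add_dirac_sub hω]
        simp
      rw [lintegral_congr_ae this]
      simp
    rw [hP.evariance_count, e, hT _ hm, h1, mul_div_assoc,
      ENNReal.div_self hσ0 (measure_ne_top _ _), mul_one]
  · refine le_iInf₂ fun G hG => le_iInf₂ fun hL hc => ?_
    obtain ⟨F, hF, rfl⟩ := exists_measurable_comp_toMeasure hG
    rw [ENNReal.le_div_iff_mul_le (Or.inl (evariance_ne_zero hG hc))
      (Or.inl hL.evariance_ne_top), hT F hF]
    gcongr
    exact hP.evariance_le_lintegral hσ hF hL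

theorem poincareConst_top_diffOp [Nonempty X] (hP : IsPoissonMeasure σ P) (hσ : IsDiffuse σ)
    (hσ0 : σ Set.univ ≠ 0) : poincareConst σ P ∞ diffOp = (σ Set.univ)⁻¹ := by
  have := hP.isProbabilityMeasure
  refine le_antisymm ?_ ?_
  · refine (iInf₂_le Configuration.count Configuration.measurable_count).trans
      ((iInf₂_le hP.memLp_count (not_isAEConst_count hP hσ0)).trans ?_)
    rw [hP.evariance_count, ← one_div]
    refine ENNReal.div_le_div_right ?_ _
    have : ∀ᵐ ω ∂P, fieldNorm σ ∞ (diffOp Configuration.count) ω ^ 2 ≤ 1 := by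
      filter_upwards [hP.ae_finite] with ω hω
      refine pow_le_one₀ zero_le (fieldNorm_top_le fun x => ?_)
      rw [Real.enorm_eq_ofReal_abs, abs_diffOp_count hω, ENNReal.ofReal_one]
    refine (lintegral_mono_ae this).trans ?_
    simp
  · refine le_iInf₂ fun G hG => le_iInf₂ fun hL hc => ?_
    obtain ⟨F, hF, rfl⟩ := exists_measurable_comp_toMeasure hG
    rw [ENNReal.le_div_iff_mul_le (Or.inl (evariance_ne_zero hG hc))
      (Or.inl hL.evariance_ne_top), mul_comm, ← div_eq_mul_inv]
    refine ENNReal.div_le_of_le_mul' ?_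
    rw [← lintegral_const_mul' _ _ (measure_ne_top _ _)]
    exact (hP.evariance_le_lintegral hσ hF hL).trans
      (lintegral_mono fun ω => lintegral_enorm_sub_pow_le hσ F ω 2)

/-! ### Lower bounds for the isoperimetric constants -/

omit [TopologicalSpace X] [MeasurableSingletonClass X] in
theorem enorm_indicator_sub_sq (A : Set (Measure X)) (μ ν : Measure X) :
    ‖A.indicator (fun _ => (1 : ℝ)) μ - A.indicator (fun _ => (1 : ℝ)) ν‖ₑ ^ 2 =
      ‖A.indicator (fun _ => (1 : ℝ)) μ - A.indicator (fun _ => (1 : ℝ)) ν‖ₑ := by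
  by_cases h1 : μ ∈ A <;> by_cases h2 : ν ∈ A <;> simp [h1, h2]

omit [MeasurableSingletonClass X] in
/-- The Poincaré inequality for indicator functions. -/
theorem half_measure_le_lintegral [Nonempty X] (hP : IsPoissonMeasure σ P) (hσ : IsDiffuse σ)
    {A : Set (Measure X)} (hA : MeasurableSet A)
    (hA2 : P (Configuration.toMeasure ⁻¹' A) ≤ 2⁻¹) :
    2⁻¹ * P (Configuration.toMeasure ⁻¹' A) ≤
      ∫⁻ ω, ∫⁻ x, ‖A.indicator (fun _ => (1 : ℝ)) (ω.toMeasure + Measure.dirac x) -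
        A.indicator (fun _ => (1 : ℝ)) ω.toMeasure‖ₑ ∂σ ∂P := by
  have := hP.isProbabilityMeasure
  have hA' := Configuration.measurable_toMeasure hA
  refine (half_measure_le_ofReal_bernoulliVar hA2).trans ?_
  rw [← evariance_indicator hA']
  refine (hP.evariance_le_lintegral hσ (measurable_const.indicator hA)
    (memLp_indicator_const 2 hA' 1 (by simp))).trans_eq ?_
  exact lintegral_congr fun ω => lintegral_congr fun x => enorm_indicator_sub_sq A _ _

omit [MeasurableSingletonClass X] in
/-- The Cheeger type inequality, for sets of probability at most `1 / 2`. -/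
theorem measure_le_lintegral_sqrt [Nonempty X] (hP : IsPoissonMeasure σ P) (hσ : IsDiffuse σ)
    {A : Set (Measure X)} (hA : MeasurableSet A)
    (hA2 : P (Configuration.toMeasure ⁻¹' A) ≤ 2⁻¹) :
    ENNReal.ofReal (1 / √Real.pi) * P (Configuration.toMeasure ⁻¹' A) ≤
      ∫⁻ ω, (∫⁻ x, ‖A.indicator (fun _ => (1 : ℝ)) (ω.toMeasure + Measure.dirac x) -
        A.indicator (fun _ => (1 : ℝ)) ω.toMeasure‖ₑ ^ 2 ∂σ) ^ (1 / 2 : ℝ) ∂P := by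
  have := hP.isProbabilityMeasure
  set F : Measure X → ℝ := A.indicator fun _ => (1 : ℝ) with hF
  have hFm : Measurable F := measurable_const.indicator hA
  have hF01 : ∀ μ, 0 ≤ F μ ∧ F μ ≤ 1 := fun μ =>
    ⟨Set.indicator_nonneg (fun _ _ => zero_le_one) μ,
      Set.indicator_le_self' (fun _ _ => zero_le_one) μ⟩
  have hF1 := abs_sub_le_one (fun μ => (hF01 μ).1) (fun μ => (hF01 μ).2)
  have h := hP.bernoulliVar_le_integral_sqrt hσ hA
  rw [← hF] at h
  set a := P.real (Configuration.toMeasure ⁻¹' A) with ha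
  have ha0 : 0 ≤ a := measureReal_nonneg
  have ha2 : a ≤ 1 / 2 := by
    have := ENNReal.toReal_mono (by simp) hA2
    simpa [ha, Measure.real] using this
  have e : ∀ ω : Configuration X, (∫⁻ x, ‖F (ω.toMeasure + Measure.dirac x) -
      F ω.toMeasure‖ₑ ^ 2 ∂σ) ^ (1 / 2 : ℝ) =
        ENNReal.ofReal √(carreDuChamp σ F ω.toMeasure) := by
    intro ω
    rw [Real.sqrt_eq_rpow, ← ENNReal.ofReal_rpow_of_nonneg (carreDuChamp_nonneg _) (by norm_num)]
    congr 1
    unfold carreDuChamp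
    rw [ofReal_integral_eq_lintegral_ofReal _ (Filter.Eventually.of_forall fun _ => sq_nonneg _)]
    · refine lintegral_congr fun x => ?_
      rw [Real.enorm_eq_ofReal_abs, ← ENNReal.ofReal_pow (abs_nonneg _), sq_abs]
    · refine integrable_of_bounded (C := 1)
        (((hFm.comp_add_dirac.comp measurable_prodMk_left).sub_const _).pow_const 2) fun x => ?_
      rw [abs_pow]
      exact pow_le_one₀ (abs_nonneg _) (hF1 _ _)
  simp_rw [e]
  have hi : Integrable (fun ω : Configuration X => √(carreDuChamp σ F ω.toMeasure)) P := by
    refine hP.integrable_comp_toMeasure (measurable_carreDuChamp hFm).sqrt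
      (C := √(σ.real Set.univ)) fun μ => ?_
    rw [abs_of_nonneg (Real.sqrt_nonneg _)]
    exact Real.sqrt_le_sqrt (by simpa using carreDuChamp_le hF1 μ)
  rw [← ofReal_integral_eq_lintegral_ofReal hi
    (Filter.Eventually.of_forall fun _ => Real.sqrt_nonneg _), ← ofReal_measureReal (μ := P),
    ← ha, ← ENNReal.ofReal_mul (by positivity)]
  refine ENNReal.ofReal_le_ofReal ?_
  set I := ∫ ω, √(carreDuChamp σ F ω.toMeasure) ∂P with hI
  have hI0 : 0 ≤ I := integral_nonneg fun _ => Real.sqrt_nonneg _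
  have h1 : a / 2 ≤ √(3 / 4) * I := by
    refine le_trans ?_ h
    unfold bernoulliVar
    nlinarith
  -- `√(3 / 4) ≤ √π / 2`
  have h2 : √(3 / 4) ≤ √Real.pi / 2 := by
    rw [show (3 / 4 : ℝ) = 3 / 2 ^ 2 by norm_num, Real.sqrt_div' _ (by norm_num),
      Real.sqrt_sq (by norm_num)]
    have := Real.sqrt_le_sqrt Real.pi_gt_three.le
    linarith
  have hpi : 0 < √Real.pi := Real.sqrt_pos.2 Real.pi_pos
  rw [one_div, inv_mul_le_iff₀ hpi]
  nlinarith [mul_le_mul_of_nonneg_right h2 hI0]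

theorem le_isoperimetricConst_two_diffOp [Nonempty X] (hP : IsPoissonMeasure σ P)
    (hσ : IsDiffuse σ) :
    ENNReal.ofReal (1 / √(2 * Real.pi)) ≤ isoperimetricConst σ P 2 diffOp := by
  have := hP.isProbabilityMeasure
  refine le_iInf₂ fun A hA => le_iInf₂ fun h0 h1 => ?_
  obtain ⟨A, hA, rfl⟩ := hA
  rw [ENNReal.le_div_iff_mul_le (Or.inl h0.ne') (Or.inl (measure_ne_top _ _))]
  have e : ENNReal.ofReal (1 / √(2 * Real.pi)) =
      (2⁻¹ : ℝ≥0∞) ^ (1 / 2 : ℝ) * ENNReal.ofReal (1 / √Real.pi) := by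
    have h2 : (2⁻¹ : ℝ≥0∞) = ENNReal.ofReal (1 / 2) := by
      rw [one_div, ENNReal.ofReal_inv_of_pos two_pos]; simp
    rw [h2, ENNReal.ofReal_rpow_of_nonneg (by norm_num) (by norm_num), ← Real.sqrt_eq_rpow,
      ← ENNReal.ofReal_mul (Real.sqrt_nonneg _)]
    congr 1
    rw [Real.sqrt_mul (by norm_num), one_div (2 : ℝ), Real.sqrt_inv]
    field_simp
  rw [e, mul_assoc]
  refine (mul_le_mul_right (measure_le_lintegral_sqrt hP hσ hA h1.le) _).trans ?_
  rw [← lintegral_const_mul' _ _ (by simp)]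
  refine lintegral_mono fun ω => ?_
  rw [← ENNReal.mul_rpow_of_nonneg _ _ (by norm_num), fieldNorm_two]
  refine ENNReal.rpow_le_rpow ?_ (by norm_num)
  have h := lintegral_diffOp (F := A.indicator fun _ => (1 : ℝ)) hσ (fun r => ‖r‖ₑ ^ 2) ω
  refine le_trans ?_ h.ge
  gcongr
  refine le_trans (le_of_eq ?_) le_self_add
  refine lintegral_congr fun x => ?_
  rw [← enorm_neg, neg_sub]

theorem le_isoperimetricConst_top_diffOp [Nonempty X] (hP : IsPoissonMeasure σ P)
    (hσ : IsDiffuse σ) (hσ0 : 0 < σ.real Set.univ) :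
    ENNReal.ofReal (max (1 / √(Real.pi * σ.real Set.univ)) (1 / (2 * σ.real Set.univ))) ≤
      isoperimetricConst σ P ∞ diffOp := by
  have := hP.isProbabilityMeasure
  set s := σ.real Set.univ with hs
  have hsσ : σ Set.univ = ENNReal.ofReal s := (ofReal_measureReal).symm
  refine le_iInf₂ fun A hA => le_iInf₂ fun h0 h1 => ?_
  obtain ⟨A, hA, rfl⟩ := hA
  rw [ENNReal.le_div_iff_mul_le (Or.inl h0.ne') (Or.inl (measure_ne_top _ _))]
  set R : Configuration X → ℝ≥0∞ := fun ω => fieldNorm σ ∞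
    (diffOp ((Configuration.toMeasure ⁻¹' A).indicator fun _ => (1 : ℝ))) ω with hR
  have hRle : ∀ (ω : Configuration X) (n : ℕ),
      ∫⁻ x, ‖A.indicator (fun _ => (1 : ℝ)) (ω.toMeasure + Measure.dirac x) -
        A.indicator (fun _ => (1 : ℝ)) ω.toMeasure‖ₑ ^ n ∂σ ≤ σ Set.univ * R ω ^ n :=
    fun ω n => lintegral_enorm_sub_pow_le hσ (A.indicator fun _ => (1 : ℝ)) ω n
  rcases max_choice (1 / √(Real.pi * s)) (1 / (2 * s)) with h | h <;> rw [h]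
  · have e : ENNReal.ofReal (1 / √(Real.pi * s)) =
        ENNReal.ofReal (1 / √s) * ENNReal.ofReal (1 / √Real.pi) := by
      rw [← ENNReal.ofReal_mul (by positivity), Real.sqrt_mul Real.pi_pos.le]
      congr 1
      field_simp
    rw [e, mul_assoc]
    refine (mul_le_mul_right (measure_le_lintegral_sqrt hP hσ hA h1.le) _).trans ?_
    rw [← lintegral_const_mul' _ _ ENNReal.ofReal_ne_top]
    refine lintegral_mono fun ω => ?_
    calc _ ≤ ENNReal.ofReal (1 / √s) * (σ Set.univ * R ω ^ 2) ^ (1 / 2 : ℝ) := by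
          gcongr
          exact hRle ω 2
      _ = R ω := by
          rw [ENNReal.mul_rpow_of_nonneg _ _ (by norm_num), hsσ,
            ENNReal.ofReal_rpow_of_nonneg hσ0.le (by norm_num), ← Real.sqrt_eq_rpow, ← mul_assoc,
            ← ENNReal.ofReal_mul (by positivity), one_div_mul_cancel (Real.sqrt_pos.2 hσ0).ne',
            ENNReal.ofReal_one, one_mul, ← ENNReal.rpow_natCast, ← ENNReal.rpow_mul]
          norm_num
  · have e : ENNReal.ofReal (1 / (2 * s)) = (σ Set.univ)⁻¹ * 2⁻¹ := by
      rw [hsσ, ← ENNReal.ofReal_inv_of_pos hσ0, show (2 : ℝ≥0∞)⁻¹ = ENNReal.ofReal (2⁻¹) by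
        rw [ENNReal.ofReal_inv_of_pos two_pos]; simp, ← ENNReal.ofReal_mul (by positivity)]
      congr 1
      field_simp
    have hσne : σ Set.univ ≠ 0 := by rw [hsσ]; exact (ENNReal.ofReal_pos.2 hσ0).ne'
    rw [e, mul_assoc]
    refine (mul_le_mul_right (half_measure_le_lintegral hP hσ hA h1.le) _).trans ?_
    rw [← lintegral_const_mul' _ _ (ENNReal.inv_ne_top.2 hσne)]
    refine lintegral_mono fun ω => ?_
    have := hRle ω 1
    simp only [pow_one] at this
    refine (mul_le_mul_right this _).trans ?_
    rw [← mul_assoc, ENNReal.inv_mul_cancel hσne (measure_ne_top _ _), one_mul]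

end

/-! ### Comparisons between the constants -/

section

variable {X : Type*} [TopologicalSpace X] [MeasurableSpace X] [MeasurableSingletonClass X]
  {σ : Measure X} [IsFiniteMeasure σ] {P : Measure (Configuration X)}

theorem half_le_isoperimetricConst_one_diffOp [Nonempty X] (hP : IsPoissonMeasure σ P)
    (hσ : IsDiffuse σ) : ENNReal.ofReal (1 / 2) ≤ isoperimetricConst σ P 1 diffOp := by
  have := hP.isProbabilityMeasure
  refine le_iInf₂ fun A hA => le_iInf₂ fun h0 h1 => ?_
  obtain ⟨A, hA, rfl⟩ := hA
  rw [ENNReal.le_div_iff_mul_le (Or.inl h0.ne') (Or.inl (measure_ne_top _ _))]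
  have e : ENNReal.ofReal (1 / 2) = 2⁻¹ := by
    rw [one_div, ENNReal.ofReal_inv_of_pos two_pos]; simp
  have h := lintegral_fieldNorm_one_diffOp hP hσ (F := A.indicator fun _ => (1 : ℝ))
    (measurable_const.indicator hA)
  rw [e]
  exact (half_measure_le_lintegral hP hσ hA h1.le).trans h.ge

theorem isoperimetricConst_one_diffOp_eq (hP : IsPoissonMeasure σ P) (hσ : IsDiffuse σ)
    {T : (Configuration X → ℝ) → Configuration X → X → ℝ}
    (hT : ∀ F : Measure X → ℝ, Measurable F →
      ∫⁻ ω, fieldNorm σ 1 (T fun ω => F ω.toMeasure) ω ∂P =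
        2⁻¹ * ∫⁻ ω, ∫⁻ x, ‖F (ω.toMeasure + Measure.dirac x) - F ω.toMeasure‖ₑ ∂σ ∂P) :
    isoperimetricConst σ P 1 diffOp = 2 * isoperimetricConst σ P 1 T := by
  unfold isoperimetricConst
  simp_rw [ENNReal.mul_iInf_of_ne two_ne_zero ENNReal.ofNat_ne_top]
  refine iInf_congr fun A => iInf_congr fun hA => iInf_congr fun _ => iInf_congr fun _ => ?_
  obtain ⟨A, hA, rfl⟩ := hA
  have hm : Measurable (A.indicator fun _ => (1 : ℝ)) := measurable_const.indicator hA
  have h1 := lintegral_fieldNorm_one_diffOp hP hσ hm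
  have h2 := hT _ hm
  rw [← mul_div_assoc]
  congr 1
  refine h1.trans ?_
  refine Eq.trans ?_ (congrArg (fun z => 2 * z) h2.symm)
  rw [← mul_assoc, ENNReal.mul_inv_cancel two_ne_zero ENNReal.ofNat_ne_top, one_mul]

omit [MeasurableSpace X] [MeasurableSingletonClass X] in
theorem diffPlus_indicator_eq_zero_or_one (A : Set (Configuration X)) (ω : Configuration X)
    (x : X) : diffPlus (A.indicator fun _ => (1 : ℝ)) ω x = 0 ∨
      ω ∈ A ∧ diffPlus (A.indicator fun _ => (1 : ℝ)) ω x = 1 := by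
  classical
  have h : ∀ ω', max 0 (A.indicator (fun _ => (1 : ℝ)) ω - A.indicator (fun _ => (1 : ℝ)) ω') = 0 ∨
      ω ∈ A ∧
        max 0 (A.indicator (fun _ => (1 : ℝ)) ω - A.indicator (fun _ => (1 : ℝ)) ω') = 1 := by
    intro ω'
    by_cases h1 : ω ∈ A <;> by_cases h2 : ω' ∈ A <;> simp [h1, h2]
  unfold diffPlus diffOp
  split_ifs
  · exact h _
  · exact h _

/-- On indicator functions, `|D⁺ 1_A|₂² = |D⁺ 1_A|₁`, and this vanishes off `A`; the
Cauchy–Schwarz inequality on `A` then compares the two constants. -/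
theorem isoperimetricConst_two_diffPlus_sq_le (hP : IsPoissonMeasure σ P) (hσ : IsDiffuse σ) :
    isoperimetricConst σ P 2 diffPlus ^ 2 ≤ isoperimetricConst σ P 1 diffPlus := by
  have := hP.isProbabilityMeasure
  refine le_iInf₂ fun A hA => le_iInf₂ fun h0 h1 => ?_
  have h2 : isoperimetricConst σ P 2 diffPlus ≤
      (∫⁻ ω, fieldNorm σ 2 (diffPlus (A.indicator fun _ => (1 : ℝ))) ω ∂P) / P A :=
    (iInf₂_le A hA).trans (iInf₂_le h0 h1)
  set u := diffPlus (A.indicator fun _ => (1 : ℝ)) with hu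
  have hpt : ∀ ω, fieldNorm σ 2 u ω =
      A.indicator 1 ω * fieldNorm σ 1 u ω ^ (1 / 2 : ℝ) := by
    intro ω
    have e : ∀ x, ‖u ω x‖ₑ ^ 2 = ‖u ω x‖ₑ := fun x => by
      rcases diffPlus_indicator_eq_zero_or_one A ω x with h | ⟨_, h⟩ <;> rw [← hu] at h <;>
        simp [h]
    rw [fieldNorm_two, fieldNorm_one]
    simp_rw [e]
    by_cases hω : ω ∈ A
    · simp [hω]
    · have e' : ∀ x, u ω x = 0 := fun x =>
        (diffPlus_indicator_eq_zero_or_one A ω x).resolve_right fun h => hω h.1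
      simp [hω, e']
  have hm : AEMeasurable (fun ω => fieldNorm σ 1 u ω) P := by
    obtain ⟨A, hA, rfl⟩ := hA
    simp_rw [fieldNorm_one]
    exact hP.aemeasurable_lintegral_diffOp hσ (F := A.indicator fun _ => (1 : ℝ))
      (measurable_const.indicator hA) (ψ := fun r => ‖max 0 r‖ₑ) (by fun_prop)
  have hH : (∫⁻ ω, fieldNorm σ 2 u ω ∂P) ^ 2 ≤ P A * ∫⁻ ω, fieldNorm σ 1 u ω ∂P := by
    have h := ENNReal.lintegral_mul_le_Lp_mul_Lq P Real.HolderConjugate.two_two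
      (f := A.indicator 1) (g := fun ω => fieldNorm σ 1 u ω ^ (1 / 2 : ℝ))
      (measurable_one.indicator hA).aemeasurable (hm.pow_const _)
    have e1 : ∀ ω, A.indicator (1 : Configuration X → ℝ≥0∞) ω ^ (2 : ℝ) = A.indicator 1 ω :=
      fun ω => by by_cases hω : ω ∈ A <;> simp [hω]
    have e2 : ∀ ω, (fieldNorm σ 1 u ω ^ (1 / 2 : ℝ)) ^ (2 : ℝ) = fieldNorm σ 1 u ω :=
      fun ω => by rw [← ENNReal.rpow_mul]; norm_num
    simp_rw [e1, e2, lintegral_indicator_one hA, Pi.mul_apply] at h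
    simp_rw [hpt]
    refine (pow_le_pow_left' h 2).trans_eq ?_
    rw [mul_pow, ← ENNReal.rpow_natCast, ← ENNReal.rpow_mul, ← ENNReal.rpow_natCast,
      ← ENNReal.rpow_mul]
    norm_num
  refine (pow_le_pow_left' h2 2).trans ?_
  rw [ENNReal.le_div_iff_mul_le (Or.inl h0.ne') (Or.inl (measure_ne_top _ _)), div_eq_mul_inv,
    mul_pow]
  refine (mul_le_mul_left (mul_le_mul_left hH _) _).trans_eq ?_
  have hc : P A * (P A)⁻¹ = 1 := ENNReal.mul_inv_cancel h0.ne' (measure_ne_top _ _)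
  calc _ = (∫⁻ ω, fieldNorm σ 1 u ω ∂P) * (P A * (P A)⁻¹) ^ 2 := by ring
    _ = _ := by rw [hc, one_pow, mul_one]

omit [MeasurableSingletonClass X] [IsFiniteMeasure σ] in
/-- On the indicator of `A` the norm of the gradient is at most `1`, hence dominates its square, and
the variance is at least `P A / 2` when `P A < 1 / 2`. -/
theorem poincareConst_top_le (hP : IsPoissonMeasure σ P)
    {T : (Configuration X → ℝ) → Configuration X → X → ℝ} (hT : IsGradient T) :
    poincareConst σ P ∞ T ≤ 2 * isoperimetricConst σ P ∞ T := by
  have := hP.isProbabilityMeasure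
  unfold isoperimetricConst
  simp_rw [ENNReal.mul_iInf_of_ne two_ne_zero ENNReal.ofNat_ne_top]
  refine le_iInf₂ fun A hA => le_iInf₂ fun h0 h1 => ?_
  refine (iInf₂_le _ (measurable_const.indicator hA)).trans
    ((iInf₂_le (memLp_indicator_const 2 hA 1 (by simp))
      (not_isAEConst_indicator hA h0 h1.le)).trans ?_)
  rw [evariance_indicator hA]
  refine (ENNReal.div_le_div (lintegral_mono (g := fun ω => fieldNorm σ ∞
      (T (A.indicator fun _ => (1 : ℝ))) ω) fun ω => ?_)
    (half_measure_le_ofReal_bernoulliVar h1.le)).trans_eq ?_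
  · exact pow_le_of_le_one zero_le (hT.fieldNorm_top_indicator_le_one A ω) two_ne_zero
  · rw [div_eq_mul_inv, ENNReal.mul_inv (by simp) (by simp), inv_inv, div_eq_mul_inv]
    ring

end

/-! ### Sets of probability one half -/

section

variable {X : Type*} [TopologicalSpace X] [MeasurableSpace X]

theorem Configuration.two_le_toMeasure {ω : Configuration X} {x y : X} (hx : x ∈ ω.carrier)
    (hy : y ∈ ω.carrier) (hxy : x ≠ y) {B : Set X} (hB : MeasurableSet B) (hxB : x ∈ B)
    (hyB : y ∈ B) : 2 ≤ ω.toMeasure B := by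
  have hy' : y ∈ (ω.remove x).carrier := ⟨hy, by simpa using hxy.symm⟩
  rw [← toMeasure_remove hx, ← toMeasure_remove hy']
  simp only [Measure.add_apply, Measure.dirac_apply' _ hB, Set.indicator_of_mem hxB,
    Set.indicator_of_mem hyB, Pi.one_apply]
  rw [add_assoc, one_add_one_eq_two]
  exact le_add_self

theorem Configuration.exists_ne_of_two_le_toMeasure {ω : Configuration X}
    (h : 2 ≤ ω.toMeasure Set.univ) : ∃ x ∈ ω.carrier, ∃ y ∈ ω.carrier, x ≠ y := by
  by_contra! hc
  have hs : ω.carrier.Subsingleton := fun x hx y hy => hc x hx y hy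
  have h1 : ω.toMeasure Set.univ ≤ 1 := by
    rw [toMeasure_apply _ MeasurableSet.univ,
      tsum_subtype ω.carrier (Set.univ.indicator (1 : X → ℝ≥0∞))]
    rcases hs.eq_empty_or_singleton with h | ⟨x, h⟩
    · simp [h]
    · rw [h, tsum_eq_single x]
      · simp
      · intro y hy
        simp [hy]
  exact absurd (h.trans h1) (by norm_num)

variable {σ : Measure X} [IsFiniteMeasure σ] {P : Measure (Configuration X)}

theorem IsPoissonMeasure.lintegral_toMeasure_apply (hP : IsPoissonMeasure σ P) {B : Set X}
    (hB : MeasurableSet B) : ∫⁻ ω, ω.toMeasure B ∂P = σ B := by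
  have := hP.isProbabilityMeasure
  have h := hP.lintegral_tsum_remove (v := fun q => B.indicator 1 q.2)
    ((measurable_one.indicator hB).comp measurable_snd)
  simp only [lintegral_const, measure_univ, mul_one, lintegral_indicator_one hB] at h
  rw [← h]
  exact lintegral_congr fun ω => ω.toMeasure_apply hB

theorem IsPoissonMeasure.measure_toMeasure_ne_zero_le (hP : IsPoissonMeasure σ P) {B : Set X}
    (hB : MeasurableSet B) : P {ω | ω.toMeasure B ≠ 0} ≤ σ B := by
  have h1 : P {ω | ω.toMeasure B ≠ 0} ≤ P {ω | 1 ≤ ω.toMeasure B} := by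
    refine measure_mono_ae ?_
    filter_upwards [hP.ae_finite] with ω hω h0
    obtain ⟨n, hn⟩ := Configuration.exists_nat_toMeasure_eq
      (Configuration.toMeasure_univ_lt_top_iff.1 hω) hB
    replace h0 : ω.toMeasure B ≠ 0 := h0
    change 1 ≤ ω.toMeasure B
    rw [hn] at h0 ⊢
    exact_mod_cast Nat.one_le_iff_ne_zero.2 (by exact_mod_cast h0)
  refine h1.trans ?_
  have h2 := mul_meas_ge_le_lintegral (μ := P) (Configuration.measurable_apply hB) 1
  rwa [one_mul, hP.lintegral_toMeasure_apply hB] at h2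

/-- A set meeting `{N ≥ 2}`, where `N` is the number of points, contains with positive probability
configurations with two points in some prescribed set of small measure. -/
theorem exists_measure_inter_two_le_pos (hσ : IsDiffuse σ) {A : Set (Configuration X)}
    (hA : P (A ∩ {ω | 2 ≤ ω.toMeasure Set.univ}) ≠ 0) {δ : ℝ≥0∞} (hδ : 0 < δ) :
    ∃ B, MeasurableSet B ∧ σ B ≤ δ ∧ P (A ∩ {ω | 2 ≤ ω.toMeasure B}) ≠ 0 := by
  obtain ⟨t, ht, hcov⟩ := hσ.exists_finite_cover (ENNReal.half_pos hδ.ne')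
  by_contra! hc
  refine hA (measure_mono_null (t := ⋃ D ∈ t, ⋃ E ∈ t, A ∩ {ω | 2 ≤ ω.toMeasure (D ∪ E)}) ?_ ?_)
  · rintro ω ⟨hωA, hω⟩
    obtain ⟨x, hx, y, hy, hxy⟩ := Configuration.exists_ne_of_two_le_toMeasure hω
    obtain ⟨D, hD, hxD⟩ := hcov x
    obtain ⟨E, hE, hyE⟩ := hcov y
    simp only [Set.mem_iUnion]
    exact ⟨D, hD, E, hE, hωA, Configuration.two_le_toMeasure hx hy hxy
      ((ht D hD).1.union (ht E hE).1) (Or.inl hxD) (Or.inr hyE)⟩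
  · refine (measure_biUnion_null_iff t.countable_toSet).2 fun D hD =>
      (measure_biUnion_null_iff t.countable_toSet).2 fun E hE => ?_
    refine hc _ ((ht D hD).1.union (ht E hE).1) ?_
    calc σ (D ∪ E) ≤ σ D + σ E := measure_union_le _ _
      _ ≤ δ / 2 + δ / 2 := add_le_add (ht D hD).2 (ht E hE).2
      _ = δ := ENNReal.add_halves δ

/-- An isoperimetric inequality extends from the sets of probability less than `1 / 2` to a set of
probability `1 / 2` which contains configurations with several points: forbidding two points in a
small set `B` makes the set strictly smaller, but changes both sides very little. -/
theorem mul_measure_le_of_perturbation (hP : IsPoissonMeasure σ P) (hσ : IsDiffuse σ)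
    {Φ : Set (Configuration X) → ℝ≥0∞} {c C : ℝ≥0∞} (hc : c ≠ ∞) (hC : C ≠ ∞)
    (hΦ : ∀ A, MeasurableSet A → 0 < P A → P A < 2⁻¹ → c * P A ≤ Φ A)
    (hpert : ∀ A B, MeasurableSet A → MeasurableSet B →
      Φ (A ∩ {ω | ω.toMeasure B ≤ 1}) ≤ Φ A + C * σ B)
    {A : Set (Configuration X)} (hA : MeasurableSet A) (hA2 : P A ≤ 2⁻¹)
    (hA1 : P (A ∩ {ω | 2 ≤ ω.toMeasure Set.univ}) ≠ 0) : c * P A ≤ Φ A := by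
  have := hP.isProbabilityMeasure
  refine ENNReal.le_of_forall_pos_le_add fun ε hε _ => ?_
  obtain ⟨B, hB, hBδ, hBA⟩ := exists_measure_inter_two_le_pos hσ hA1
    (δ := ε / (C + c + 1)) (ENNReal.div_pos (by exact_mod_cast hε.ne') (by finiteness))
  have hBm : MeasurableSet {ω : Configuration X | ω.toMeasure B ≤ 1} :=
    Configuration.measurable_apply hB measurableSet_Iic
  set A' := A ∩ {ω : Configuration X | ω.toMeasure B ≤ 1} with hA'
  have hdiff : P (A \ A') ≤ σ B := by
    refine (measure_mono ?_).trans (hP.measure_toMeasure_ne_zero_le hB)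
    rintro ω ⟨h1, h2⟩ h3
    exact h2 ⟨h1, by change ω.toMeasure B ≤ 1; rw [h3]; exact zero_le⟩
  have hsplit : P A = P A' + P (A \ A') := by
    have h := measure_inter_add_sdiff (μ := P) A (hA.inter hBm)
    rw [Set.inter_eq_right.2 Set.inter_subset_left] at h
    exact h.symm
  have hlt : P A' < P A := by
    rw [hsplit]
    refine ENNReal.lt_add_right (measure_ne_top _ _) fun h0 => hBA ?_
    refine measure_mono_null ?_ h0
    rintro ω ⟨h1, h2⟩
    refine ⟨h1, fun h3 => ?_⟩
    have h4 : (2 : ℝ≥0∞) ≤ 1 := le_trans h2 (show ω.toMeasure B ≤ 1 from h3.2)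
    exact absurd h4 (by norm_num)
  have hcA' : c * P A' ≤ Φ A' := by
    rcases eq_or_ne (P A') 0 with h0 | h0
    · simp [h0]
    · exact hΦ A' (hA.inter hBm) (pos_iff_ne_zero.2 h0) (hlt.trans_le hA2)
  calc c * P A = c * P A' + c * P (A \ A') := by rw [hsplit, mul_add]
    _ ≤ (Φ A + C * σ B) + c * σ B := by
        exact add_le_add (hcA'.trans (hpert A B hA hB)) (mul_le_mul_right hdiff c)
    _ = Φ A + (C + c) * σ B := by ring
    _ ≤ Φ A + (C + c + 1) * (ε / (C + c + 1)) := by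
        exact add_le_add le_rfl (mul_le_mul' le_self_add hBδ)
    _ = Φ A + ε := by
        rw [ENNReal.mul_div_cancel (by simp) (by finiteness)]

end

section

variable {X : Type*} [TopologicalSpace X] [MeasurableSpace X]

/-- Forbidding two points in `B` does not affect the gradient at configurations without points
in `B`. -/
theorem diffOp_indicator_inter_eq [MeasurableSingletonClass X] (A : Set (Configuration X))
    {B : Set X} {ω : Configuration X} (hω : ω.toMeasure B = 0) (x : X) :
    diffOp ((A ∩ {ω | ω.toMeasure B ≤ 1}).indicator fun _ => (1 : ℝ)) ω x =
      diffOp (A.indicator fun _ => (1 : ℝ)) ω x := by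
  classical
  have h : ∀ ω' : Configuration X, ω'.toMeasure B ≤ 1 →
      (A ∩ {ω | ω.toMeasure B ≤ 1}).indicator (fun _ => (1 : ℝ)) ω' =
        A.indicator (fun _ => (1 : ℝ)) ω' := by
    intro ω' h'
    simp [Set.indicator, h']
  unfold diffOp
  rw [h ω (by simp [hω])]
  split_ifs with hx
  · rw [h (ω.remove x)]
    refine le_trans ?_ (hω.le.trans zero_le_one)
    rw [← Configuration.toMeasure_remove hx, Measure.add_apply]
    exact le_self_add
  · rw [h (ω.add x)]
    rw [Configuration.toMeasure_add hx, Measure.add_apply, hω, zero_add]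
    exact prob_le_one

variable [MeasurableSingletonClass X] {σ : Measure X} [IsFiniteMeasure σ]
  {P : Measure (Configuration X)}

theorem lintegral_fieldNorm_top_inter_le (hP : IsPoissonMeasure σ P)
    {T : (Configuration X → ℝ) → Configuration X → X → ℝ} (hT : IsGradient T)
    (A : Set (Configuration X)) {B : Set X} (hB : MeasurableSet B) :
    ∫⁻ ω, fieldNorm σ ∞ (T ((A ∩ {ω | ω.toMeasure B ≤ 1}).indicator fun _ => (1 : ℝ))) ω ∂P ≤
      ∫⁻ ω, fieldNorm σ ∞ (T (A.indicator fun _ => (1 : ℝ))) ω ∂P + 1 * σ B := by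
  have hBm : MeasurableSet {ω : Configuration X | ω.toMeasure B ≠ 0} :=
    (Configuration.measurable_apply hB (measurableSet_singleton 0)).compl
  calc _ ≤ ∫⁻ ω, (fieldNorm σ ∞ (T (A.indicator fun _ => (1 : ℝ))) ω +
        {ω : Configuration X | ω.toMeasure B ≠ 0}.indicator 1 ω) ∂P := by
        refine lintegral_mono fun ω => ?_
        by_cases h : ω.toMeasure B = 0
        · refine le_trans (le_of_eq ?_) le_self_add
          obtain ⟨φ, -, hφ⟩ := hT
          unfold fieldNorm
          congr 1
          ext x
          rw [hφ, hφ, diffOp_indicator_inter_eq A h]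
        · refine le_trans (hT.fieldNorm_top_indicator_le_one _ ω) ?_
          rw [Set.indicator_of_mem (show ω ∈ {ω : Configuration X | ω.toMeasure B ≠ 0} from h)]
          exact le_add_self
    _ ≤ _ := by
        rw [lintegral_add_right _ (measurable_one.indicator hBm), lintegral_indicator_one hBm,
          one_mul]
        gcongr
        exact hP.measure_toMeasure_ne_zero_le hB

theorem lintegral_fieldNorm_one_inter_le (hP : IsPoissonMeasure σ P) (hσ : IsDiffuse σ)
    {A : Set (Configuration X)} (hA : MeasurableSet A) {B : Set X} (hB : MeasurableSet B) :
    ∫⁻ ω, fieldNorm σ 1 (diffOp ((A ∩ {ω | ω.toMeasure B ≤ 1}).indicator fun _ => (1 : ℝ))) ω ∂P ≤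
      ∫⁻ ω, fieldNorm σ 1 (diffOp (A.indicator fun _ => (1 : ℝ))) ω ∂P +
        (2 * σ Set.univ) * σ B := by
  obtain ⟨A, hA, rfl⟩ := hA
  have hBm : MeasurableSet {μ : Measure X | μ B ≤ 1} :=
    Measure.measurable_coe hB measurableSet_Iic
  have hBm' : MeasurableSet {ω : Configuration X | ω.toMeasure B ≠ 0} :=
    (Configuration.measurable_apply hB (measurableSet_singleton 0)).compl
  have h1 := lintegral_fieldNorm_one_diffOp hP hσ
    (F := (A ∩ {μ | μ B ≤ 1}).indicator fun _ => (1 : ℝ)) (measurable_const.indicator (hA.inter hBm))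
  have h2 := lintegral_fieldNorm_one_diffOp hP hσ
    (F := A.indicator fun _ => (1 : ℝ)) (measurable_const.indicator hA)
  refine h1.trans_le (le_trans ?_ (add_le_add_left h2.ge _))
  have hsub : ∀ μ : Measure X, μ B ≤ 1 →
      (A ∩ {μ | μ B ≤ 1}).indicator (fun _ => (1 : ℝ)) μ = A.indicator (fun _ => (1 : ℝ)) μ := by
    intro μ hμ
    by_cases h : μ ∈ A
    · rw [Set.indicator_of_mem h, Set.indicator_of_mem (show μ ∈ A ∩ {μ | μ B ≤ 1} from ⟨h, hμ⟩)]
    · rw [Set.indicator_of_notMem h, Set.indicator_of_notMem fun h' => h h'.1]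
  have hle : ∀ μ ν : Measure X, ‖(A ∩ {μ | μ B ≤ 1}).indicator (fun _ => (1 : ℝ)) μ -
      (A ∩ {μ | μ B ≤ 1}).indicator (fun _ => (1 : ℝ)) ν‖ₑ ≤ 1 := by
    intro μ ν
    rw [Real.enorm_eq_ofReal_abs, ENNReal.ofReal_le_one]
    by_cases h1 : μ ∈ A ∩ {μ | μ B ≤ 1} <;> by_cases h2 : ν ∈ A ∩ {μ | μ B ≤ 1} <;>
      simp only [h1, h2, Set.indicator_of_mem, Set.indicator_of_notMem, not_false_eq_true] <;> simp
  calc _ ≤ ∫⁻ ω, (∫⁻ x, ‖A.indicator (fun _ => (1 : ℝ)) (ω.toMeasure + Measure.dirac x) -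
          A.indicator (fun _ => (1 : ℝ)) ω.toMeasure‖ₑ ∂σ +
        σ Set.univ * {ω : Configuration X | ω.toMeasure B ≠ 0}.indicator 1 ω) ∂P := by
        refine lintegral_mono fun ω => ?_
        by_cases h : ω.toMeasure B = 0
        · refine le_trans (le_of_eq (lintegral_congr fun x => ?_)) le_self_add
          have h' : (ω.toMeasure + Measure.dirac x) B ≤ 1 := by
            rw [Measure.add_apply, h, zero_add]
            exact prob_le_one
          rw [hsub _ (h.le.trans zero_le_one), hsub _ h']
        · rw [Set.indicator_of_mem (show ω ∈ {ω : Configuration X | ω.toMeasure B ≠ 0} from h)]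
          refine le_trans ?_ le_add_self
          calc _ ≤ ∫⁻ _, 1 ∂σ := lintegral_mono fun x => hle _ _
            _ = _ := by simp
    _ ≤ _ := by
        rw [lintegral_add_right _ ((measurable_one.indicator hBm').const_mul _),
          lintegral_const_mul _ (measurable_one.indicator hBm'), lintegral_indicator_one hBm']
        gcongr
        · exact le_mul_of_one_le_left zero_le one_le_two
        · exact hP.measure_toMeasure_ne_zero_le hB

theorem mul_measure_le_of_le_isoperimetricConst_top (hP : IsPoissonMeasure σ P)
    (hσ : IsDiffuse σ) {T : (Configuration X → ℝ) → Configuration X → X → ℝ} (hT : IsGradient T)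
    {c : ℝ≥0∞} (hc : c ≠ ∞) (hcT : c ≤ isoperimetricConst σ P ∞ T) {A : Set (Configuration X)}
    (hA : MeasurableSet A) (hA2 : P A ≤ 2⁻¹)
    (hA1 : P (A ∩ {ω | 2 ≤ ω.toMeasure Set.univ}) ≠ 0) :
    c * P A ≤ ∫⁻ ω, fieldNorm σ ∞ (T (A.indicator fun _ => (1 : ℝ))) ω ∂P := by
  have := hP.isProbabilityMeasure
  refine mul_measure_le_of_perturbation hP hσ
    (Φ := fun A => ∫⁻ ω, fieldNorm σ ∞ (T (A.indicator fun _ => (1 : ℝ))) ω ∂P) hc ENNReal.one_ne_top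
    (fun A hA h0 h1 => ?_) (fun A B _ hB => lintegral_fieldNorm_top_inter_le hP hT A hB) hA hA2 hA1
  rw [← ENNReal.le_div_iff_mul_le (Or.inl h0.ne') (Or.inl (measure_ne_top _ _))]
  exact hcT.trans ((iInf₂_le A hA).trans (iInf₂_le h0 h1))

theorem mul_measure_le_of_le_isoperimetricConst_one (hP : IsPoissonMeasure σ P)
    (hσ : IsDiffuse σ) {c : ℝ≥0∞} (hc : c ≠ ∞) (hcT : c ≤ isoperimetricConst σ P 1 diffOp)
    {A : Set (Configuration X)} (hA : MeasurableSet A) (hA2 : P A ≤ 2⁻¹)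
    (hA1 : P (A ∩ {ω | 2 ≤ ω.toMeasure Set.univ}) ≠ 0) :
    c * P A ≤ ∫⁻ ω, fieldNorm σ 1 (diffOp (A.indicator fun _ => (1 : ℝ))) ω ∂P := by
  have := hP.isProbabilityMeasure
  refine mul_measure_le_of_perturbation hP hσ
    (Φ := fun A => ∫⁻ ω, fieldNorm σ 1 (diffOp (A.indicator fun _ => (1 : ℝ))) ω ∂P)
    (C := 2 * σ Set.univ) hc (by finiteness)
    (fun A hA h0 h1 => ?_) (fun A B hA hB => lintegral_fieldNorm_one_inter_le hP hσ hA hB) hA hA2 hA1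
  rw [← ENNReal.le_div_iff_mul_le (Or.inl h0.ne') (Or.inl (measure_ne_top _ _))]
  exact hcT.trans ((iInf₂_le A hA).trans (iInf₂_le h0 h1))

end

/-! ### Events depending on the number of points -/

section

variable {X : Type*} [TopologicalSpace X] [MeasurableSpace X]

theorem diffOp_indicator_toMeasure_univ (S : Set ℝ≥0∞) {ω : Configuration X} {n : ℕ}
    (hn : ω.toMeasure Set.univ = n) (x : X) :
    diffOp ({ω : Configuration X | ω.toMeasure Set.univ ∈ S}.indicator fun _ => (1 : ℝ)) ω x =
        S.indicator 1 (n : ℝ≥0∞) - S.indicator 1 ((n + 1 : ℕ) : ℝ≥0∞) ∨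
      ∃ m : ℕ, n = m + 1 ∧
        diffOp ({ω : Configuration X | ω.toMeasure Set.univ ∈ S}.indicator fun _ => (1 : ℝ)) ω x =
          S.indicator 1 (n : ℝ≥0∞) - S.indicator 1 (m : ℝ≥0∞) := by
  classical
  have e : ∀ {ω : Configuration X} {n : ℕ}, ω.toMeasure Set.univ = n →
      {ω : Configuration X | ω.toMeasure Set.univ ∈ S}.indicator (fun _ => (1 : ℝ)) ω =
        S.indicator 1 (n : ℝ≥0∞) := by
    intro ω n hn
    simp [Set.indicator, hn]
  by_cases hx : x ∈ ω.carrier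
  · right
    have h := congrArg (fun μ : Measure X => μ Set.univ) (Configuration.toMeasure_remove hx)
    have h1 : Measure.dirac x Set.univ = 1 := measure_univ
    simp only [Measure.add_apply, h1, hn] at h
    have hne : n ≠ 0 := by
      rintro rfl
      simp at h
    obtain ⟨m, rfl⟩ := Nat.exists_eq_succ_of_ne_zero hne
    have hm : (ω.remove x).toMeasure Set.univ = m := by
      rw [Nat.succ_eq_add_one, Nat.cast_add, Nat.cast_one] at h
      exact (ENNReal.add_left_inj ENNReal.one_ne_top).1 h
    exact ⟨m, rfl, by rw [diffOp, if_pos hx, e hn, e hm]⟩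
  · left
    have hm : (ω.add x).toMeasure Set.univ = (n + 1 : ℕ) := by
      have h1 : Measure.dirac x Set.univ = 1 := measure_univ
      rw [Configuration.toMeasure_add hx, Measure.add_apply, hn, h1, Nat.cast_add, Nat.cast_one]
    rw [diffOp, if_neg hx, e hn, e hm]

/-- The gradient of the indicator of the upper tail `{N ≥ k + 1}` lives on `{N = k + 1}` and
`{N = k}`. -/
theorem diffOp_indicator_succ_le {ω : Configuration X} {n : ℕ}
    (hn : ω.toMeasure Set.univ = n) (k : ℕ) (x : X) :
    let d := diffOp ({ω : Configuration X | ((k + 1 : ℕ) : ℝ≥0∞) ≤ ω.toMeasure Set.univ}.indicator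
      fun _ => (1 : ℝ)) ω x
    d = 0 ∨ (d = 1 ∧ n = k + 1) ∨ (d = -1 ∧ n = k) := by
  intro d
  have hS : ∀ j : ℕ, (Set.Ici ((k + 1 : ℕ) : ℝ≥0∞)).indicator (1 : ℝ≥0∞ → ℝ) (j : ℝ≥0∞) =
      if k + 1 ≤ j then 1 else 0 := by
    intro j
    simp only [Set.indicator, Set.mem_Ici, Nat.cast_le, Pi.one_apply]
  rcases diffOp_indicator_toMeasure_univ (Set.Ici ((k + 1 : ℕ) : ℝ≥0∞)) hn x with h | ⟨m, rfl, h⟩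
  · rw [hS, hS] at h
    rw [show d = _ from h]
    split_ifs <;> first | omega | simp <;> omega
  · rw [hS, hS] at h
    rw [show d = _ from h]
    split_ifs <;> first | omega | simp <;> omega

/-- The gradient of the indicator of the lower tail `{N ≤ k}` lives on `{N = k}` and
`{N = k + 1}`. -/
theorem diffOp_indicator_le {ω : Configuration X} {n : ℕ}
    (hn : ω.toMeasure Set.univ = n) (k : ℕ) (x : X) :
    let d := diffOp ({ω : Configuration X | ω.toMeasure Set.univ ≤ k}.indicator
      fun _ => (1 : ℝ)) ω x
    d = 0 ∨ (d = 1 ∧ n = k) ∨ (d = -1 ∧ n = k + 1) := by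
  intro d
  have hS : ∀ j : ℕ, (Set.Iic (k : ℝ≥0∞)).indicator (1 : ℝ≥0∞ → ℝ) (j : ℝ≥0∞) =
      if j ≤ k then 1 else 0 := by
    intro j
    simp only [Set.indicator, Set.mem_Iic, Nat.cast_le, Pi.one_apply]
  rcases diffOp_indicator_toMeasure_univ (Set.Iic (k : ℝ≥0∞)) hn x with h | ⟨m, rfl, h⟩
  · rw [hS, hS] at h
    rw [show d = _ from h]
    split_ifs <;> first | omega | simp <;> omega
  · rw [hS, hS] at h
    rw [show d = _ from h]
    split_ifs <;> first | omega | simp <;> omega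

variable {σ : Measure X} [IsFiniteMeasure σ] {P : Measure (Configuration X)}

omit [IsFiniteMeasure σ] in
theorem IsPoissonMeasure.ae_exists_nat (hP : IsPoissonMeasure σ P) :
    ∀ᵐ ω ∂P, ∃ n : ℕ, ω.toMeasure Set.univ = (n : ℝ≥0∞) := by
  filter_upwards [hP.ae_finite] with ω hω
  exact Configuration.exists_nat_toMeasure_eq (Configuration.toMeasure_univ_lt_top_iff.1 hω)
    MeasurableSet.univ

omit [IsFiniteMeasure σ] in
theorem IsPoissonMeasure.measure_univ_eq (hP : IsPoissonMeasure σ P) (k : ℕ) :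
    P {ω | ω.toMeasure Set.univ = k} = ENNReal.ofReal (poissonWeight (σ.real Set.univ) k) :=
  hP.measure_apply_eq MeasurableSet.univ k

theorem measurableSet_univ_eq (k : ℕ) :
    MeasurableSet {ω : Configuration X | ω.toMeasure Set.univ = k} :=
  Configuration.measurable_apply MeasurableSet.univ (measurableSet_singleton _)

omit [IsFiniteMeasure σ] in
theorem lintegral_fieldNorm_top_le (hP : IsPoissonMeasure σ P) {u : Configuration X → X → ℝ}
    {i j : ℕ} {a b : ℝ≥0∞}
    (h : ∀ (ω : Configuration X) (n : ℕ), ω.toMeasure Set.univ = n → ∀ x,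
      ‖u ω x‖ₑ ≤ (if n = i then a else 0) + if n = j then b else 0) :
    ∫⁻ ω, fieldNorm σ ∞ u ω ∂P ≤
      a * P {ω | ω.toMeasure Set.univ = i} + b * P {ω | ω.toMeasure Set.univ = j} := by
  have hi := measurableSet_univ_eq (X := X) i
  have hj := measurableSet_univ_eq (X := X) j
  rw [← lintegral_indicator_const hi, ← lintegral_indicator_const hj,
    ← lintegral_add_left (measurable_const.indicator hi)]
  refine lintegral_mono_ae ?_
  filter_upwards [hP.ae_exists_nat] with ω ⟨n, hn⟩
  refine (fieldNorm_top_le (h ω n hn)).trans (le_of_eq ?_)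
  simp [Set.indicator, hn]

/-- The Mecke formula for null sets: a property holds almost surely for the
configuration and an independent point if and only if it holds for the configuration without `x`
and `x`, where `x` is any of its points. -/
theorem ae_ae_iff_ae_remove (hP : IsPoissonMeasure σ P) {S : Set (Measure X × X)}
    (hS : MeasurableSet S) :
    (∀ᵐ ω : Configuration X ∂P, ∀ᵐ x ∂σ, (ω.toMeasure, x) ∉ S) ↔
      ∀ᵐ ω : Configuration X ∂P, ∀ x : ω.carrier, ((ω.remove x).toMeasure, (x : X)) ∉ S := by
  have hv : Measurable (S.indicator (1 : Measure X × X → ℝ≥0∞)) := measurable_one.indicator hS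
  have h := hP.lintegral_tsum_remove hv
  have e1 : ∀ ω : Configuration X, ∫⁻ x, S.indicator 1 (ω.toMeasure, x) ∂σ = 0 ↔
      ∀ᵐ x ∂σ, (ω.toMeasure, x) ∉ S := by
    intro ω
    refine (lintegral_eq_zero_iff (hv.comp measurable_prodMk_left)).trans ?_
    refine Filter.eventually_congr (Filter.Eventually.of_forall fun x => ?_)
    simp
  have e2 : ∀ ω : Configuration X,
      ∑' x : ω.carrier, S.indicator (1 : Measure X × X → ℝ≥0∞) ((ω.remove x).toMeasure, (x : X)) = 0
        ↔ ∀ x : ω.carrier, ((ω.remove x).toMeasure, (x : X)) ∉ S := by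
    intro ω
    rw [ENNReal.tsum_eq_zero]
    refine forall_congr' fun x => ?_
    simp
  simp_rw [← e1, ← e2]
  have h1 := lintegral_eq_zero_iff' (hP.aemeasurable_tsum_remove hv)
  have h2 := lintegral_eq_zero_iff (μ := P)
    ((hv.lintegral_prod_right' (ν := σ)).comp Configuration.measurable_toMeasure)
  rw [h] at h1
  exact h2.symm.trans h1

end

/-! ### The one-sided gradient and sets of probability one half -/

section

variable {X : Type*} [TopologicalSpace X] [MeasurableSpace X]
  {σ : Measure X} [IsFiniteMeasure σ] {P : Measure (Configuration X)}

theorem exists_measure_pos_lt_half (hP : IsPoissonMeasure σ P) (hσ : IsDiffuse σ)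
    (hσ0 : σ Set.univ ≠ 0) : ∃ A, MeasurableSet A ∧ 0 < P A ∧ P A < 2⁻¹ := by
  obtain ⟨t, ht, hcov⟩ := hσ.exists_finite_cover (δ := 4⁻¹) (by simp)
  obtain ⟨D, hD, hD0⟩ : ∃ D ∈ t, σ D ≠ 0 := by
    by_contra! hc
    refine hσ0 (measure_mono_null (t := ⋃ D ∈ t, D) (fun x _ => ?_)
      ((measure_biUnion_null_iff t.countable_toSet).2 hc))
    obtain ⟨D, hD, hx⟩ := hcov x
    exact Set.mem_biUnion hD hx
  have h1 := hP.measure_apply_eq (ht D hD).1 1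
  rw [Nat.cast_one] at h1
  refine ⟨{ω | ω.toMeasure D = 1},
    Configuration.measurable_apply (ht D hD).1 (measurableSet_singleton _), ?_, ?_⟩
  · rw [h1, ENNReal.ofReal_pos, poissonWeight]
    have : 0 < σ.real D := ENNReal.toReal_pos hD0 (measure_ne_top _ _)
    positivity
  · calc P {ω | ω.toMeasure D = 1} ≤ P {ω | ω.toMeasure D ≠ 0} := by
          refine measure_mono fun ω (hω : ω.toMeasure D = 1) => ?_
          simp [hω]
      _ ≤ σ D := hP.measure_toMeasure_ne_zero_le (ht D hD).1
      _ ≤ 4⁻¹ := (ht D hD).2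
      _ < 2⁻¹ := by
          rw [ENNReal.inv_lt_inv]
          norm_num

theorem isoperimetricConst_top_diffPlus_le_one (hP : IsPoissonMeasure σ P) (hσ : IsDiffuse σ)
    (hσ0 : σ Set.univ ≠ 0) : isoperimetricConst σ P ∞ diffPlus ≤ 1 := by
  obtain ⟨A, hA, h0, h1⟩ := exists_measure_pos_lt_half hP hσ hσ0
  refine (iInf₂_le A hA).trans ((iInf₂_le h0 h1).trans ?_)
  refine ENNReal.div_le_of_le_mul ?_
  rw [one_mul, ← lintegral_indicator_one hA]
  refine lintegral_mono fun ω => fieldNorm_top_le fun x => ?_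
  rcases diffPlus_indicator_eq_zero_or_one A ω x with h | ⟨hω, h⟩
  · simp [h]
  · simp [h, hω]

omit [IsFiniteMeasure σ] in
/-- The norm is maximal at a configuration of `A` which can be moved out of `A` by adding a point. -/
theorem one_le_fieldNorm_top_diffPlus_indicator [MeasurableSingletonClass X] (hσ : IsDiffuse σ)
    {A : Set (Measure X)} {ω : Configuration X} (hω : ω.toMeasure ∈ A)
    (h : ¬ ∀ᵐ x ∂σ, ω.toMeasure + Measure.dirac x ∈ A) :
    1 ≤ fieldNorm σ ∞
      (diffPlus ((Configuration.toMeasure ⁻¹' A).indicator fun _ => (1 : ℝ))) ω := by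
  by_contra! hlt
  refine h ?_
  filter_upwards [hσ.ae_notMem_carrier ω, ae_le_fieldNorm_top (σ := σ)
    (diffPlus ((Configuration.toMeasure ⁻¹' A).indicator fun _ => (1 : ℝ))) ω] with x hx hle
  by_contra hxA
  have h1 : diffPlus ((Configuration.toMeasure ⁻¹' A).indicator fun _ => (1 : ℝ)) ω x = 1 := by
    have h2 := diffOp_of_notMem (F := A.indicator fun _ => (1 : ℝ)) hx
    rw [Set.indicator_of_mem hω, Set.indicator_of_notMem hxA, sub_zero] at h2
    unfold diffPlus
    rw [show diffOp ((Configuration.toMeasure ⁻¹' A).indicator fun _ => (1 : ℝ)) ω x = 1 from h2]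
    norm_num
  rw [h1, enorm_one] at hle
  exact absurd hlt hle.not_gt

theorem le_two_of_one_add_mul_exp_eq {s : ℝ} (hs : (1 + s) * Real.exp (-s) = 1 / 2) (h0 : 0 ≤ s) :
    s ≤ 2 := by
  by_contra! h
  have h1 := Real.sum_le_exp_of_nonneg h0 4
  have h2 : Real.exp s = 2 * (1 + s) := by
    rw [Real.exp_neg] at hs
    have := Real.exp_pos s
    field_simp at hs
    linarith
  simp only [Finset.sum_range_succ, Finset.sum_range_zero, h2, Nat.factorial] at h1
  norm_num at h1
  nlinarith [mul_pos (sub_pos.2 h) (sub_pos.2 h),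
    mul_pos (mul_pos (sub_pos.2 h) (sub_pos.2 h)) (sub_pos.2 h)]

/-- For the gradient `D⁺` and `p = ∞`, the isoperimetric inequality holds for all sets of
probability at most `1 / 2`. A set of probability `1 / 2` without configurations of several points
either consists of inner boundary points only, or it is `{N ≤ 1}`, with `N` the number of points,
and in that case its inner boundary `{N = 1}` is at least as large as the inner boundary `{N = 2}`
of its complement. -/
theorem mul_measure_le_lintegral_fieldNorm_top_diffPlus [MeasurableSingletonClass X]
    (hP : IsPoissonMeasure σ P) (hσ : IsDiffuse σ) (hσ0 : σ Set.univ ≠ 0)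
    {A : Set (Configuration X)} (hA : MeasurableSet A) (hA2 : P A ≤ 2⁻¹) :
    isoperimetricConst σ P ∞ diffPlus * P A ≤
      ∫⁻ ω, fieldNorm σ ∞ (diffPlus (A.indicator fun _ => (1 : ℝ))) ω ∂P := by
  have := hP.isProbabilityMeasure
  have hc1 := isoperimetricConst_top_diffPlus_le_one hP hσ hσ0
  set c := isoperimetricConst σ P ∞ diffPlus with hc
  have hcne : c ≠ ∞ := (hc1.trans_lt ENNReal.one_lt_top).ne
  by_cases h2 : P (A ∩ {ω | 2 ≤ ω.toMeasure Set.univ}) ≠ 0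
  · exact mul_measure_le_of_le_isoperimetricConst_top hP hσ isGradient_diffPlus hcne le_rfl hA hA2 h2
  rw [not_not] at h2
  rcases hA2.lt_or_eq with hlt | hhalf
  · rcases eq_or_ne (P A) 0 with h0 | h0
    · simp [h0]
    · rw [← ENNReal.le_div_iff_mul_le (Or.inl h0) (Or.inl (measure_ne_top _ _))]
      exact (iInf₂_le A hA).trans (iInf₂_le (pos_iff_ne_zero.2 h0) hlt)
  obtain ⟨A, hA', rfl⟩ := hA
  set R := fieldNorm σ ∞
    (diffPlus ((Configuration.toMeasure ⁻¹' A).indicator fun _ => (1 : ℝ))) with hR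
  have hNm : Measurable fun μ : Measure X => μ Set.univ := Measure.measurable_coe MeasurableSet.univ
  have hdm : Measurable fun q : Measure X × X => q.1 + Measure.dirac q.2 :=
    measurable_fst.add (Measure.measurable_dirac.comp measurable_snd)
  -- adding a point to a non-empty configuration leads out of `A`
  have hout : ∀ᵐ ω : Configuration X ∂P, ∀ᵐ x ∂σ,
      ¬ (1 ≤ ω.toMeasure Set.univ ∧ ω.toMeasure + Measure.dirac x ∈ A) := by
    refine (ae_ae_iff_ae_remove hP
      (S := {q | 1 ≤ q.1 Set.univ ∧ q.1 + Measure.dirac q.2 ∈ A}) ?_).2 ?_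
    · exact ((hNm.comp measurable_fst) measurableSet_Ici).inter (hdm hA')
    · filter_upwards [measure_eq_zero_iff_ae_notMem.1 h2] with ω hω x hx
      refine hω ⟨?_, ?_⟩
      · have := hx.2
        rwa [Configuration.toMeasure_remove x.2] at this
      · have h1 : Measure.dirac (x : X) Set.univ = 1 := measure_univ
        change 2 ≤ ω.toMeasure Set.univ
        rw [← Configuration.toMeasure_remove x.2, Measure.add_apply, h1, ← one_add_one_eq_two]
        exact add_le_add_left hx.1 1
  have hnot : ∀ {p : X → Prop}, (∀ᵐ x ∂σ, p x) → ¬ ∀ᵐ x ∂σ, ¬ p x := by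
    intro p h1 h2
    have : (ae σ).NeBot := ae_neBot.2 fun h => hσ0 (by simp [h])
    obtain ⟨x, hx1, hx2⟩ := (h1.and h2).exists
    exact hx2 hx1
  have hR1 : ∀ᵐ ω : Configuration X ∂P, ω.toMeasure ∈ A → 1 ≤ ω.toMeasure Set.univ → 1 ≤ R ω := by
    filter_upwards [hout] with ω hω hωA h1
    refine one_le_fieldNorm_top_diffPlus_indicator hσ hωA fun h => hnot h ?_
    filter_upwards [hω] with x hx hxA using hx ⟨h1, hxA⟩
  by_cases h0 : (0 : Measure X) ∈ A ∧ ∀ᵐ x ∂σ, (0 : Measure X) + Measure.dirac x ∈ A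
  · have hin : ∀ᵐ ω : Configuration X ∂P, ω.toMeasure Set.univ = 1 → ω.toMeasure ∈ A := by
      have h : ∀ᵐ ω : Configuration X ∂P, ∀ᵐ x ∂σ,
          (ω.toMeasure, x) ∉ {q : Measure X × X | q.1 Set.univ = 0 ∧
            q.1 + Measure.dirac q.2 ∉ A} := by
        refine Filter.Eventually.of_forall fun ω => ?_
        filter_upwards [h0.2] with x hx hx'
        have hx1 : ω.toMeasure Set.univ = 0 := hx'.1
        rw [Measure.measure_univ_eq_zero] at hx1
        exact hx'.2 (by simpa only [hx1] using hx)
      filter_upwards [(ae_ae_iff_ae_remove hP (((hNm.comp measurable_fst)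
        (measurableSet_singleton 0)).inter (hdm hA').compl)).1 h] with ω hω h1
      by_contra hωA
      have hne : ω.carrier.Nonempty := by
        rw [Set.nonempty_iff_ne_empty]
        intro he
        rw [Configuration.toMeasure_apply _ MeasurableSet.univ,
          tsum_subtype ω.carrier (Set.univ.indicator (1 : X → ℝ≥0∞)), he] at h1
        simp at h1
      obtain ⟨x, hx⟩ := hne
      refine hω ⟨x, hx⟩ ⟨?_, ?_⟩
      · have h2 : Measure.dirac x Set.univ = 1 := measure_univ
        rw [← Configuration.toMeasure_remove hx, Measure.add_apply, h2] at h1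
        exact (ENNReal.add_left_inj ENNReal.one_ne_top).1 (h1.trans (zero_add _).symm)
      · change (ω.remove x).toMeasure + Measure.dirac x ∉ A
        rwa [Configuration.toMeasure_remove hx]
    set s := σ.real Set.univ with hs
    have hs0 : 0 ≤ s := measureReal_nonneg
    have hw : ∀ k : ℕ, 0 ≤ poissonWeight s k := poissonWeight_nonneg hs0
    have hPk := fun k => hP.measure_univ_eq k
    rw [← hs] at hPk
    have hm0 := measurableSet_univ_eq (X := X) 0
    have hm1 := measurableSet_univ_eq (X := X) 1
    -- `A` is the set of configurations with at most one point
    have hAeq : (Configuration.toMeasure ⁻¹' A : Set (Configuration X)) =ᵐ[P]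
        ({ω | ω.toMeasure Set.univ = (0 : ℕ)} ∪ {ω | ω.toMeasure Set.univ = (1 : ℕ)} :
          Set (Configuration X)) := by
      rw [Filter.eventuallyEq_set]
      filter_upwards [hin, measure_eq_zero_iff_ae_notMem.1 h2, hP.ae_exists_nat] with ω h1 h2 ⟨n, hn⟩
      constructor
      · intro hω
        have h3 : ¬ 2 ≤ ω.toMeasure Set.univ := fun h => h2 ⟨hω, h⟩
        rw [hn] at h3
        have h4 : n < 2 := by
          by_contra! h5
          exact h3 (by exact_mod_cast h5)
        interval_cases n
        · exact Or.inl hn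
        · exact Or.inr hn
      · rintro (h | h)
        · have h' : ω.toMeasure Set.univ = 0 := by simpa using h
          rw [Measure.measure_univ_eq_zero] at h'
          change ω.toMeasure ∈ A
          rw [h']
          exact h0.1
        · exact h1 (by simpa using h)
    have hsum : P (Configuration.toMeasure ⁻¹' A) =
        ENNReal.ofReal (poissonWeight s 0 + poissonWeight s 1) := by
      rw [measure_congr hAeq, measure_union _ hm1, hPk, hPk, ENNReal.ofReal_add (hw 0) (hw 1)]
      rw [Set.disjoint_left]
      intro ω (h : _ = _) (h' : _ = _)
      rw [h] at h'
      exact absurd (Nat.cast_injective h') (by norm_num)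
    have hs2 : s ≤ 2 := by
      rw [hhalf] at hsum
      have h := congrArg ENNReal.toReal hsum
      rw [ENNReal.toReal_ofReal (add_nonneg (hw 0) (hw 1))] at h
      refine le_two_of_one_add_mul_exp_eq ?_ hs0
      simp [poissonWeight] at h
      linarith
    have hcompl : {ω : Configuration X | ((1 + 1 : ℕ) : ℝ≥0∞) ≤ ω.toMeasure Set.univ} =ᵐ[P]
        ((Configuration.toMeasure ⁻¹' A)ᶜ : Set (Configuration X)) := by
      refine Filter.EventuallyEq.trans ?_ hAeq.compl.symm
      rw [Filter.eventuallyEq_set]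
      filter_upwards [hP.ae_exists_nat] with ω ⟨n, hn⟩
      simp only [Set.mem_ofPred_eq, Set.mem_compl_iff, Set.mem_union, hn, Nat.cast_le, Nat.cast_inj]
      omega
    have hm2 : MeasurableSet
        {ω : Configuration X | ((1 + 1 : ℕ) : ℝ≥0∞) ≤ ω.toMeasure Set.univ} :=
      Configuration.measurable_apply MeasurableSet.univ measurableSet_Ici
    have hP2 : P {ω : Configuration X | ((1 + 1 : ℕ) : ℝ≥0∞) ≤ ω.toMeasure Set.univ} = 2⁻¹ := by
      rw [measure_congr hcompl, prob_compl_eq_one_sub (Configuration.measurable_toMeasure hA'),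
        hhalf, ENNReal.one_sub_inv_two]
    have hkey := mul_measure_le_of_le_isoperimetricConst_top hP hσ isGradient_diffPlus hcne le_rfl
      hm2 hP2.le (by
        rw [show {ω : Configuration X | ((1 + 1 : ℕ) : ℝ≥0∞) ≤ ω.toMeasure Set.univ} ∩
          {ω | 2 ≤ ω.toMeasure Set.univ} = {ω | ((1 + 1 : ℕ) : ℝ≥0∞) ≤ ω.toMeasure Set.univ} by
            ext; simp [one_add_one_eq_two], hP2]
        simp)
    rw [hhalf, ← hP2]
    refine hkey.trans ((lintegral_fieldNorm_top_le hP (i := 1 + 1) (j := 0) (a := 1) (b := 0)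
      fun ω n hn x => ?_).trans ?_)
    · rw [diffPlus]
      rcases diffOp_indicator_succ_le hn 1 x with h | ⟨h, h'⟩ | ⟨h, h'⟩
      · rw [h]; simp
      · rw [h, h']; simp
      · rw [h, h']; simp
    · rw [zero_mul, add_zero, one_mul, hPk]
      refine le_trans (b := P {ω | ω.toMeasure Set.univ = (1 : ℕ)}) ?_ ?_
      · rw [hPk]
        refine ENNReal.ofReal_le_ofReal ?_
        have h := succ_mul_poissonWeight s 1
        push_cast at h
        nlinarith [hw 1]
      · rw [← lintegral_indicator_one hm1]
        refine lintegral_mono_ae ?_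
        filter_upwards [hin, hR1] with ω h1 h2
        refine Set.indicator_apply_le' (fun h => ?_) fun _ => zero_le
        have h3 : ω.toMeasure Set.univ = 1 := by simpa using h
        exact h2 (h1 h3) h3.ge
  · refine (mul_le_of_le_one_left zero_le hc1).trans ?_
    rw [← lintegral_indicator_one (Configuration.measurable_toMeasure hA')]
    refine lintegral_mono_ae ?_
    filter_upwards [hR1, hP.ae_exists_nat] with ω h1 ⟨n, hn⟩
    by_cases hω : ω.toMeasure ∈ A
    · rw [Set.indicator_of_mem (show ω ∈ Configuration.toMeasure ⁻¹' A from hω)]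
      rcases Nat.eq_zero_or_pos n with rfl | hpos
      · rw [Nat.cast_zero, Measure.measure_univ_eq_zero] at hn
        refine one_le_fieldNorm_top_diffPlus_indicator hσ hω fun h => h0 ?_
        rw [hn] at hω h
        exact ⟨hω, h⟩
      · refine h1 hω ?_
        rw [hn]
        exact_mod_cast hpos
    · rw [Set.indicator_of_notMem (show ω ∉ Configuration.toMeasure ⁻¹' A from hω)]
      exact zero_le

end

/-! ### The constant for medians -/

section

variable {X : Type*} [TopologicalSpace X] [MeasurableSpace X] [MeasurableSingletonClass X]
  {σ : Measure X} {P : Measure (Configuration X)}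

theorem measurable_diffOp {F : Measure X → ℝ} (hF : Measurable F) (ω : Configuration X) :
    Measurable (diffOp (fun ω => F ω.toMeasure) ω) := by
  intro S hS
  have e : diffOp (fun ω => F ω.toMeasure) ω ⁻¹' S =
      (diffOp (fun ω => F ω.toMeasure) ω ⁻¹' S ∩ ω.carrier) ∪
        ((fun x => F ω.toMeasure - F (ω.toMeasure + Measure.dirac x)) ⁻¹' S ∩ ω.carrierᶜ) := by
    ext x
    by_cases hx : x ∈ ω.carrier
    · simp [hx]
    · simp [hx, diffOp_of_notMem (F := F) hx]
  rw [e]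
  refine MeasurableSet.union (ω.countable_carrier.mono Set.inter_subset_right).measurableSet
    (MeasurableSet.inter ?_ ω.countable_carrier.measurableSet.compl)
  exact ((hF.comp_add_dirac.comp measurable_prodMk_left).const_sub _) hS

theorem aemeasurable_fieldNorm_top_diffPlus [IsFiniteMeasure σ] (hP : IsPoissonMeasure σ P)
    (hσ : IsDiffuse σ) {F : Measure X → ℝ} (hF : Measurable F) :
    AEMeasurable (fieldNorm σ ∞ (diffPlus fun ω => F ω.toMeasure)) P := by
  have hN : NullMeasurable (fieldNorm σ ∞ (diffPlus fun ω => F ω.toMeasure)) P := by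
    refine measurable_of_Iic (δ := NullMeasurableSpace (Configuration X) P) fun r => ?_
    have hψ : Measurable fun y : ℝ => (Set.Ioi r).indicator (1 : ℝ≥0∞ → ℝ≥0∞) ‖max 0 y‖ₑ :=
      (measurable_one.indicator measurableSet_Ioi).comp (by fun_prop)
    have h := hP.aemeasurable_lintegral_diffOp hσ hF hψ
    refine (h.nullMeasurable (measurableSet_singleton 0)).congr (Filter.Eventually.of_forall ?_)
    intro ω
    refine propext ?_
    change _ = 0 ↔ fieldNorm σ ∞ (diffPlus fun ω => F ω.toMeasure) ω ≤ r
    refine (lintegral_eq_zero_iff (hψ.comp (measurable_diffOp hF ω))).trans ?_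
    rw [fieldNorm, eLpNorm_exponent_top]
    constructor
    · intro h0
      refine eLpNormEssSup_le_of_ae_enorm_bound ?_
      filter_upwards [h0] with x hx
      by_contra! hlt
      have hmem : ‖max 0 (diffOp (fun ω => F ω.toMeasure) ω x)‖ₑ ∈ Set.Ioi r := hlt
      simp [Set.indicator_of_mem hmem] at hx
    · intro h0
      filter_upwards [ae_le_eLpNormEssSup (f := diffPlus (fun ω => F ω.toMeasure) ω)
        (μ := (2 : ℝ≥0∞)⁻¹ • (σ + ω.toMeasure))] with x hx
      have hmem : ‖max 0 (diffOp (fun ω => F ω.toMeasure) ω x)‖ₑ ∉ Set.Ioi r :=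
        (hx.trans h0).not_gt
      simp only [Function.comp_apply, Pi.zero_apply]
      exact Set.indicator_of_notMem hmem _
  exact hN.aemeasurable

omit [MeasurableSingletonClass X] in
/-- The norm of the gradient of the indicator of a level set. -/
theorem fieldNorm_top_diffPlus_indicator_le (G : Configuration X → ℝ) (t : ℝ)
    (ω : Configuration X) :
    fieldNorm σ ∞ (diffPlus ({ω | t < G ω}.indicator fun _ => (1 : ℝ))) ω ≤
      {ω | t < G ω ∧ ENNReal.ofReal (G ω - t) ≤ fieldNorm σ ∞ (diffPlus G) ω}.indicator 1 ω := by
  classical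
  by_cases h : t < G ω ∧ ENNReal.ofReal (G ω - t) ≤ fieldNorm σ ∞ (diffPlus G) ω
  · refine (isGradient_diffPlus.fieldNorm_top_indicator_le_one _ ω).trans_eq ?_
    have hω : ω ∈ {ω | t < G ω ∧ ENNReal.ofReal (G ω - t) ≤ fieldNorm σ ∞ (diffPlus G) ω} := h
    rw [Set.indicator_of_mem hω, Pi.one_apply]
  · refine le_trans (le_of_eq ?_) zero_le
    rw [fieldNorm, eLpNorm_exponent_top, eLpNormEssSup_eq_zero_iff]
    have hR : ∀ᵐ x ∂((2 : ℝ≥0∞)⁻¹ • (σ + ω.toMeasure)),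
        ‖diffPlus G ω x‖ₑ ≤ fieldNorm σ ∞ (diffPlus G) ω := by
      rw [fieldNorm, eLpNorm_exponent_top]
      exact ae_le_eLpNormEssSup
    filter_upwards [hR] with x hx
    rcases diffPlus_indicator_eq_zero_or_one {ω | t < G ω} ω x with h0 | ⟨hω, h1⟩
    · exact h0
    · refine absurd ⟨hω, le_trans ?_ hx⟩ h
      -- the point `x` crosses the level `t`, hence changes `G` by at least `G ω - t`
      have hkey : ∀ ω', max 0 ({ω | t < G ω}.indicator (fun _ => (1 : ℝ)) ω -
          {ω | t < G ω}.indicator (fun _ => (1 : ℝ)) ω') = 1 → G ω - t ≤ G ω - G ω' := by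
        intro ω' h'
        by_contra! hlt
        have hω' : ω' ∈ {ω | t < G ω} := by
          change t < G ω'
          linarith
        rw [Set.indicator_of_mem hω, Set.indicator_of_mem hω'] at h'
        norm_num at h'
      have h2 : G ω - t ≤ diffOp G ω x := by
        unfold diffPlus diffOp at h1
        unfold diffOp
        split_ifs at h1 ⊢
        · exact hkey _ h1
        · exact hkey _ h1
      rw [diffPlus, Real.enorm_of_nonneg (le_max_left _ _)]
      exact ENNReal.ofReal_le_ofReal (h2.trans (le_max_right _ _))

/-- The isoperimetric inequality, integrated over the level sets of `F` above the level `m`. -/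
theorem mul_lintegral_sub_le_lintegral_fieldNorm_top [IsFiniteMeasure σ]
    (hP : IsPoissonMeasure σ P) (hσ : IsDiffuse σ) (hσ0 : σ Set.univ ≠ 0) {F : Measure X → ℝ}
    (hF : Measurable F) {m : ℝ} (hm : P {ω | m < F ω.toMeasure} ≤ 2⁻¹) :
    isoperimetricConst σ P ∞ diffPlus * ∫⁻ ω, ENNReal.ofReal (F ω.toMeasure - m) ∂P ≤
      ∫⁻ ω, fieldNorm σ ∞ (diffPlus fun ω => F ω.toMeasure) ω ∂P := by
  have := hP.isProbabilityMeasure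
  have hc1 := isoperimetricConst_top_diffPlus_le_one hP hσ hσ0
  set c := isoperimetricConst σ P ∞ diffPlus with hc
  have hcne : c ≠ ∞ := (hc1.trans_lt ENNReal.one_lt_top).ne
  have hRm := aemeasurable_fieldNorm_top_diffPlus hP hσ hF
  set R := fieldNorm σ ∞ (diffPlus fun ω => F ω.toMeasure) with hR
  have hG : Measurable fun ω : Configuration X => F ω.toMeasure :=
    hF.comp Configuration.measurable_toMeasure
  have hQm := hRm.measurable_mk
  have hQ := hRm.ae_eq_mk
  set Q := hRm.mk R with hQdef
  -- the layers of `(F - m)⁺`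
  let L : Set (Configuration X × ℝ) := {q | m ≤ q.2 ∧ q.2 < F q.1.toMeasure}
  have hL : MeasurableSet L := (measurableSet_le measurable_const measurable_snd).inter
    (measurableSet_lt measurable_snd (hG.comp measurable_fst))
  let K : Set (Configuration X × ℝ) :=
    {q | q.2 < F q.1.toMeasure ∧ ENNReal.ofReal (F q.1.toMeasure - q.2) ≤ Q q.1}
  have hK : MeasurableSet K :=
    (measurableSet_lt measurable_snd (hG.comp measurable_fst)).inter (measurableSet_le
      ((hG.comp measurable_fst).sub measurable_snd).ennreal_ofReal (hQm.comp measurable_fst))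
  have h1 : ∀ ω : Configuration X,
      ENNReal.ofReal (F ω.toMeasure - m) = ∫⁻ t, L.indicator 1 (ω, t) := by
    intro ω
    have e : ∀ t : ℝ, L.indicator (1 : Configuration X × ℝ → ℝ≥0∞) (ω, t) =
        (Set.Ico m (F ω.toMeasure)).indicator 1 t := fun t => rfl
    simp_rw [e]
    rw [lintegral_indicator_one measurableSet_Ico, Real.volume_Ico]
  have h2 : ∀ ω : Configuration X, ∫⁻ t, K.indicator 1 (ω, t) ≤ Q ω := by
    intro ω
    rcases eq_or_ne (Q ω) ∞ with h | h
    · rw [h]; exact le_top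
    have e : ∀ t : ℝ, K.indicator (1 : Configuration X × ℝ → ℝ≥0∞) (ω, t) ≤
        (Set.Ico (F ω.toMeasure - (Q ω).toReal) (F ω.toMeasure)).indicator 1 t := by
      intro t
      refine Set.indicator_apply_le' (fun ht => ?_) fun _ => zero_le
      have ht1 : F ω.toMeasure - t ≤ (Q ω).toReal := (ENNReal.ofReal_le_iff_le_toReal h).1 ht.2
      have hmem : t ∈ Set.Ico (F ω.toMeasure - (Q ω).toReal) (F ω.toMeasure) :=
        ⟨by linarith, ht.1⟩
      rw [Set.indicator_of_mem hmem]
      rfl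
    refine (lintegral_mono e).trans_eq ?_
    rw [lintegral_indicator_one measurableSet_Ico, Real.volume_Ico, sub_sub_cancel,
      ENNReal.ofReal_toReal h]
  have h3 : ∀ t : ℝ, c * ∫⁻ ω, L.indicator 1 (ω, t) ∂P ≤ ∫⁻ ω, K.indicator 1 (ω, t) ∂P := by
    intro t
    rcases lt_or_ge t m with htm | htm
    · have e : ∀ ω : Configuration X,
          L.indicator (1 : Configuration X × ℝ → ℝ≥0∞) (ω, t) = 0 := fun ω =>
        Set.indicator_of_notMem (fun h => htm.not_ge h.1) _
      simp [e]
    have hAm : MeasurableSet {ω : Configuration X | t < F ω.toMeasure} :=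
      measurableSet_lt measurable_const hG
    have hA2 : P {ω | t < F ω.toMeasure} ≤ 2⁻¹ :=
      (measure_mono (show {ω : Configuration X | t < F ω.toMeasure} ⊆ {ω | m < F ω.toMeasure} from
        fun ω hω => lt_of_le_of_lt htm hω)).trans hm
    have e : ∀ ω : Configuration X, L.indicator (1 : Configuration X × ℝ → ℝ≥0∞) (ω, t) =
        {ω : Configuration X | t < F ω.toMeasure}.indicator 1 ω := by
      intro ω
      by_cases h : t < F ω.toMeasure
      · rw [Set.indicator_of_mem (show (ω, t) ∈ L from ⟨htm, h⟩)]
        exact (Set.indicator_of_mem (s := {ω : Configuration X | t < F ω.toMeasure}) h 1).symm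
      · rw [Set.indicator_of_notMem (show (ω, t) ∉ L from fun h' => h h'.2)]
        exact (Set.indicator_of_notMem (s := {ω : Configuration X | t < F ω.toMeasure}) h 1).symm
    simp_rw [e]
    rw [lintegral_indicator_one hAm]
    refine (mul_measure_le_lintegral_fieldNorm_top_diffPlus hP hσ hσ0 hAm hA2).trans ?_
    refine lintegral_mono_ae ?_
    filter_upwards [hQ] with ω hω
    refine (fieldNorm_top_diffPlus_indicator_le (fun ω => F ω.toMeasure) t ω).trans ?_
    refine Set.indicator_apply_le' (fun ht => ?_) fun _ => zero_le
    rw [Set.indicator_of_mem (show (ω, t) ∈ K from ⟨ht.1, hω ▸ ht.2⟩)]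
    rfl
  have hswap : ∀ {S : Set (Configuration X × ℝ)}, MeasurableSet S →
      ∫⁻ ω, (∫⁻ t : ℝ, S.indicator 1 (ω, t)) ∂P = ∫⁻ t : ℝ, ∫⁻ ω, S.indicator 1 (ω, t) ∂P := fun hS =>
    lintegral_lintegral_swap (measurable_one.indicator hS).aemeasurable
  calc c * ∫⁻ ω, ENNReal.ofReal (F ω.toMeasure - m) ∂P
      = c * ∫⁻ t, ∫⁻ ω, L.indicator 1 (ω, t) ∂P := by
        simp_rw [h1]
        rw [hswap hL]
    _ = ∫⁻ t, c * ∫⁻ ω, L.indicator 1 (ω, t) ∂P := (lintegral_const_mul' _ _ hcne).symm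
    _ ≤ ∫⁻ t, ∫⁻ ω, K.indicator 1 (ω, t) ∂P := lintegral_mono h3
    _ = ∫⁻ ω, (∫⁻ t : ℝ, K.indicator 1 (ω, t)) ∂P := (hswap hK).symm
    _ ≤ ∫⁻ ω, Q ω ∂P := lintegral_mono h2
    _ = ∫⁻ ω, R ω ∂P := (lintegral_congr_ae hQ).symm

/-- A function with vanishing one-sided gradient is constant: apply the Poincaré inequality to a
bounded increasing function of it. -/
theorem isAEConst_of_lintegral_fieldNorm_top_diffPlus_eq_zero [Nonempty X] [IsFiniteMeasure σ]
    (hP : IsPoissonMeasure σ P) (hσ : IsDiffuse σ) {F : Measure X → ℝ} (hF : Measurable F)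
    (h : ∫⁻ ω, fieldNorm σ ∞ (diffPlus fun ω => F ω.toMeasure) ω ∂P = 0) :
    IsAEConst P fun ω => F ω.toMeasure := by
  have := hP.isProbabilityMeasure
  rw [lintegral_eq_zero_iff' (aemeasurable_fieldNorm_top_diffPlus hP hσ hF)] at h
  have hH : Measurable fun μ => Real.arctan (F μ) := Real.measurable_arctan.comp hF
  have hHm : Measurable fun ω : Configuration X => Real.arctan (F ω.toMeasure) :=
    hH.comp Configuration.measurable_toMeasure
  have hL : MemLp (fun ω : Configuration X => Real.arctan (F ω.toMeasure)) 2 P := by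
    refine MemLp.of_bound hHm.aestronglyMeasurable (Real.pi / 2)
      (Filter.Eventually.of_forall fun ω => ?_)
    rw [Real.norm_eq_abs, abs_le]
    exact ⟨(Real.neg_pi_div_two_lt_arctan _).le, (Real.arctan_lt_pi_div_two _).le⟩
  have h2 : ∫⁻ ω, fieldNorm σ 2 (diffPlus fun ω => Real.arctan (F ω.toMeasure)) ω ^ 2 ∂P = 0 := by
    rw [← lintegral_zero (μ := P)]
    refine lintegral_congr_ae ?_
    filter_upwards [h] with ω hω
    rw [Pi.zero_apply, fieldNorm, eLpNorm_exponent_top, eLpNormEssSup_eq_zero_iff] at hω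
    have : diffPlus (fun ω => Real.arctan (F ω.toMeasure)) ω
        =ᵐ[(2 : ℝ≥0∞)⁻¹ • (σ + ω.toMeasure)] 0 := by
      filter_upwards [hω] with x hx
      have hmono : ∀ ω' : Configuration X, max 0 (F ω.toMeasure - F ω'.toMeasure) = 0 →
          max 0 (Real.arctan (F ω.toMeasure) - Real.arctan (F ω'.toMeasure)) = 0 := by
        intro ω' h'
        rw [max_eq_left_iff, sub_nonpos] at h' ⊢
        exact Real.arctan_strictMono.monotone h'
      unfold diffPlus diffOp at hx ⊢
      split_ifs at hx ⊢
      · exact hmono _ hx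
      · exact hmono _ hx
    rw [fieldNorm, eLpNorm_congr_ae this, eLpNorm_zero]
    simp
  rw [lintegral_fieldNorm_two_diffPlus hP hσ hH, mul_eq_zero] at h2
  have h3 := hP.evariance_le_lintegral hσ hH hL
  rw [h2.resolve_left (by simp), nonpos_iff_eq_zero,
    evariance_eq_zero_iff hHm.aemeasurable] at h3
  refine ⟨Real.tan (∫ ω, Real.arctan (F ω.toMeasure) ∂P), ?_⟩
  filter_upwards [h3] with ω hω
  rw [← hω, Real.tan_arctan]

theorem isoperimetricConst_top_diffPlus_eq_medianConstPlus [Nonempty X] [IsFiniteMeasure σ]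
    (hP : IsPoissonMeasure σ P) (hσ : IsDiffuse σ) (hσ0 : σ Set.univ ≠ 0) :
    isoperimetricConst σ P ∞ diffPlus = medianConstPlus σ P ∞ := by
  have := hP.isProbabilityMeasure
  refine le_antisymm ?_ ?_
  · refine le_iInf₂ fun G hG => le_iInf₂ fun hL hc => le_iInf₂ fun m hm => ?_
    obtain ⟨F, hF, rfl⟩ := exists_measurable_comp_toMeasure hG
    have hne : ∫⁻ ω, fieldNorm σ ∞ (diffPlus fun ω => F ω.toMeasure) ω ∂P ≠ 0 := fun h =>
      hc (isAEConst_of_lintegral_fieldNorm_top_diffPlus_eq_zero hP hσ hF h)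
    have hfin : ∫⁻ ω, ENNReal.ofReal (F ω.toMeasure - m) ∂P ≠ ∞ := by
      have h : Integrable (fun ω : Configuration X => F ω.toMeasure - m) P :=
        hL.sub (integrable_const m)
      exact (Integrable.lintegral_lt_top h).ne
    have hm2 : P {ω | m < F ω.toMeasure} ≤ 2⁻¹ := by
      have e : {ω : Configuration X | m < F ω.toMeasure} = {ω | F ω.toMeasure ≤ m}ᶜ := by
        ext ω; simp
      rw [e, prob_compl_eq_one_sub (measurableSet_le hG measurable_const),
        ← ENNReal.one_sub_inv_two]
      exact tsub_le_tsub_left hm.1 _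
    rw [ENNReal.le_div_iff_mul_le (Or.inr hne) (Or.inl hfin)]
    exact mul_lintegral_sub_le_lintegral_fieldNorm_top hP hσ hσ0 hF hm2
  · refine le_iInf₂ fun A hA => le_iInf₂ fun h0 h1 => ?_
    have hG : Measurable (A.indicator fun _ => (1 : ℝ)) := measurable_const.indicator hA
    have hL : Integrable (A.indicator fun _ => (1 : ℝ)) P := (integrable_const 1).indicator hA
    have hmed : IsMedian P (A.indicator fun _ => (1 : ℝ)) 0 := by
      constructor
      · have : P Aᶜ ≤ P {ω | A.indicator (fun _ => (1 : ℝ)) ω ≤ 0} := by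
          refine measure_mono fun ω (hω : ω ∉ A) => ?_
          change A.indicator (fun _ => (1 : ℝ)) ω ≤ 0
          rw [Set.indicator_of_notMem hω]
        refine le_trans ?_ this
        rw [prob_compl_eq_one_sub hA, ← ENNReal.one_sub_inv_two]
        exact tsub_le_tsub_left h1.le _
      · have : {ω | 0 ≤ A.indicator (fun _ => (1 : ℝ)) ω} = Set.univ := by
          ext ω
          simpa using Set.indicator_nonneg (fun _ _ => zero_le_one) ω
        rw [this, measure_univ]
        simp
    refine (iInf₂_le _ hG).trans ((iInf₂_le hL (not_isAEConst_indicator hA h0 h1.le)).trans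
      ((iInf₂_le 0 hmed).trans (le_of_eq ?_)))
    congr 1
    rw [← lintegral_indicator_one hA]
    refine lintegral_congr fun ω => ?_
    by_cases h : ω ∈ A <;> simp [h]

end

/-! ### Tail inequalities for the number of points -/

theorem tsum_odd_indicator_lt (j : ℕ) :
    ∑' i : ℕ, (2 * i + 1 : ℝ≥0∞) * (if i + 1 ≤ j then 1 else 0) = (j : ℝ≥0∞) ^ 2 := by
  rw [tsum_eq_sum (s := Finset.range j) fun i hi => by
    rw [if_neg (by simpa [Nat.succ_le_iff] using hi), mul_zero]]
  induction j with
  | zero => simp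
  | succ j ih =>
    rw [Finset.sum_range_succ, if_pos le_rfl]
    rw [Finset.sum_congr rfl (g := fun i : ℕ => (2 * i + 1 : ℝ≥0∞) * (if i + 1 ≤ j then 1 else 0))
      fun i hi => by
        rw [if_pos (by simp at hi; omega), if_pos (by simp at hi; omega)], ih]
    push_cast
    ring

theorem tsum_odd_indicator_eq_le (α β : ℝ≥0∞) (j : ℕ) :
    ∑' i : ℕ, (2 * i + 1 : ℝ≥0∞) * (α * (if j = i + 1 then 1 else 0) +
      β * (if j = i then 1 else 0)) ≤ 2 * (α + β) * j + β := by
  simp_rw [mul_add, ENNReal.tsum_add]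
  have h2 : ∑' i : ℕ, ((2 * i : ℝ≥0∞) + 1) * (β * (if j = i then 1 else 0)) = (2 * j + 1) * β := by
    rw [tsum_eq_single j fun i hi => by rw [if_neg hi.symm, mul_zero, mul_zero]]
    simp
  have h1 : ∑' i : ℕ, ((2 * i : ℝ≥0∞) + 1) * (α * (if j = i + 1 then 1 else 0)) ≤ 2 * j * α := by
    cases j with
    | zero => simp
    | succ j =>
      rw [tsum_eq_single j fun i hi => by rw [if_neg (by omega), mul_zero, mul_zero]]
      simp only [if_true, mul_one]
      gcongr
      push_cast
      rw [mul_add]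
      gcongr
      norm_num
  rw [h2]
  calc _ ≤ 2 * j * α + (2 * j + 1) * β := by gcongr
    _ = _ := by ring

/-- If the tails of an integer valued random variable are controlled by its point masses, its
second moment is controlled by its mean: sum the tail inequalities with the odd numbers as
weights. -/
theorem mul_lintegral_sq_le_of_tail {Ω : Type*} [MeasurableSpace Ω] {P : Measure Ω}
    {Y : Ω → ℕ} (hY : Measurable Y) {c α β : ℝ≥0∞}
    (h : ∀ i : ℕ, c * P {ω | i + 1 ≤ Y ω} ≤ α * P {ω | Y ω = i + 1} + β * P {ω | Y ω = i}) :
    c * ∫⁻ ω, (Y ω : ℝ≥0∞) ^ 2 ∂P ≤ ∫⁻ ω, (2 * (α + β) * Y ω + β) ∂P := by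
  have hm : ∀ f : ℕ → ℝ≥0∞, Measurable fun ω => f (Y ω) := fun f =>
    (Measurable.of_discrete (f := f)).comp hY
  have hS : ∀ p : ℕ → Prop, P {ω | p (Y ω)} = ∫⁻ ω, Set.indicator {n | p n} 1 (Y ω) ∂P := by
    intro p
    have hp : MeasurableSet {ω | p (Y ω)} := hY (MeasurableSet.of_discrete (s := {n | p n}))
    rw [← lintegral_indicator_one hp]
    rfl
  classical
  have hS' : ∀ (p : ℕ → Prop) [DecidablePred p],
      P {ω | p (Y ω)} = ∫⁻ ω, (if p (Y ω) then 1 else 0) ∂P := by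
    intro p _
    rw [hS]
    refine lintegral_congr fun ω => ?_
    by_cases hp : p (Y ω) <;> simp [Set.indicator, hp]
  calc c * ∫⁻ ω, (Y ω : ℝ≥0∞) ^ 2 ∂P
      = c * ∑' i : ℕ, (2 * i + 1 : ℝ≥0∞) * P {ω | i + 1 ≤ Y ω} := by
        simp_rw [← tsum_odd_indicator_lt]
        rw [lintegral_tsum fun i : ℕ => (hm fun n => (2 * i + 1 : ℝ≥0∞) *
          (if i + 1 ≤ n then 1 else 0)).aemeasurable]
        congr 2
        ext i
        rw [lintegral_const_mul _ (hm fun n => if i + 1 ≤ n then 1 else 0), ← hS' fun n => i + 1 ≤ n]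
    _ = ∑' i : ℕ, (2 * i + 1 : ℝ≥0∞) * (c * P {ω | i + 1 ≤ Y ω}) := by
        rw [← ENNReal.tsum_mul_left]
        congr 1
        ext i
        ring
    _ ≤ ∑' i : ℕ, (2 * i + 1 : ℝ≥0∞) * (α * P {ω | Y ω = i + 1} + β * P {ω | Y ω = i}) :=
        ENNReal.tsum_le_tsum fun i => mul_le_mul_right (h i) _
    _ = ∫⁻ ω, ∑' i : ℕ, (2 * i + 1 : ℝ≥0∞) * (α * (if Y ω = i + 1 then 1 else 0) +
          β * (if Y ω = i then 1 else 0)) ∂P := by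
        rw [lintegral_tsum fun i : ℕ => (hm fun n => (2 * i + 1 : ℝ≥0∞) *
          (α * (if n = i + 1 then 1 else 0) + β * (if n = i then 1 else 0))).aemeasurable]
        congr 1
        ext i
        rw [lintegral_const_mul _ (hm fun n => α * (if n = i + 1 then 1 else 0) +
            β * (if n = i then 1 else 0)),
          lintegral_add_left (hm fun n => α * (if n = i + 1 then 1 else 0)),
          lintegral_const_mul _ (hm fun n => if n = i + 1 then 1 else 0),
          lintegral_const_mul _ (hm fun n => if n = i then 1 else 0),
          ← hS' fun n => n = i + 1, ← hS' fun n => n = i]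
    _ ≤ _ := lintegral_mono fun ω => tsum_odd_indicator_eq_le α β _

section

variable {X : Type*} [TopologicalSpace X] [MeasurableSpace X]
  {σ : Measure X} {P : Measure (Configuration X)}

theorem Configuration.floor_count_eq {ω : Configuration X} {n : ℕ}
    (hn : ω.toMeasure Set.univ = n) : ⌊ω.count⌋₊ = n := by
  rw [count, hn]
  simp

theorem exists_median [IsProbabilityMeasure P] (Y : Configuration X → ℕ) :
    ∃ m : ℕ, 2⁻¹ ≤ P {ω | Y ω ≤ m} ∧ ∀ k < m, P {ω | Y ω ≤ k} < 2⁻¹ := by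
  classical
  have h : ∃ m : ℕ, 2⁻¹ ≤ P {ω | Y ω ≤ m} := by
    have hmono : Monotone fun m : ℕ => {ω | Y ω ≤ m} := fun a b hab ω hω => le_trans hω hab
    have ht := tendsto_measure_iUnion_atTop (μ := P) hmono
    have hU : ⋃ m : ℕ, {ω | Y ω ≤ m} = Set.univ :=
      Set.eq_univ_of_forall fun ω => Set.mem_iUnion.2 ⟨Y ω, le_refl (Y ω)⟩
    rw [hU, measure_univ] at ht
    obtain ⟨m, hm⟩ := ((tendsto_order.1 ht).1 2⁻¹ (by simp)).exists
    exact ⟨m, hm.le⟩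
  exact ⟨Nat.find h, Nat.find_spec h, fun k hk => not_le.1 (Nat.find_min h hk)⟩

/-- If `c` satisfies isoperimetric inequalities for the tails of the number `N` of points, then it
is bounded in terms of the variance of `N`: apply the inequalities to the tails on both sides
of a median. -/
theorem le_of_isoperimetric_tails [IsFiniteMeasure σ] (hP : IsPoissonMeasure σ P)
    (hs : 0 < σ.real Set.univ) {c α β α' β' γ : NNReal} (hγ : α + β = γ) (hγ' : α' + β' = γ)
    (hU : ∀ k : ℕ,
      P {ω : Configuration X | ((k + 1 : ℕ) : ℝ≥0∞) ≤ ω.toMeasure Set.univ} ≤ 2⁻¹ →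
      c * P {ω : Configuration X | ((k + 1 : ℕ) : ℝ≥0∞) ≤ ω.toMeasure Set.univ} ≤
        α * P {ω | ω.toMeasure Set.univ = (k + 1 : ℕ)} + β * P {ω | ω.toMeasure Set.univ = k})
    (hD : ∀ k : ℕ, P {ω : Configuration X | ω.toMeasure Set.univ ≤ k} < 2⁻¹ →
      c * P {ω : Configuration X | ω.toMeasure Set.univ ≤ k} ≤
        α' * P {ω | ω.toMeasure Set.univ = k} + β' * P {ω | ω.toMeasure Set.univ = (k + 1 : ℕ)}) :
    (c : ℝ) ≤ 2 * γ / √(σ.real Set.univ) + (β + β') / σ.real Set.univ := by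
  have := hP.isProbabilityMeasure
  set s := σ.real Set.univ with hsdef
  let N : Configuration X → ℕ := fun ω => ⌊ω.count⌋₊
  have hN : Measurable N := Nat.measurable_floor.comp Configuration.measurable_count
  have hNae : ∀ᵐ ω : Configuration X ∂P, ω.toMeasure Set.univ = N ω := by
    filter_upwards [hP.ae_exists_nat] with ω ⟨n, hn⟩
    rw [hn, show N ω = n from Configuration.floor_count_eq hn]
  have hset : ∀ p : ℝ≥0∞ → Prop, P {ω : Configuration X | p (ω.toMeasure Set.univ)} =
      P {ω | p (N ω)} := by
    intro p
    refine measure_congr (Filter.eventuallyEq_set.2 ?_)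
    filter_upwards [hNae] with ω hω
    rw [hω]
  have hge : ∀ k : ℕ, P {ω : Configuration X | ((k : ℕ) : ℝ≥0∞) ≤ ω.toMeasure Set.univ} =
      P {ω | k ≤ N ω} := by
    intro k
    rw [hset fun z => (k : ℝ≥0∞) ≤ z]
    simp only [Nat.cast_le]
  have hle : ∀ k : ℕ, P {ω : Configuration X | ω.toMeasure Set.univ ≤ k} =
      P {ω | N ω ≤ k} := by
    intro k
    rw [hset fun z => z ≤ (k : ℝ≥0∞)]
    simp only [Nat.cast_le]
  have heq : ∀ k : ℕ, P {ω : Configuration X | ω.toMeasure Set.univ = k} =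
      P {ω | N ω = k} := by
    intro k
    rw [hset fun z => z = (k : ℝ≥0∞)]
    simp only [Nat.cast_inj]
  simp_rw [hge, heq] at hU
  simp_rw [hle, heq] at hD
  obtain ⟨m, hm1, hm2⟩ := exists_median (P := P) N
  have hY1 : Measurable fun ω => N ω - m := (Measurable.of_discrete (f := fun n => n - m)).comp hN
  have hY2 : Measurable fun ω => m - N ω := (Measurable.of_discrete (f := fun n => m - n)).comp hN
  have h1 : (c : ℝ≥0∞) * ∫⁻ ω, ((N ω - m : ℕ) : ℝ≥0∞) ^ 2 ∂P ≤
      ∫⁻ ω, (2 * ((α : ℝ≥0∞) + β) * ((N ω - m : ℕ) : ℝ≥0∞) + β) ∂P := by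
    refine mul_lintegral_sq_le_of_tail hY1 fun i => ?_
    have e : {ω | i + 1 ≤ N ω - m} = {ω | m + i + 1 ≤ N ω} := by ext ω; simp; omega
    rw [e]
    refine (hU (m + i) ?_).trans ?_
    · have e' : {ω | m + i + 1 ≤ N ω} ⊆ {ω | N ω ≤ m}ᶜ := by
        intro ω (hω : m + i + 1 ≤ N ω) (h' : N ω ≤ m)
        omega
      refine (measure_mono e').trans ?_
      rw [prob_compl_eq_one_sub (measurableSet_le hN measurable_const), ← ENNReal.one_sub_inv_two]
      exact tsub_le_tsub_left hm1 _
    · refine add_le_add (mul_le_mul_right (measure_mono fun ω hω => ?_) _)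
        (mul_le_mul_right (measure_mono fun ω hω => ?_) _)
      · change N ω = _ at hω
        change N ω - m = _
        omega
      · change N ω = _ at hω
        change N ω - m = _
        omega
  have h2 : (c : ℝ≥0∞) * ∫⁻ ω, ((m - N ω : ℕ) : ℝ≥0∞) ^ 2 ∂P ≤
      ∫⁻ ω, (2 * ((α' : ℝ≥0∞) + β') * ((m - N ω : ℕ) : ℝ≥0∞) + β') ∂P := by
    refine mul_lintegral_sq_le_of_tail hY2 fun i => ?_
    rcases lt_or_ge i m with hi | hi
    · have e : {ω | i + 1 ≤ m - N ω} = {ω | N ω ≤ m - (i + 1)} := by ext ω; simp; omega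
      rw [e]
      refine (hD (m - (i + 1)) (hm2 _ (by omega))).trans ?_
      refine add_le_add (mul_le_mul_right (measure_mono fun ω hω => ?_) _)
        (mul_le_mul_right (measure_mono fun ω hω => ?_) _)
      · change N ω = _ at hω
        change m - N ω = _
        omega
      · change N ω = _ at hω
        change m - N ω = _
        omega
    · have e : {ω | i + 1 ≤ m - N ω} = ∅ := by
        ext ω
        simp
        omega
      rw [e, measure_empty, mul_zero]
      exact zero_le
  -- the variance of `N` around the median
  set V : ℝ := s + (s - m) ^ 2 with hV
  have hVs : s ≤ V := le_add_of_nonneg_right (sq_nonneg _)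
  have hV0 : 0 < V := hs.trans_le hVs
  have hVint : ∫⁻ ω, (((N ω - m : ℕ) : ℝ≥0∞) ^ 2 + ((m - N ω : ℕ) : ℝ≥0∞) ^ 2) ∂P =
      ENNReal.ofReal V := by
    have hL1 : Integrable (Configuration.count : Configuration X → ℝ) P :=
      hP.memLp_count.integrable one_le_two
    have hL2 : Integrable (fun ω : Configuration X => ω.count ^ 2) P := hP.memLp_count.integrable_sq
    have hi : Integrable (fun ω : Configuration X => (ω.count - m) ^ 2) P :=
      (hP.memLp_count.sub (memLp_const (m : ℝ))).integrable_sq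
    have hVe : ∫ ω, (ω.count - m) ^ 2 ∂P = V := by
      have e : ∀ ω : Configuration X, (ω.count - m) ^ 2 =
          ω.count ^ 2 - 2 * m * ω.count + m ^ 2 := fun ω => by ring
      have hL3 : Integrable (fun ω : Configuration X => ω.count ^ 2 - 2 * m * ω.count) P :=
        hL2.sub (hL1.const_mul _)
      simp_rw [e]
      rw [integral_add hL3 (integrable_const _),
        integral_sub hL2 (hL1.const_mul _), integral_const_mul, hP.integral_count,
        hP.integral_count_sq]
      simp [hV, ← hsdef]
      ring
    rw [← hVe, ofReal_integral_eq_lintegral_ofReal hi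
      (Filter.Eventually.of_forall fun _ => sq_nonneg _)]
    refine lintegral_congr_ae ?_
    filter_upwards [hNae] with ω hω
    have hc : ω.count = N ω := by
      rw [Configuration.count, hω]
      simp
    rw [hc]
    rcases le_total (N ω) m with h | h
    · rw [Nat.sub_eq_zero_of_le h]
      rw [show ((N ω : ℝ) - m) ^ 2 = ((m - N ω : ℕ) : ℝ) ^ 2 by
        rw [Nat.cast_sub h]; ring, ENNReal.ofReal_pow (by positivity)]
      simp
    · rw [Nat.sub_eq_zero_of_le h]
      rw [show ((N ω : ℝ) - m) ^ 2 = ((N ω - m : ℕ) : ℝ) ^ 2 by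
        rw [Nat.cast_sub h], ENNReal.ofReal_pow (by positivity)]
      simp
  have hm' : ∀ f : ℕ → ℝ≥0∞, Measurable fun ω => f (N ω) := fun f =>
    (Measurable.of_discrete (f := f)).comp hN
  have hsq : 0 < √s := Real.sqrt_pos.2 hs
  -- `2 |N - m| ≤ |N - m|² / √s + √s`
  have hamgm : ∀ j : ℕ, 2 * (j : ℝ≥0∞) ≤
      ENNReal.ofReal (1 / √s) * (j : ℝ≥0∞) ^ 2 + ENNReal.ofReal √s := by
    intro j
    rw [← ENNReal.ofReal_natCast j, ← ENNReal.ofReal_pow (by positivity),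
      ← ENNReal.ofReal_mul (by positivity), ← ENNReal.ofReal_add (by positivity) (by positivity),
      show (2 : ℝ≥0∞) = ENNReal.ofReal 2 by simp, ← ENNReal.ofReal_mul (by norm_num)]
    refine ENNReal.ofReal_le_ofReal ?_
    rw [one_div, inv_mul_eq_div, div_add' _ _ _ hsq.ne', le_div_iff₀ hsq]
    nlinarith [sq_nonneg ((j : ℝ) - √s)]
  have hmain : (c : ℝ≥0∞) * ENNReal.ofReal V ≤
      γ * (ENNReal.ofReal (1 / √s) * ENNReal.ofReal V + ENNReal.ofReal √s) + (β + β') := by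
    have hγe : (α : ℝ≥0∞) + β = γ := by exact_mod_cast hγ
    have hγe' : (α' : ℝ≥0∞) + β' = γ := by exact_mod_cast hγ'
    rw [hγe] at h1
    rw [hγe'] at h2
    calc (c : ℝ≥0∞) * ENNReal.ofReal V
        = c * ∫⁻ ω, ((N ω - m : ℕ) : ℝ≥0∞) ^ 2 ∂P + c * ∫⁻ ω, ((m - N ω : ℕ) : ℝ≥0∞) ^ 2 ∂P := by
          rw [← hVint, lintegral_add_left (hm' fun n => ((n - m : ℕ) : ℝ≥0∞) ^ 2), mul_add]
      _ ≤ _ := add_le_add h1 h2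
      _ = ∫⁻ ω, (2 * (γ : ℝ≥0∞) * ((N ω - m : ℕ) : ℝ≥0∞) + β +
            (2 * γ * ((m - N ω : ℕ) : ℝ≥0∞) + β')) ∂P := by
          rw [lintegral_add_left (hm' fun n => 2 * (γ : ℝ≥0∞) * ((n - m : ℕ) : ℝ≥0∞) + β)]
      _ ≤ ∫⁻ ω, (γ * (ENNReal.ofReal (1 / √s) * (((N ω - m : ℕ) : ℝ≥0∞) ^ 2 +
            ((m - N ω : ℕ) : ℝ≥0∞) ^ 2) + ENNReal.ofReal √s) + (β + β')) ∂P := by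
          refine lintegral_mono fun ω => ?_
          have h := hamgm (N ω - m + (m - N ω))
          have e : ((N ω - m + (m - N ω) : ℕ) : ℝ≥0∞) ^ 2 =
              ((N ω - m : ℕ) : ℝ≥0∞) ^ 2 + ((m - N ω : ℕ) : ℝ≥0∞) ^ 2 := by
            rcases le_total (N ω) m with h | h <;> simp [Nat.sub_eq_zero_of_le h]
          rw [e] at h
          refine le_trans (le_of_eq ?_) (add_le_add_left (mul_le_mul_right h (γ : ℝ≥0∞)) _)
          push_cast
          ring
      _ = _ := by
          rw [lintegral_add_right _ measurable_const, lintegral_const_mul' _ _ ENNReal.coe_ne_top,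
            lintegral_add_right _ measurable_const, lintegral_const_mul' _ _ ENNReal.ofReal_ne_top,
            hVint]
          simp
  have hreal : (c : ℝ) * V ≤ γ * (1 / √s * V + √s) + (β + β') := by
    have h := ENNReal.toReal_mono (by finiteness) hmain
    rw [ENNReal.toReal_mul, ENNReal.toReal_add (by finiteness) (by finiteness), ENNReal.toReal_mul,
      ENNReal.toReal_add (by finiteness) (by finiteness), ENNReal.toReal_mul,
      ENNReal.toReal_add (by finiteness) (by finiteness), ENNReal.toReal_ofReal hV0.le,
      ENNReal.toReal_ofReal (by positivity), ENNReal.toReal_ofReal (by positivity)] at h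
    simpa using h
  have hγ0 : (0 : ℝ) ≤ γ := γ.2
  have hββ : (0 : ℝ) ≤ β + β' := (β + β').2
  have hs1 : √s ≤ V / √s := by
    rw [le_div_iff₀ hsq, Real.mul_self_sqrt hs.le]
    exact hVs
  have hs2 : (β + β' : ℝ) ≤ (β + β') / s * V := by
    rw [div_mul_eq_mul_div, le_div_iff₀ hs]
    exact mul_le_mul_of_nonneg_left hVs hββ
  have hfin : (c : ℝ) * V ≤ (2 * γ / √s + (β + β') / s) * V := by
    have e : (2 * γ / √s + (β + β') / s) * V = γ * (1 / √s * V + V / √s) + (β + β') / s * V := by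
      ring
    rw [e]
    refine hreal.trans (add_le_add (mul_le_mul_of_nonneg_left ?_ hγ0) hs2)
    linarith
  exact le_of_mul_le_mul_right hfin hV0

end

/-! ### Upper bounds for the isoperimetric constants -/

section

variable {X : Type*} [TopologicalSpace X] [MeasurableSpace X] [MeasurableSingletonClass X]
  {σ : Measure X} [IsFiniteMeasure σ] {P : Measure (Configuration X)}

omit [MeasurableSingletonClass X] [IsFiniteMeasure σ] in
theorem measure_succ_le_inter_ne_zero (hP : IsPoissonMeasure σ P) (hs : 0 < σ.real Set.univ)
    (k : ℕ) : P ({ω : Configuration X | ((k + 1 : ℕ) : ℝ≥0∞) ≤ ω.toMeasure Set.univ} ∩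
      {ω | 2 ≤ ω.toMeasure Set.univ}) ≠ 0 := by
  have h := hP.measure_univ_eq (k + 2)
  have h0 : P {ω | ω.toMeasure Set.univ = (k + 2 : ℕ)} ≠ 0 := by
    rw [h]
    refine (ENNReal.ofReal_pos.2 ?_).ne'
    unfold poissonWeight
    positivity
  refine fun h' => h0 (measure_mono_null ?_ h')
  intro ω hω
  change ω.toMeasure Set.univ = _ at hω
  refine ⟨?_, ?_⟩
  · change _ ≤ ω.toMeasure Set.univ
    rw [hω]
    exact_mod_cast Nat.le_succ _
  · change _ ≤ ω.toMeasure Set.univ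
    rw [hω]
    exact_mod_cast Nat.le_add_left 2 k

/-- The bound `le_of_isoperimetric_tails` for an isoperimetric constant. The upper tail may have
probability `1 / 2`, which is not among the sets that define the constant. -/
theorem isoperimetricConst_top_le (hP : IsPoissonMeasure σ P) (hσ : IsDiffuse σ)
    (hs : 0 < σ.real Set.univ) {T : (Configuration X → ℝ) → Configuration X → X → ℝ}
    (hT : IsGradient T) {α β α' β' γ : NNReal} (hγ : α + β = γ) (hγ' : α' + β' = γ)
    (hU : ∀ (k : ℕ) (ω : Configuration X) (n : ℕ), ω.toMeasure Set.univ = n → ∀ x,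
      ‖T ({ω : Configuration X | ((k + 1 : ℕ) : ℝ≥0∞) ≤ ω.toMeasure Set.univ}.indicator
        fun _ => (1 : ℝ)) ω x‖ₑ ≤ (if n = k + 1 then (α : ℝ≥0∞) else 0) + if n = k then ↑β else 0)
    (hD : ∀ (k : ℕ) (ω : Configuration X) (n : ℕ), ω.toMeasure Set.univ = n → ∀ x,
      ‖T ({ω : Configuration X | ω.toMeasure Set.univ ≤ k}.indicator
        fun _ => (1 : ℝ)) ω x‖ₑ ≤
          (if n = k then (α' : ℝ≥0∞) else 0) + if n = k + 1 then ↑β' else 0) :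
    isoperimetricConst σ P ∞ T ≤
      ENNReal.ofReal (2 * γ / √(σ.real Set.univ) + (β + β') / σ.real Set.univ) := by
  have := hP.isProbabilityMeasure
  refine ENNReal.le_of_forall_nnreal_lt fun c hc => ?_
  rw [← ENNReal.ofReal_coe_nnreal]
  refine ENNReal.ofReal_le_ofReal (le_of_isoperimetric_tails hP hs hγ hγ' ?_ ?_)
  · intro k hk
    refine (mul_measure_le_of_le_isoperimetricConst_top hP hσ hT ENNReal.coe_ne_top hc.le
      (Configuration.measurable_apply MeasurableSet.univ measurableSet_Ici) hk
      (measure_succ_le_inter_ne_zero hP hs k)).trans ?_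
    exact lintegral_fieldNorm_top_le hP (hU k)
  · intro k hk
    have hm : MeasurableSet {ω : Configuration X | ω.toMeasure Set.univ ≤ k} :=
      Configuration.measurable_apply MeasurableSet.univ measurableSet_Iic
    rcases eq_or_ne (P {ω : Configuration X | ω.toMeasure Set.univ ≤ k}) 0 with h0 | h0
    · rw [h0, mul_zero]
      exact zero_le
    · refine le_trans ?_ (lintegral_fieldNorm_top_le hP (hD k))
      rw [← ENNReal.le_div_iff_mul_le (Or.inl h0) (Or.inl (measure_ne_top _ _))]
      exact hc.le.trans ((iInf₂_le _ hm).trans (iInf₂_le (pos_iff_ne_zero.2 h0) hk))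

theorem isoperimetricConst_top_diffOp_le (hP : IsPoissonMeasure σ P) (hσ : IsDiffuse σ)
    (hs : 0 < σ.real Set.univ) : isoperimetricConst σ P ∞ diffOp ≤
      ENNReal.ofReal (4 / √(σ.real Set.univ) + 2 / σ.real Set.univ) := by
  refine (isoperimetricConst_top_le hP hσ hs isGradient_diffOp (α := 1) (β := 1) (α' := 1)
    (β' := 1) rfl rfl (fun k ω n hn x => ?_) fun k ω n hn x => ?_).trans_eq ?_
  · rcases diffOp_indicator_succ_le hn k x with h | ⟨h, rfl⟩ | ⟨h, rfl⟩ <;> rw [h] <;> simp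
  · rcases diffOp_indicator_le hn k x with h | ⟨h, rfl⟩ | ⟨h, rfl⟩ <;> rw [h] <;> simp
  · congr 1
    push_cast
    norm_num

theorem isoperimetricConst_top_diffPlus_le (hP : IsPoissonMeasure σ P) (hσ : IsDiffuse σ)
    (hs : 0 < σ.real Set.univ) : isoperimetricConst σ P ∞ diffPlus ≤
      ENNReal.ofReal (2 / √(σ.real Set.univ)) := by
  refine (isoperimetricConst_top_le hP hσ hs isGradient_diffPlus (α := 1) (β := 0) (α' := 1)
    (β' := 0) rfl rfl (fun k ω n hn x => ?_) fun k ω n hn x => ?_).trans_eq ?_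
  · rw [diffPlus]
    rcases diffOp_indicator_succ_le hn k x with h | ⟨h, rfl⟩ | ⟨h, rfl⟩ <;> rw [h] <;> simp
  · rw [diffPlus]
    rcases diffOp_indicator_le hn k x with h | ⟨h, rfl⟩ | ⟨h, rfl⟩ <;> rw [h] <;> simp
  · congr 1
    push_cast
    norm_num

theorem isoperimetricConst_top_diffMinus_le (hP : IsPoissonMeasure σ P) (hσ : IsDiffuse σ)
    (hs : 0 < σ.real Set.univ) : isoperimetricConst σ P ∞ diffMinus ≤
      ENNReal.ofReal (2 / √(σ.real Set.univ) + 2 / σ.real Set.univ) := by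
  refine (isoperimetricConst_top_le hP hσ hs isGradient_diffMinus (α := 0) (β := 1) (α' := 0)
    (β' := 1) rfl rfl (fun k ω n hn x => ?_) fun k ω n hn x => ?_).trans_eq ?_
  · rw [diffMinus]
    rcases diffOp_indicator_succ_le hn k x with h | ⟨h, rfl⟩ | ⟨h, rfl⟩ <;> rw [h] <;> simp
  · rw [diffMinus]
    rcases diffOp_indicator_le hn k x with h | ⟨h, rfl⟩ | ⟨h, rfl⟩ <;> rw [h] <;> simp
  · congr 1
    push_cast
    norm_num

/-- The mean perimeter of an event which depends only on the number of points, and is either an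
upper or a lower tail with jump at `k`. -/
theorem lintegral_fieldNorm_one_le (hP : IsPoissonMeasure σ P) (hσ : IsDiffuse σ) {S : Set ℝ≥0∞}
    (hS : MeasurableSet S) {k : ℕ}
    (hk : ∀ n : ℕ, n ≠ k → ((n : ℝ≥0∞) ∈ S ↔ (n : ℝ≥0∞) + 1 ∈ S)) :
    ∫⁻ ω, fieldNorm σ 1 (diffOp ({ω : Configuration X | ω.toMeasure Set.univ ∈ S}.indicator
        fun _ => (1 : ℝ))) ω ∂P ≤
      σ Set.univ * P {ω | ω.toMeasure Set.univ = k} := by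
  have hSm : MeasurableSet {μ : Measure X | μ Set.univ ∈ S} :=
    Measure.measurable_coe MeasurableSet.univ hS
  have hm := measurableSet_univ_eq (X := X) k
  have h1 := lintegral_fieldNorm_one_diffOp hP hσ
    (F := {μ : Measure X | μ Set.univ ∈ S}.indicator fun _ => (1 : ℝ))
    (measurable_const.indicator hSm)
  refine h1.trans_le ?_
  rw [← lintegral_indicator_const hm]
  refine lintegral_mono_ae ?_
  filter_upwards [hP.ae_exists_nat] with ω ⟨n, hn⟩
  have hd : ∀ x : X, (ω.toMeasure + Measure.dirac x) Set.univ = (n : ℝ≥0∞) + 1 := by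
    intro x
    have h1 : Measure.dirac x Set.univ = 1 := measure_univ
    rw [Measure.add_apply, hn, h1]
  rcases eq_or_ne n k with rfl | hnk
  · rw [Set.indicator_of_mem (s := {ω : Configuration X | ω.toMeasure Set.univ = n}) hn]
    refine (lintegral_mono (g := fun _ => 1) fun x => ?_).trans_eq (by simp)
    rw [Real.enorm_eq_ofReal_abs, ENNReal.ofReal_le_one]
    simp only [Set.indicator]
    split_ifs <;> simp
  · refine le_trans (le_of_eq ?_) zero_le
    rw [← lintegral_zero (μ := σ)]
    refine lintegral_congr fun x => ?_
    have e : (ω.toMeasure + Measure.dirac x ∈ {μ : Measure X | μ Set.univ ∈ S}) ↔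
        ω.toMeasure ∈ {μ : Measure X | μ Set.univ ∈ S} := by
      change (ω.toMeasure + Measure.dirac x) Set.univ ∈ S ↔ ω.toMeasure Set.univ ∈ S
      rw [hd, hn]
      exact (hk n hnk).symm
    by_cases h : ω.toMeasure ∈ {μ : Measure X | μ Set.univ ∈ S}
    · rw [Set.indicator_of_mem h, Set.indicator_of_mem (e.2 h), sub_self, enorm_zero]
    · rw [Set.indicator_of_notMem h, Set.indicator_of_notMem fun h' => h (e.1 h'), sub_self,
        enorm_zero]

theorem isoperimetricConst_one_diffOp_le (hP : IsPoissonMeasure σ P) (hσ : IsDiffuse σ)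
    (hs : 0 < σ.real Set.univ) : isoperimetricConst σ P 1 diffOp ≤
      ENNReal.ofReal (2 * √(σ.real Set.univ) + 1) := by
  have := hP.isProbabilityMeasure
  have hσN : σ Set.univ = ((σ Set.univ).toNNReal : ℝ≥0∞) :=
    (ENNReal.coe_toNNReal (measure_ne_top _ _)).symm
  refine ENNReal.le_of_forall_nnreal_lt fun c hc => ?_
  rw [← ENNReal.ofReal_coe_nnreal]
  refine ENNReal.ofReal_le_ofReal ((le_of_isoperimetric_tails hP hs (c := c) (α := 0)
    (β := (σ Set.univ).toNNReal) (α' := (σ Set.univ).toNNReal) (β' := 0) (γ := (σ Set.univ).toNNReal)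
    (zero_add _) (add_zero _) ?_ ?_).trans_eq ?_)
  · intro k hk
    refine (mul_measure_le_of_le_isoperimetricConst_one hP hσ ENNReal.coe_ne_top hc.le
      (Configuration.measurable_apply MeasurableSet.univ measurableSet_Ici) hk
      (measure_succ_le_inter_ne_zero hP hs k)).trans ?_
    rw [ENNReal.coe_zero, zero_mul, zero_add, ← hσN]
    refine lintegral_fieldNorm_one_le hP hσ (S := Set.Ici ((k + 1 : ℕ) : ℝ≥0∞)) measurableSet_Ici
      fun n hn => ?_
    rw [Set.mem_Ici, Set.mem_Ici, Nat.cast_le]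
    norm_cast
    omega
  · intro k hk
    have hm : MeasurableSet {ω : Configuration X | ω.toMeasure Set.univ ≤ k} :=
      Configuration.measurable_apply MeasurableSet.univ measurableSet_Iic
    rcases eq_or_ne (P {ω : Configuration X | ω.toMeasure Set.univ ≤ k}) 0 with h0 | h0
    · rw [h0, mul_zero]
      exact zero_le
    · rw [ENNReal.coe_zero, zero_mul, add_zero, ← hσN]
      refine le_trans ?_ (lintegral_fieldNorm_one_le hP hσ (S := Set.Iic (k : ℝ≥0∞))
        measurableSet_Iic fun n hn => ?_)
      · rw [← ENNReal.le_div_iff_mul_le (Or.inl h0) (Or.inl (measure_ne_top _ _))]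
        exact hc.le.trans ((iInf₂_le _ hm).trans (iInf₂_le (pos_iff_ne_zero.2 h0) hk))
      · rw [Set.mem_Iic, Set.mem_Iic, Nat.cast_le]
        norm_cast
        omega
  · change 2 * σ.real Set.univ / √(σ.real Set.univ) +
      (σ.real Set.univ + ((0 : NNReal) : ℝ)) / σ.real Set.univ = _
    rw [NNReal.coe_zero, add_zero, div_self hs.ne', mul_div_assoc, Real.div_sqrt]

end

theorem mainTheorem1 {X : Type*} [MetricSpace X] [MeasurableSpace X] [BorelSpace X]
    (σ : Measure X) [IsFiniteMeasure σ] (hσ : IsDiffuse σ) (hσ0 : 0 < σ Set.univ)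
    (P : Measure (Configuration X)) (hP : IsPoissonMeasure σ P) :
    -- the Poincaré constants
    (poincareConst σ P 2 diffOp = 1 ∧
      2 * poincareConst σ P 2 diffPlus = 1 ∧
      2 * poincareConst σ P 2 diffMinus = 1) ∧
    poincareConst σ P ∞ diffOp = ENNReal.ofReal (1 / σ.real Set.univ) ∧
    -- the isoperimetric constants
    ENNReal.ofReal (1 / √(2 * Real.pi)) ≤ isoperimetricConst σ P 2 diffOp ∧
    (ENNReal.ofReal (max (1 / √(Real.pi * σ.real Set.univ)) (1 / (2 * σ.real Set.univ)))
        ≤ isoperimetricConst σ P ∞ diffOp ∧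
      isoperimetricConst σ P ∞ diffOp
        ≤ ENNReal.ofReal (4 / σ.real Set.univ + 4 / √(σ.real Set.univ))) ∧
    (ENNReal.ofReal (1 / 2) ≤ isoperimetricConst σ P 1 diffOp ∧
      isoperimetricConst σ P 1 diffOp = 2 * isoperimetricConst σ P 1 diffPlus ∧
      isoperimetricConst σ P 1 diffOp = 2 * isoperimetricConst σ P 1 diffMinus ∧
      isoperimetricConst σ P 1 diffOp ≤ ENNReal.ofReal (4 + 4 * √(σ.real Set.univ))) ∧
    (isoperimetricConst σ P 2 diffPlus ^ 2 ≤ isoperimetricConst σ P 1 diffPlus ∧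
      isoperimetricConst σ P 2 diffPlus ≤ ENNReal.ofReal (√(1 + √(σ.real Set.univ)))) ∧
    -- the constants of order infinity for the one-sided gradients
    (poincareConst σ P ∞ diffPlus ≤ 2 * isoperimetricConst σ P ∞ diffPlus ∧
      isoperimetricConst σ P ∞ diffPlus = medianConstPlus σ P ∞ ∧
      isoperimetricConst σ P ∞ diffPlus / 2 ≤ poincareConst σ P ∞ diffOp ^ (1 / 2 : ℝ) ∧
      poincareConst σ P ∞ diffOp ^ (1 / 2 : ℝ) = ENNReal.ofReal (1 / √(σ.real Set.univ))) ∧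
    (poincareConst σ P ∞ diffMinus ≤ 2 * isoperimetricConst σ P ∞ diffMinus ∧
      isoperimetricConst σ P ∞ diffMinus / 2
        ≤ ENNReal.ofReal (1 / σ.real Set.univ + √(2 / σ.real Set.univ))) := by
  have hne : Nonempty X := by
    by_contra h
    rw [not_nonempty_iff] at h
    rw [Set.eq_empty_of_isEmpty Set.univ, measure_empty] at hσ0
    exact lt_irrefl _ hσ0
  have hσne := hσ0.ne'
  have hs : 0 < σ.real Set.univ := ENNReal.toReal_pos hσne (measure_ne_top _ _)
  have hsq : 0 < √(σ.real Set.univ) := Real.sqrt_pos.2 hs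
  have htwo : ∀ {a : ℝ≥0∞} {r : ℝ}, a ≤ ENNReal.ofReal (2 * r) → a / 2 ≤ ENNReal.ofReal r := by
    intro a r h
    refine ENNReal.div_le_of_le_mul ?_
    rwa [mul_comm, show (2 : ℝ≥0∞) = ENNReal.ofReal 2 by simp, ← ENNReal.ofReal_mul (by norm_num)]
  have hinv : (2 : ℝ≥0∞) * 2⁻¹ = 1 := ENNReal.mul_inv_cancel two_ne_zero ENNReal.ofNat_ne_top
  have hl2 : poincareConst σ P 2 diffOp = 1 :=
    poincareConst_two_eq hP hσ hσne fun F hF => by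
      rw [one_mul]; exact lintegral_fieldNorm_two_diffOp hP hσ hF
  have hl2p : poincareConst σ P 2 diffPlus = 2⁻¹ :=
    poincareConst_two_eq hP hσ hσne fun F hF => lintegral_fieldNorm_two_diffPlus hP hσ hF
  have hl2m : poincareConst σ P 2 diffMinus = 2⁻¹ :=
    poincareConst_two_eq hP hσ hσne fun F hF => lintegral_fieldNorm_two_diffMinus hP hσ hF
  have hlinf : poincareConst σ P ∞ diffOp = ENNReal.ofReal (1 / σ.real Set.univ) := by
    rw [poincareConst_top_diffOp hP hσ hσne, one_div, ENNReal.ofReal_inv_of_pos hs,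
      ofReal_measureReal]
  have hlsqrt : poincareConst σ P ∞ diffOp ^ (1 / 2 : ℝ) =
      ENNReal.ofReal (1 / √(σ.real Set.univ)) := by
    rw [hlinf, ENNReal.ofReal_rpow_of_nonneg (by positivity) (by norm_num), ← Real.sqrt_eq_rpow,
      Real.sqrt_div zero_le_one, Real.sqrt_one]
  have hh1p := isoperimetricConst_one_diffOp_eq hP hσ (T := diffPlus)
    fun F hF => lintegral_fieldNorm_one_diffPlus hP hσ hF
  have hh1m := isoperimetricConst_one_diffOp_eq hP hσ (T := diffMinus)
    fun F hF => lintegral_fieldNorm_one_diffMinus hP hσ hF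
  have hh1 := isoperimetricConst_one_diffOp_le hP hσ hs
  have hh2 := isoperimetricConst_two_diffPlus_sq_le hP hσ
  have hh2' : isoperimetricConst σ P 2 diffPlus ^ 2 ≤
      ENNReal.ofReal (1 + √(σ.real Set.univ)) := by
    have h : isoperimetricConst σ P 1 diffPlus = isoperimetricConst σ P 1 diffOp / 2 := by
      rw [hh1p, mul_comm, mul_div_assoc, ENNReal.div_self two_ne_zero ENNReal.ofNat_ne_top, mul_one]
    refine hh2.trans (h.le.trans (htwo (hh1.trans (ENNReal.ofReal_le_ofReal ?_))))
    linarith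
  refine ⟨⟨hl2, by rw [hl2p, hinv], by rw [hl2m, hinv]⟩, hlinf,
    le_isoperimetricConst_two_diffOp hP hσ,
    ⟨le_isoperimetricConst_top_diffOp hP hσ hs,
      (isoperimetricConst_top_diffOp_le hP hσ hs).trans (ENNReal.ofReal_le_ofReal ?_)⟩,
    ⟨half_le_isoperimetricConst_one_diffOp hP hσ, hh1p, hh1m,
      hh1.trans (ENNReal.ofReal_le_ofReal (by linarith))⟩, ⟨hh2, ?_⟩,
    ⟨poincareConst_top_le hP isGradient_diffPlus,
      isoperimetricConst_top_diffPlus_eq_medianConstPlus hP hσ hσne, ?_, hlsqrt⟩,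
    ⟨poincareConst_top_le hP isGradient_diffMinus, htwo
      ((isoperimetricConst_top_diffMinus_le hP hσ hs).trans (ENNReal.ofReal_le_ofReal ?_))⟩⟩
  · rw [add_comm]
    gcongr
    norm_num
  · have h := ENNReal.rpow_le_rpow hh2' (z := 1 / 2) (by norm_num)
    rw [← ENNReal.rpow_natCast, ← ENNReal.rpow_mul, ENNReal.ofReal_rpow_of_nonneg (by positivity)
      (by norm_num), ← Real.sqrt_eq_rpow] at h
    norm_num at h
    exact h
  · rw [hlsqrt]
    refine htwo ((isoperimetricConst_top_diffPlus_le hP hσ hs).trans_eq ?_)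
    rw [mul_one_div]
  · have h : 1 / √(σ.real Set.univ) ≤ √(2 / σ.real Set.univ) := by
      rw [Real.sqrt_div zero_le_two]
      gcongr
      rw [Real.one_le_sqrt]
      norm_num
    have e : 2 / √(σ.real Set.univ) + 2 / σ.real Set.univ =
        2 * (1 / σ.real Set.univ + 1 / √(σ.real Set.univ)) := by ring
    rw [e]
    linarith
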